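/- **Setting.** Let $A=(a_{pq})_{p,q\in P}$ be a simply laced generalized Cartan matrix of untwisted affine type (entries in $\{2,0,-1\}$) with connected Dynkin diagram $\Gamma$, let $o\in P$ be the additional vertex (so the smallest positive imaginary root has coefficient $1$ at $o$), let $A_0$ be the finite type matrix obtained by deleting the row and column $o$, and let $\Delta_0\subset\mathbb Z^P$ be the set of roots of $A_0$, with $\Delta_0^+$ the positive ones. The pairing is $\langle\alpha_q,\alpha_p^\vee\rangle=a_{pq}$. Write $p\,\mathcal C\,q$ if $p=q$ or $p,q$ are adjacent in $\Gamma$. *Heaps.* A labelled heap over $\Gamma$ is a locally finite poset $(E,\le)$ with a map $\varepsilon:E\to P$ such that elements $a,b$ with $\varepsilon(a)\,\mathcal C\,\varepsilon(b)$ are comparable and $\le$ is the transitive closure of $\{(a,b): a\le b,\ \varepsilon(a)\,\mathcal C\,\varepsilon(b)\}$. It is full if every fibre $\varepsilon^{-1}(p)$ is nonempty and unbounded above and below; if for adjacent $p,p'$ every element labelled $p$ covers or is covered by an element labelled $p'$; and if $\sum_{a<c<b}a_{p,\varepsilon(c)}=-2$ whenever $a<b$ are labelled $p$ and no element of the open interval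 $(a,b)$ is labelled $p$. Let $E$ be a full heap over $\Gamma$. *Folding.* Let $\mu$ be an automorphism of $\Gamma$ of order $2$ such that $p,\mu(p)$ are never distinct adjacent vertices. Let $\bar P$ be the set of $\mu$-orbits $\bar p$. Let $\bar A$ be the matrix indexed by $\bar P$ with diagonal entries $2$ and, for $\bar p\ne\bar q$: $\bar a_{\bar p\bar q}=-2$ if some $p'\in\bar p$, $q'\in\bar q$ satisfy $p'\neq\mu(p')$ and $q'$ is adjacent to both $p'$ and $\mu(p')$; otherwise $-1$ if some members of the two orbits are adjacent; otherwise $0$. Let $f:\mathbb Z^P\to\mathbb Z^{\bar P}$ be linear with $f(\alpha_p)=\alpha_{\bar p}$, and let $\mu(\alpha_p)=\alpha_{\mu(p)}$. Suppose that elements of $E$ with labels $p,q$ are comparable whenever $\mu(p)\,\mathcal C\,q$; then $E$ folds to $\bar E$, the same poset with labels $\overline{\varepsilon(a)}$. Let $\bar P_0=\{\bar p: p\ne o\}$, and suppose that the submatrix $\bar A_0$ of $\bar A$ indexed by $\bar P_0$ is of finite type and that $f$ sends the roots of $A_0$ to roots of $\bar A_0$. *Operators.* Fix an orientation of the edges of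 $\Gamma$; put $\mathrm{sgn}(p,q)=-1$ if $p=q$ or there is an arrow from $p$ to $q$, and $1$ otherwise, and suppose $\mathrm{sgn}(\mu(p),\mu(q))=\mathrm{sgn}(p,q)$ for all $p,q$. Extend $\mathrm{sgn}$ bimultiplicatively to $\mathbb Z^P$, and for a finite convex $L\subseteq E$ let $\mathrm{sgn}(L)=\prod_{a,b\in L,\,a>b}\mathrm{sgn}(\varepsilon(a),\varepsilon(b))$. For a vector $\gamma$ with entries indexed by $P$ (respectively $\bar P$), let $\mathcal L_\gamma(E)$ (respectively $\mathcal L_\gamma(\bar E)$) be the set of finite convex subsets with exactly $\gamma(p)$ elements of each label $p$. Let $k$ be a field of characteristic $\ne2$ and let $V_{\bar E}$ be the $k$-space with basis $v_I$, where $I$ runs over the proper ideals of $\bar E$ (the down-closed sets meeting every fibre of the labelling in a nonempty proper subset of it). Put $X_Lv_I=v_{I\cup L}$ if $I\cap L=\emptyset$ and $I\cup L$ is an ideal (written $L\succ I$), and $0$ otherwise; $Y_Lv_I=v_{I\setminus L}$ if $L\subseteq I$ and $I\setminus L$ is an ideal (written $L\prec I$), and $0$ otherwise; $H_Lv_I=v_I$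 if $L\prec I$ and $L\not\succ I$, $-v_I$ if $L\succ I$ and $L\not\prec I$, and $0$ otherwise. For a vertex $x\in\bar P$, let $X_x,Y_x,H_x$ be the sums of the $X_L,Y_L,H_L$ over all one-element $L$ labelled $x$ in $\bar E$; for $\gamma\in\mathbb Z^{\bar P}$ let $X_\gamma=\sum_{L\in\mathcal L_\gamma(\bar E)}\mathrm{sgn}(L)X_L$ and $Y_\gamma=\sum_{L\in\mathcal L_\gamma(\bar E)}\mathrm{sgn}(L)Y_L$. *Kac's Chevalley basis.* Let $\bar\Delta_0=f(\Delta_0)$. Let $\bar{\mathfrak g}_0$ be the complex Lie algebra with basis $\alpha_x^\vee$ $(x\in\bar P_0)$ and $E_\gamma$ $(\gamma\in\bar\Delta_0)$ and brackets $[\alpha_x^\vee,\alpha_y^\vee]=0$; $[\alpha_x^\vee,E_\gamma]=\langle\gamma,\alpha_x^\vee\rangle E_\gamma$ with $\langle\alpha_y,\alpha_x^\vee\rangle=\bar a_{xy}$; $[E_\gamma,E_{-\gamma}]=-\gamma^\vee$; $[E_\gamma,E_{\gamma'}]=0$ if $\gamma+\gamma'\notin\bar\Delta_0\cup\{0\}$;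 and $[E_{f(\alpha)},E_{f(\beta)}]=(m+1)\,\mathrm{sgn}(\alpha,\beta)\,E_{f(\alpha+\beta)}$ if $\alpha,\beta,\alpha+\beta\in\Delta_0$, where $m$ is the largest integer with $f(\alpha)-mf(\beta)\in\bar\Delta_0$. Here, for $\alpha=\sum_p\lambda_p\alpha_p\in\Delta_0$, $f(\alpha)^\vee=\sum_p\lambda_p\frac{|f(\alpha_p)|^2}{|f(\alpha)|^2}\alpha_{\bar p}^\vee$, where $|f(\beta)|^2$ is $2$ if $\mu(\beta)=\beta$ and $1$ otherwise. **Proposition 6.5.** For every $\alpha\in\Delta_0^+$: (i) $\mathcal L_{f(\alpha)}(\bar E)\neq\emptyset$, and every $L\in\mathcal L_{f(\alpha)}(\bar E)$ lies in $\mathcal L_\alpha(E)\cup\mathcal L_{\mu(\alpha)}(E)$. (ii) $X_{f(\alpha)}$ is nonzero and lies in the Lie algebra generated by the operators $X_x$ $(x\in\bar P)$ on $V_{\bar E}$. (iii) $Y_{f(\alpha)}$ is nonzero and lies in the Lie algebra generated by the operators $Y_x$ $(x\in\bar P)$ on $V_{\bar E}$. Moreover, for $k=\mathbb C$ there is a representation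 $\rho$ of $\bar{\mathfrak g}_0$ on $V_{\bar E}$ in which $E_{\alpha_x}$, $-E_{-\alpha_x}$, $\alpha_x^\vee$ act as $X_x,Y_x,H_x$ for all $x\in\bar P_0$, and in it $\rho(E_{f(\alpha)})=X_{f(\alpha)}$ and $\rho(-E_{-f(\alpha)})=Y_{f(\alpha)}$ for all $\alpha\in\Delta_0^+$. -/

import Mathlib

namespace FoldedHeap

/-! ## Generalized Cartan matrices, roots -/

section Cartan

variable {ι : Type*}

/-- Generalized Cartan matrices. -/
structure IsGCM (A : Matrix ι ι ℤ) : Prop where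
  diag : ∀ i, A i i = 2
  nonpos : ∀ i j, i ≠ j → A i j ≤ 0
  zero_iff : ∀ i j, A i j = 0 ↔ A j i = 0

/-- Adjacency of two (distinct) vertices in the Dynkin diagram. -/
def Adj (A : Matrix ι ι ℤ) (i j : ι) : Prop := i ≠ j ∧ A i j ≠ 0

/-- Two vertices are concurrent if they are equal or adjacent. -/
def Conc (A : Matrix ι ι ℤ) (i j : ι) : Prop := i = j ∨ Adj A i j

/-- The Dynkin diagram is connected. -/
def Indecomposable (A : Matrix ι ι ℤ) : Prop := ∀ i j, Relation.ReflTransGen (Adj A) i j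

/-- Simply laced: all entries lie in `{2, 0, -1}`. -/
def SimplyLaced (A : Matrix ι ι ℤ) : Prop := ∀ i j, A i j = 2 ∨ A i j = 0 ∨ A i j = -1

open Classical in
/-- The matrix `A` is of finite type: `det A ≠ 0`; there is `u > 0` with `A u > 0`; and
`A v ≥ 0` implies `v > 0` or `v = 0`. -/
def IsFiniteType [Fintype ι] (A : Matrix ι ι ℤ) : Prop :=
  A.det ≠ 0 ∧
  (∃ u : ι → ℝ, (∀ i, 0 < u i) ∧ ∀ i, 0 < (A.map (Int.cast : ℤ → ℝ)).mulVec u i) ∧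
  ∀ v : ι → ℝ, (∀ i, 0 ≤ (A.map (Int.cast : ℤ → ℝ)).mulVec v i) → (∀ i, 0 < v i) ∨ v = 0

/-- The matrix `A` is of affine type: `A` has corank `1`; there is `u > 0` with `A u = 0`; and
`A v ≥ 0` implies `A v = 0`. -/
def IsAffineType [Fintype ι] (A : Matrix ι ι ℤ) : Prop :=
  (A.map (Int.cast : ℤ → ℝ)).rank + 1 = Fintype.card ι ∧
  (∃ u : ι → ℝ, (∀ i, 0 < u i) ∧ (A.map (Int.cast : ℤ → ℝ)).mulVec u = 0) ∧
  ∀ v : ι → ℝ, (∀ i, 0 ≤ (A.map (Int.cast : ℤ → ℝ)).mulVec v i) →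
    (A.map (Int.cast : ℤ → ℝ)).mulVec v = 0

/-- `A` is a simply laced generalized Cartan matrix of untwisted affine type, with additional
vertex `o`.  (Simply laced affine matrices are automatically untwisted.)  The vertex `o` can be
the additional vertex, i.e. the smallest positive imaginary root `δ` is `α_o + θ` with `θ` the
highest root of the diagram with `o` removed, exactly when `δ` has coefficient `1` at `o`. -/
structure IsSimplyLacedAffine [Fintype ι] (A : Matrix ι ι ℤ) (o : ι) : Prop where
  gcm : IsGCM A
  indecomposable : Indecomposable A
  simplyLaced : SimplyLaced A
  affine : IsAffineType A
  mark_one : ∃ d : ι → ℤ, (∀ i, 0 < d i) ∧ A.mulVec d = 0 ∧ d o = 1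

open Classical in
/-- The simple root `α_i`, as an element of `ℤ^ι` (the element `∑ a_i α_i` of the root lattice is
the function `i ↦ a_i`). -/
noncomputable def simpleRoot (i : ι) : ι → ℤ := Pi.single i 1

/-- The simple reflection `s_i v = v - ⟨v, α_i^∨⟩ α_i`, where `⟨α_j, α_i^∨⟩ = a_{ij}`. -/
noncomputable def reflect [Fintype ι] (A : Matrix ι ι ℤ) (i : ι) (v : ι → ℤ) : ι → ℤ :=
  v - A.mulVec v i • simpleRoot i

/-- The real roots of the principal submatrix of `A` with index set `S` (elements of the Weyl group
orbits of the simple roots), extended by zero outside `S`.  If the submatrix is of finite type,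
these are all of its roots. -/
inductive IsRoot [Fintype ι] (A : Matrix ι ι ℤ) (S : Set ι) : (ι → ℤ) → Prop
  | simple (i : ι) (hi : i ∈ S) : IsRoot A S (simpleRoot i)
  | refl (i : ι) (hi : i ∈ S) (v : ι → ℤ) (hv : IsRoot A S v) : IsRoot A S (reflect A i v)

end Cartan

/-! ## Heaps -/

section Heaps

variable {P E : Type*} [PartialOrder E]

/-- `(E, ≤, ε)` is a labelled heap over the Dynkin diagram of `A`. -/
structure IsHeap (A : Matrix P P ℤ) (ε : E → P) : Prop where
  locallyFinite : ∀ a b : E, (Set.Icc a b).Finite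
  comparable : ∀ a b : E, Conc A (ε a) (ε b) → a ≤ b ∨ b ≤ a
  le_iff : ∀ a b : E, a ≤ b ↔ Relation.TransGen (fun x y => x ≤ y ∧ Conc A (ε x) (ε y)) a b

/-- Fibred heaps: every fibre of the labelling is a (nonempty) chain that is unbounded above and
below, and for adjacent vertices `p, p'` each element labelled `p` covers or is covered by an
element labelled `p'`. -/
structure IsFibred (A : Matrix P P ℤ) (ε : E → P) : Prop extends IsHeap A ε where
  nonempty : ∀ p, ∃ a, ε a = p
  unbounded : ∀ a, (∃ b, ε b = ε a ∧ a < b) ∧ (∃ b, ε b = ε a ∧ b < a)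
  covers : ∀ p p', Adj A p p' → ∀ a, ε a = p → ∃ b, ε b = p' ∧ (a ⋖ b ∨ b ⋖ a)

/-- Full heaps. -/
structure IsFull (A : Matrix P P ℤ) (ε : E → P) : Prop extends IsFibred A ε where
  full : ∀ a b : E, a < b → ε a = ε b → (∀ c ∈ Set.Ioo a b, ε c ≠ ε a) →
    ∑ᶠ c ∈ Set.Ioo a b, A (ε a) (ε c) = -2

/-- Proper ideals: lower sets that meet every fibre of the labelling in a nonempty proper subset of
that fibre. -/
def IsProperIdeal (ε : E → P) (I : Set E) : Prop :=
  IsLowerSet I ∧ I.Nonempty ∧ I ≠ Set.univ ∧ ∀ p, (∃ a ∈ I, ε a = p) ∧ ∃ a ∉ I, ε a = p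

/-- The set of proper ideals. -/
def ProperIdeal (ε : E → P) : Type _ := {I : Set E // IsProperIdeal ε I}

/-- The space `V_E`, with basis `v_I` indexed by the proper ideals. -/
abbrev VE (k : Type*) [Field k] (ε : E → P) : Type _ := ProperIdeal ε →₀ k

/-- `L ≻ I`. -/
def Above (L : Finset E) (I : Set E) : Prop := IsLowerSet (I ∪ ↑L) ∧ I ∩ ↑L = ∅

/-- `L ≺ I`. -/
def Below (L : Finset E) (I : Set E) : Prop := (L : Set E) ⊆ I ∧ IsLowerSet (I \ ↑L)

open Classical in
/-- The character of a finite subheap: the number of elements with each label. -/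
noncomputable def character (ε : E → P) (L : Finset E) : P → ℤ :=
  fun p => ((L.filter fun a => ε a = p).card : ℤ)

/-- The set `L_γ(E)` of all finite convex subheaps of character `γ`. -/
def heapsOf (ε : E → P) (γ : P → ℤ) : Set (Finset E) :=
  {L | (L : Set E).OrdConnected ∧ character ε L = γ}

section Operators

variable (k : Type*) [Field k] (ε : E → P)

open Classical in
/-- `X_L (v_I) = v_{I ∪ L}` if `L ≻ I`, and `0` otherwise.  (In a full heap, if `L ≻ I`, then
`I ∪ L` is automatically a proper ideal.) -/
noncomputable def XL (L : Finset E) : Module.End k (VE k ε) :=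
  Finsupp.linearCombination k fun I : ProperIdeal ε =>
    if h : Above L I.1 ∧ IsProperIdeal ε (I.1 ∪ ↑L) then Finsupp.single ⟨I.1 ∪ ↑L, h.2⟩ 1 else 0

open Classical in
/-- `Y_L (v_I) = v_{I \ L}` if `L ≺ I`, and `0` otherwise.  (In a full heap, if `L ≺ I`, then
`I \ L` is automatically a proper ideal.) -/
noncomputable def YL (L : Finset E) : Module.End k (VE k ε) :=
  Finsupp.linearCombination k fun I : ProperIdeal ε =>
    if h : Below L I.1 ∧ IsProperIdeal ε (I.1 \ ↑L) then Finsupp.single ⟨I.1 \ ↑L, h.2⟩ 1 else 0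

open Classical in
/-- `H_L (v_I)` is `v_I` if `L ≺ I` and not `L ≻ I`, it is `-v_I` if `L ≻ I` and not `L ≺ I`, and
it is `0` otherwise. -/
noncomputable def HL (L : Finset E) : Module.End k (VE k ε) :=
  Finsupp.linearCombination k fun I : ProperIdeal ε =>
    if Below L I.1 ∧ ¬ Above L I.1 then Finsupp.single I 1
    else if Above L I.1 ∧ ¬ Below L I.1 then - Finsupp.single I 1 else 0

/-- The possibly infinite sum `∑_{L ∈ S} c(L) T_L` of operators, to be used when, for each `v_I`,
only finitely many summands act on `v_I` in a nonzero way. -/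
noncomputable def sumOp (S : Set (Finset E)) (c : Finset E → ℤˣ)
    (T : Finset E → Module.End k (VE k ε)) : Module.End k (VE k ε) :=
  Finsupp.linearCombination k fun I : ProperIdeal ε =>
    ∑ᶠ L ∈ S, ((c L : ℤ) : k) • T L (Finsupp.single I 1)

/-- `X_p = ∑ X_L`, over the one-element subheaps `L` labelled `p`. -/
noncomputable def Xv (p : P) : Module.End k (VE k ε) :=
  sumOp k ε (heapsOf ε (simpleRoot p)) (fun _ => 1) (XL k ε)

/-- `Y_p = ∑ Y_L`, over the one-element subheaps `L` labelled `p`. -/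
noncomputable def Yv (p : P) : Module.End k (VE k ε) :=
  sumOp k ε (heapsOf ε (simpleRoot p)) (fun _ => 1) (YL k ε)

/-- `H_p = ∑ H_L`, over the one-element subheaps `L` labelled `p`. -/
noncomputable def Hv (p : P) : Module.End k (VE k ε) :=
  sumOp k ε (heapsOf ε (simpleRoot p)) (fun _ => 1) (HL k ε)

/-- `X_γ = ∑_{L ∈ L_γ} sgn(L) X_L`, for a given parity function `sgn`. -/
noncomputable def Xop (sgn : Finset E → ℤˣ) (γ : P → ℤ) : Module.End k (VE k ε) :=
  sumOp k ε (heapsOf ε γ) sgn (XL k ε)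

/-- `Y_γ = ∑_{L ∈ L_γ} sgn(L) Y_L`, for a given parity function `sgn`. -/
noncomputable def Yop (sgn : Finset E → ℤˣ) (γ : P → ℤ) : Module.End k (VE k ε) :=
  sumOp k ε (heapsOf ε γ) sgn (YL k ε)

end Operators

end Heaps

/-! ## Orientations and parity -/

section Parity

variable {P E : Type*}

/-- `arrow` is an orientation of the Dynkin diagram of `A`: each edge gets exactly one of its two
directions. -/
structure IsOrientation (A : Matrix P P ℤ) (arrow : P → P → Prop) : Prop where
  adj : ∀ p q, arrow p q → Adj A p q
  xor : ∀ p q, Adj A p q → Xor (arrow p q) (arrow q p)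

open Classical in
/-- `sgn(p, q)` is `-1` if `p = q` or if there is an arrow from `p` to `q`, and `1` otherwise. -/
noncomputable def sgn (arrow : P → P → Prop) (p q : P) : ℤˣ := if p = q ∨ arrow p q then -1 else 1

/-- The bimultiplicative extension of `sgn` to the root lattice (an asymmetry function). -/
noncomputable def sgnLattice [Fintype P] (arrow : P → P → Prop) (a b : P → ℤ) : ℤˣ :=
  ∏ p, ∏ q, sgn arrow p q ^ (a p * b q)

open Classical in
/-- The parity `sgn(L) = ∏ sgn(ε(a), ε(b))`, over all pairs `a > b` in `L`, of a finite convex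
subheap. -/
noncomputable def parity [PartialOrder E] (arrow : P → P → Prop) (ε : E → P) (L : Finset E) : ℤˣ :=
  ∏ x ∈ (L ×ˢ L).filter (fun x => x.2 < x.1), sgn arrow (ε x.1) (ε x.2)

end Parity

/-! ## Folding -/

section Folding

variable {P : Type*}

/-- `μ` is a nonidentity graph automorphism, of order two, such that `p` and `μ p` are never
distinct adjacent vertices. -/
structure Folds (A : Matrix P P ℤ) (μ : Equiv.Perm P) : Prop where
  auto : ∀ p q, A (μ p) (μ q) = A p q
  ne_one : μ ≠ 1
  sq_eq_one : μ * μ = 1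
  not_adj : ∀ p, ¬ Adj A p (μ p)

/-- The orbits of `μ`, that is, the vertices of the folded diagram. -/
def Orb (μ : Equiv.Perm P) : Type _ := Quotient (Equiv.Perm.SameCycle.setoid μ)

/-- The orbit of a vertex. -/
def bar (μ : Equiv.Perm P) (p : P) : Orb μ := Quotient.mk _ p

instance (μ : Equiv.Perm P) [Finite P] : Finite (Orb μ) :=
  inferInstanceAs (Finite (Quotient _))

noncomputable instance (μ : Equiv.Perm P) [Finite P] : Fintype (Orb μ) := Fintype.ofFinite _

open Classical in
/-- The folded matrix.  Distinct orbits are adjacent if some of their members are.  If `q` is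
adjacent to both `p` and `μ p`, where `p ≠ μ p`, then the orbits of `p` and `q` are joined by a
double edge with an arrow towards the orbit of `p`, that is, the entry in the row of the orbit of
`p` and the column of the orbit of `q` is `-2`. -/
noncomputable def foldedMatrix (A : Matrix P P ℤ) (μ : Equiv.Perm P) : Matrix (Orb μ) (Orb μ) ℤ :=
  fun x y =>
    if x = y then 2
    else if ∃ p q, bar μ p = x ∧ bar μ q = y ∧ p ≠ μ p ∧ Adj A p q ∧ Adj A (μ p) q then -2
    else if ∃ p q, bar μ p = x ∧ bar μ q = y ∧ Adj A p q then -1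
    else 0

/-- The vertices of the folded diagram that are orbits of vertices other than `o`. -/
def finiteOrbs (μ : Equiv.Perm P) (o : P) : Set (Orb μ) := bar μ '' {p | p ≠ o}

noncomputable instance (μ : Equiv.Perm P) (o : P) [Finite P] : Fintype (finiteOrbs μ o) :=
  Fintype.ofFinite _

/-- The folded matrix with only the rows and columns of orbits of vertices other than `o`. -/
noncomputable def foldedFinite (A : Matrix P P ℤ) (μ : Equiv.Perm P) (o : P) :
    Matrix (finiteOrbs μ o) (finiteOrbs μ o) ℤ :=
  (foldedMatrix A μ).submatrix Subtype.val Subtype.val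

open Classical in
/-- The map `f`, i.e. the linear map with `f(α_p) = α_{bar p}`. -/
noncomputable def fold [Fintype P] (μ : Equiv.Perm P) (a : P → ℤ) : Orb μ → ℤ :=
  fun x => ∑ p with bar μ p = x, a p

/-- The action of `μ` on the root lattice, `μ(α_p) = α_{μ p}`. -/
def act (μ : Equiv.Perm P) (a : P → ℤ) : P → ℤ := fun p => a (μ.symm p)

/-- The condition under which a heap folds: elements with labels `p` and `q` are comparable if
`μ p` and `q` are concurrent. -/
def HeapFolds {E : Type*} [PartialOrder E] (A : Matrix P P ℤ) (μ : Equiv.Perm P) (ε : E → P) :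
    Prop :=
  ∀ p q, Conc A (μ p) q → ∀ a b, ε a = p → ε b = q → a ≤ b ∨ b ≤ a

/-- The labelling of the folded heap; its underlying poset is unchanged. -/
def barLabel {E : Type*} (μ : Equiv.Perm P) (ε : E → P) : E → Orb μ := fun a => bar μ (ε a)

/-- The orientation is compatible with `μ`. -/
def Compatible (μ : Equiv.Perm P) (arrow : P → P → Prop) : Prop :=
  ∀ p q, sgn arrow p q = sgn arrow (μ p) (μ q)

end Folding

/-! ## Kac's form of the folded finite dimensional Lie algebra -/

section Kac

variable {P : Type*} [Fintype P]

/-- The roots `f(α)`, for `α` a root of the diagram with `o` removed. -/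
def foldedRoots (A : Matrix P P ℤ) (μ : Equiv.Perm P) (o : P) : Set (Orb μ → ℤ) :=
  fold μ '' {a | IsRoot A {p | p ≠ o} a}

/-- Basis symbols: simple coroots and root vectors. -/
inductive Gen (A : Matrix P P ℤ) (μ : Equiv.Perm P) (o : P)
  | h (x : finiteOrbs μ o) : Gen A μ o
  | e (γ : foldedRoots A μ o) : Gen A μ o

variable (A : Matrix P P ℤ) (μ : Equiv.Perm P) (o : P) (arrow : P → P → Prop)

/-- The symbol for the simple coroot attached to `x`. -/
noncomputable def symH (x : finiteOrbs μ o) : FreeLieAlgebra ℂ (Gen A μ o) :=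
  FreeLieAlgebra.of ℂ (Gen.h x)

open Classical in
/-- The symbol `E_γ` if `γ` is one of the roots `f(α)`, and `0` if it is not. -/
noncomputable def symE (γ : Orb μ → ℤ) : FreeLieAlgebra ℂ (Gen A μ o) :=
  if h : γ ∈ foldedRoots A μ o then FreeLieAlgebra.of ℂ (Gen.e ⟨γ, h⟩) else 0

open Classical in
/-- The squared length of `f(α)`: the root `f(α)` is long if `μ(α) = α` and short otherwise. -/
noncomputable def sqLen (a : P → ℤ) : ℂ := if act μ a = a then 2 else 1

/-- The coroot `f(α)^∨ = ∑ a_p (|f(α_p)|² / |f(α)|²) f(α_p)^∨`, where `α = ∑ a_p α_p`. -/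
noncomputable def symCoroot (a : P → ℤ) : FreeLieAlgebra ℂ (Gen A μ o) :=
  open Classical in
  ∑ p : {p : P // p ≠ o},
    ((a p : ℂ) * (sqLen μ (simpleRoot (p : P)) / sqLen μ a)) •
      symH A μ o ⟨bar μ p, Set.mem_image_of_mem _ p.2⟩

/-- The commutation relations between the symbols, i.e. the elements that are to be set to zero. -/
inductive IsRelator : FreeLieAlgebra ℂ (Gen A μ o) → Prop
  | hh (x y : finiteOrbs μ o) : IsRelator ⁅symH A μ o x, symH A μ o y⁆
  | he (x : finiteOrbs μ o) (γ : Orb μ → ℤ) (hγ : γ ∈ foldedRoots A μ o) :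
      IsRelator (⁅symH A μ o x, symE A μ o γ⁆ -
        (((foldedMatrix A μ).mulVec γ x : ℤ) : ℂ) • symE A μ o γ)
  | ee_neg (a : P → ℤ) (ha : IsRoot A {p | p ≠ o} a) :
      IsRelator (⁅symE A μ o (fold μ a), symE A μ o (-fold μ a)⁆ + symCoroot A μ o a)
  | ee_zero (γ γ' : Orb μ → ℤ) (hγ : γ ∈ foldedRoots A μ o) (hγ' : γ' ∈ foldedRoots A μ o)
      (h : γ + γ' ∉ foldedRoots A μ o) (h0 : γ + γ' ≠ 0) :
      IsRelator ⁅symE A μ o γ, symE A μ o γ'⁆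
  | ee_add (a b : P → ℤ) (ha : IsRoot A {p | p ≠ o} a) (hb : IsRoot A {p | p ≠ o} b)
      (hab : IsRoot A {p | p ≠ o} (a + b)) (m : ℕ)
      (hm : IsGreatest {n : ℕ | fold μ a - (n : ℤ) • fold μ b ∈ foldedRoots A μ o} m) :
      IsRelator (⁅symE A μ o (fold μ a), symE A μ o (fold μ b)⁆ -
        (((m : ℤ) + 1) * (sgnLattice arrow a b : ℤ)) • symE A μ o (fold μ (a + b)))

/-- Kac's form of the folded Lie algebra over `ℂ`.  It has basis the simple coroots `α_x^∨`
(`x` an orbit of vertices other than `o`) and the root vectors `E_γ` (`γ` one of the roots `f(α)`),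
with
`[α_x^∨, α_y^∨] = 0`, `[α_x^∨, E_γ] = ⟨γ, α_x^∨⟩ E_γ`, `[E_γ, E_{-γ}] = -γ^∨`,
`[E_γ, E_γ'] = 0` if `γ + γ'` is neither a root nor zero, and
`[E_{f(α)}, E_{f(β)}] = (m + 1) sgn(α, β) E_{f(α + β)}` if `α`, `β` and `α + β` are roots, where
`m` is the largest integer such that `f(α) - m f(β)` is a root.
These relations express every bracket of two basis symbols as a linear combination of basis
symbols, so that presenting the Lie algebra by them amounts to giving its multiplication table. -/
abbrev KacAlgebra : Type _ :=
  FreeLieAlgebra ℂ (Gen A μ o) ⧸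
    (LieSubmodule.lieSpan ℂ (FreeLieAlgebra ℂ (Gen A μ o)) {r | IsRelator A μ o arrow r} :
      LieIdeal ℂ (FreeLieAlgebra ℂ (Gen A μ o)))

/-- The simple coroot `α_x^∨` in Kac's Lie algebra. -/
noncomputable def kacH (x : finiteOrbs μ o) : KacAlgebra A μ o arrow :=
  LieSubmodule.Quotient.mk (symH A μ o x)

/-- The element `E_γ` of Kac's Lie algebra (`0` if `γ` is not one of the roots `f(α)`). -/
noncomputable def kacE (γ : Orb μ → ℤ) : KacAlgebra A μ o arrow :=
  LieSubmodule.Quotient.mk (symE A μ o γ)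

end Kac

end FoldedHeap

open FoldedHeap
attribute [local instance 100] LieRing.ofAssociativeRing

/-! Proper ideals of the heap behave like the weights of a minuscule module. Relative to a base
ideal, every ideal has a position in the root lattice (`FullFolding.rel`). It also has a weight
(`idealWt`), whose labels fullness confines to -1, 0, 1 and which moves by `A` times the change of
position. A simple root can be added to a position exactly when the label is -1. Hence simple
reflections permute the ideals, and the criterion spreads from simple roots to all real roots
(`LatticeModel.pair_root`). The parity of convex sets extends to a sign on pairs of ideals that
satisfies the cocycle rule of `sgn` (`FullFolding.relSign_mul`). These properties, collected in
`LatticeModel`, already give the simply laced relations for the operators `rootOp`.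

Folding rests on two facts. The fibres of the folded labelling are chains, so an ideal is determined
by its folded position (`FullFolding.eq_of_fold_rel_eq_zero`). And a difference of positions that
folds to f(a), for a root a, is a or μ(a) (`FoldedModel.eq_or_eq_act`): lifted reflections reduce to
simple roots and show that it is a root, and the norm of a + μ(a), which can only be 4 or 8,
determines the fibres of f on roots. Hence the operator of f(a) is E_a when μ(a) = a, and E_a +
E_{μ(a)} otherwise. Expanding commutators yields Kac's relations; the factor m + 1 is 2 exactly when
a and b are moved by μ but a + b is fixed (`FoldedModel.op_lie_of_add`).

The heap operators are then recognised as model operators (`FullFolding.Xop_eq`,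
`FullFolding.Yop_eq`, `FullFolding.Hv_eq`). Part (i) holds because a nonempty finite convex set is a
difference of two ideals. Parts (ii) and (iii) build a positive root by adding one simple root at a
time and dividing by structure constants ±1 or ±2, which is where the characteristic enters. The
representation is defined on the free Lie algebra and annihilates the relators. -/

namespace FoldedHeap

/-! ### The bilinear form of `A` and the simple reflections. -/

section Form

variable {ι : Type*}

open Classical in
theorem simpleRoot_apply (i j : ι) : simpleRoot i j = if j = i then 1 else 0 := by
  simp [simpleRoot, Pi.single_apply]

@[simp] theorem simpleRoot_self (i : ι) : simpleRoot i i = 1 := by simp [simpleRoot_apply]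

theorem simpleRoot_of_ne {i j : ι} (h : j ≠ i) : simpleRoot i j = 0 := by
  simp [simpleRoot_apply, h]

variable [Fintype ι] (A : Matrix ι ι ℤ)

/-- The bilinear form on the root lattice with Gram matrix `A`. -/
def form (a b : ι → ℤ) : ℤ := a ⬝ᵥ A.mulVec b

theorem form_add_left (a b c : ι → ℤ) : form A (a + b) c = form A a c + form A b c := by
  simp [form, add_dotProduct]

theorem form_add_right (a b c : ι → ℤ) : form A a (b + c) = form A a b + form A a c := by
  simp [form, Matrix.mulVec_add, dotProduct_add]

theorem form_sub_left (a b c : ι → ℤ) : form A (a - b) c = form A a c - form A b c := by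
  simp [form, sub_dotProduct]

theorem form_sub_right (a b c : ι → ℤ) : form A a (b - c) = form A a b - form A a c := by
  simp [form, Matrix.mulVec_sub, dotProduct_sub]

theorem form_smul_left (n : ℤ) (a b : ι → ℤ) : form A (n • a) b = n * form A a b := by
  rw [form, smul_dotProduct, smul_eq_mul, form]

theorem form_smul_right (n : ℤ) (a b : ι → ℤ) : form A a (n • b) = n * form A a b := by
  rw [form, Matrix.mulVec_smul, dotProduct_smul, smul_eq_mul, form]

theorem form_neg_left (a b : ι → ℤ) : form A (-a) b = -form A a b := by
  simp [form, neg_dotProduct]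

theorem form_neg_right (a b : ι → ℤ) : form A a (-b) = -form A a b := by
  simp [form, Matrix.mulVec_neg, dotProduct_neg]

theorem form_simpleRoot_left (i : ι) (b : ι → ℤ) :
    form A (simpleRoot i) b = A.mulVec b i := by
  classical
  simp [form, dotProduct, simpleRoot_apply]

theorem mulVec_simpleRoot (i j : ι) : A.mulVec (simpleRoot i) j = A j i := by
  classical
  simp [Matrix.mulVec, dotProduct, simpleRoot_apply]

theorem form_comm {A : Matrix ι ι ℤ} (hA : A.IsSymm) (a b : ι → ℤ) :
    form A a b = form A b a := by
  rw [form, Matrix.dotProduct_mulVec, ← Matrix.mulVec_transpose, hA.eq, dotProduct_comm, form]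

theorem reflect_eq (i : ι) (v : ι → ℤ) :
    reflect A i v = v - form A (simpleRoot i) v • simpleRoot i := by
  rw [form_simpleRoot_left, reflect]

theorem reflect_add (i : ι) (v w : ι → ℤ) :
    reflect A i (v + w) = reflect A i v + reflect A i w := by
  simp only [reflect_eq, form_add_right]; module

theorem reflect_neg (i : ι) (v : ι → ℤ) : reflect A i (-v) = -reflect A i v := by
  simp only [reflect_eq, form_neg_right]; module

theorem reflect_sub (i : ι) (v w : ι → ℤ) :
    reflect A i (v - w) = reflect A i v - reflect A i w := by
  simp only [reflect_eq, form_sub_right]; module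

theorem reflect_smul (i : ι) (n : ℤ) (v : ι → ℤ) :
    reflect A i (n • v) = n • reflect A i v := by
  simp only [reflect_eq, form_smul_right]; module

variable {A}

theorem reflect_reflect {i : ι} (h : A i i = 2) (v : ι → ℤ) :
    reflect A i (reflect A i v) = v := by
  have : form A (simpleRoot i) (simpleRoot i) = 2 := by
    rw [form_simpleRoot_left, mulVec_simpleRoot, h]
  simp only [reflect_eq, form_sub_right, form_smul_right, this]
  module

theorem form_reflect_reflect (hA : A.IsSymm) {i : ι} (h : A i i = 2) (v w : ι → ℤ) :
    form A (reflect A i v) (reflect A i w) = form A v w := by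
  have : form A (simpleRoot i) (simpleRoot i) = 2 := by
    rw [form_simpleRoot_left, mulVec_simpleRoot, h]
  simp only [reflect_eq, form_sub_right, form_smul_right, form_sub_left, form_smul_left, this,
    form_comm hA v (simpleRoot i)]
  ring

theorem form_reflect_left (hA : A.IsSymm) {i : ι} (h : A i i = 2) (v w : ι → ℤ) :
    form A (reflect A i v) w = form A v (reflect A i w) := by
  rw [← form_reflect_reflect hA h, reflect_reflect h]

end Form

/-! ### Real roots for a symmetric matrix. -/

section Roots

variable {ι : Type*} [Fintype ι] {A : Matrix ι ι ℤ} {S : Set ι}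

theorem IsRoot.form_self (hA : A.IsSymm) (h2 : ∀ i, A i i = 2) {a : ι → ℤ} (ha : IsRoot A S a) :
    form A a a = 2 := by
  induction ha with
  | simple i hi => rw [form_simpleRoot_left, mulVec_simpleRoot, h2]
  | refl i hi v hv ih => rwa [form_reflect_reflect hA (h2 i)]

theorem IsRoot.apply_eq_zero {a : ι → ℤ} (ha : IsRoot A S a) {p : ι} (hp : p ∉ S) : a p = 0 := by
  induction ha with
  | simple i hi => exact simpleRoot_of_ne fun h => hp (h ▸ hi)
  | refl i hi v hv ih =>
    have hpi : p ≠ i := fun h => hp (h ▸ hi)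
    simp [reflect, ih, simpleRoot_of_ne hpi]

theorem IsRoot.neg (h2 : ∀ i, A i i = 2) {a : ι → ℤ} (ha : IsRoot A S a) : IsRoot A S (-a) := by
  induction ha with
  | simple i hi =>
    have := IsRoot.refl (A := A) i hi _ (IsRoot.simple i hi)
    rw [reflect, mulVec_simpleRoot, h2] at this
    convert this using 1
    module
  | refl i hi v hv ih => rw [← reflect_neg]; exact ih.refl i hi

theorem IsRoot.sub_form_smul (hA : A.IsSymm) (h2 : ∀ i, A i i = 2) {a b : ι → ℤ}
    (ha : IsRoot A S a) (hb : IsRoot A S b) : IsRoot A S (b - form A a b • a) := by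
  induction ha generalizing b with
  | simple i hi => rw [← reflect_eq]; exact hb.refl i hi
  | refl i hi v hv ih =>
    rw [form_reflect_left hA (h2 i)]
    have := (ih (hb.refl i hi)).refl i hi
    rwa [reflect_sub, reflect_smul, reflect_reflect (h2 i)] at this

theorem IsRoot.add (hA : A.IsSymm) (h2 : ∀ i, A i i = 2) {a b : ι → ℤ}
    (ha : IsRoot A S a) (hb : IsRoot A S b) (h : form A a b = -1) : IsRoot A S (a + b) := by
  have := ha.sub_form_smul hA h2 hb
  rw [h] at this
  convert this using 1
  module

theorem IsRoot.form_of_add (hA : A.IsSymm) (h2 : ∀ i, A i i = 2) {a b : ι → ℤ}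
    (ha : IsRoot A S a) (hb : IsRoot A S b) (h : IsRoot A S (a + b)) : form A a b = -1 := by
  have h0 := h.form_self hA h2
  rw [form_add_left, form_add_right, form_add_right, ha.form_self hA h2, hb.form_self hA h2,
    form_comm hA b a] at h0
  linarith

end Roots

/-! ### Positivity of the form on vectors vanishing at `o`, and induction over positive roots. -/

section Affine

variable {P : Type*} [Fintype P] {A : Matrix P P ℤ} {o : P}

theorem IsSimplyLacedAffine.symm (hA : IsSimplyLacedAffine A o) : A.IsSymm := by
  ext i j
  by_cases h : i = j
  · simp [h]
  · have h1 := hA.simplyLaced i j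
    have h2 := hA.simplyLaced j i
    have h3 := hA.gcm.nonpos i j h
    have h4 := hA.gcm.nonpos j i (Ne.symm h)
    have h5 := hA.gcm.zero_iff i j
    rw [Matrix.transpose_apply]
    omega

theorem IsSimplyLacedAffine.apply_of_adj (hA : IsSimplyLacedAffine A o) {p q : P}
    (h : Adj A p q) : A p q = -1 := by
  have h1 := hA.simplyLaced p q
  have h3 := hA.gcm.nonpos p q h.1
  have := h.2
  omega

theorem IsSimplyLacedAffine.adj_comm (hA : IsSimplyLacedAffine A o) {p q : P} :
    Adj A p q ↔ Adj A q p := by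
  simp only [Adj, ne_eq, hA.gcm.zero_iff p q, eq_comm (a := p)]

/-- Expanding the square, the terms in `v i ^ 2` and `v j ^ 2` carry a factor `∑ j, A i j * d j =
0`, so only the cross terms survive. With nonpositive off-diagonal entries this exhibits the form as
semidefinite. -/
theorem form_eq_sum_sq {d : P → ℝ} (hd : ∀ i, d i ≠ 0) (hs : A.IsSymm)
    (h0 : ∀ i, ∑ j, (A i j : ℝ) * d j = 0) (v : P → ℤ) :
    (form A v v : ℝ) =
      -(1 / 2) * ∑ i, ∑ j, (A i j : ℝ) * d i * d j * ((v i : ℝ) / d i - v j / d j) ^ 2 := by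
  have e1 : ∀ i j, (A i j : ℝ) * d i * d j * ((v i : ℝ) / d i - v j / d j) ^ 2 =
      (A i j * d j) * ((v i : ℝ) ^ 2 / d i) + (A j i * d i) * ((v j : ℝ) ^ 2 / d j)
        - 2 * (v i * (A i j * v j)) := by
    intro i j
    have hi := hd i
    have hj := hd j
    rw [hs.apply i j]
    field_simp
    ring
  have e2 : ∑ i, ∑ j, ((A i j : ℝ) * d j) * ((v i : ℝ) ^ 2 / d i) = 0 := by
    refine Finset.sum_eq_zero fun i _ => ?_
    rw [← Finset.sum_mul, h0, zero_mul]
  have e3 : ∑ i, ∑ j, ((A j i : ℝ) * d i) * ((v j : ℝ) ^ 2 / d j) = 0 := by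
    rw [Finset.sum_comm]
    exact e2
  simp only [e1, Finset.sum_sub_distrib, Finset.sum_add_distrib, e2, e3]
  simp only [← Finset.mul_sum, form, dotProduct, Matrix.mulVec]
  push_cast
  ring

/-- If the form were not positive, every square in `form_eq_sum_sq` with an adjacent pair would
vanish. Then the zero of `v` at `o` spreads along the edges of the connected diagram. -/
theorem IsSimplyLacedAffine.form_pos (hA : IsSimplyLacedAffine A o) {v : P → ℤ} (ho : v o = 0)
    (hv : v ≠ 0) : 0 < form A v v := by
  obtain ⟨d, hd, hd0, -⟩ := hA.mark_one
  have hd' : ∀ i, (0 : ℝ) < d i := fun i => by exact_mod_cast hd i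
  have h0 : ∀ i, ∑ j, (A i j : ℝ) * (d j : ℝ) = 0 := fun i => by
    have := congrFun hd0 i
    simp only [Matrix.mulVec, dotProduct, Pi.zero_apply] at this
    exact_mod_cast this
  have key := form_eq_sum_sq (d := fun i => (d i : ℝ)) (fun i => (hd' i).ne') hA.symm h0 v
  have hterm : ∀ i j, (A i j : ℝ) * d i * d j * ((v i : ℝ) / d i - v j / d j) ^ 2 ≤ 0 := by
    intro i j
    by_cases h : i = j
    · simp [h]
    · have h1 : (A i j : ℝ) ≤ 0 := by exact_mod_cast hA.gcm.nonpos i j h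
      have h2 : 0 ≤ (d i : ℝ) * d j * ((v i : ℝ) / d i - v j / d j) ^ 2 := by
        have := hd' i; have := hd' j; positivity
      have := mul_nonpos_of_nonpos_of_nonneg h1 h2
      linarith
  by_contra hle
  have hle' : (form A v v : ℝ) ≤ 0 := by exact_mod_cast not_lt.1 hle
  have hsum0 : ∑ i, ∑ j, (A i j : ℝ) * d i * d j * ((v i : ℝ) / d i - v j / d j) ^ 2 = 0 := by
    refine le_antisymm (Finset.sum_nonpos fun i _ => Finset.sum_nonpos fun j _ => hterm i j) ?_
    linarith
  have hall : ∀ i j, (A i j : ℝ) * d i * d j * ((v i : ℝ) / d i - v j / d j) ^ 2 = 0 := by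
    intro i j
    have h1 := (Finset.sum_eq_zero_iff_of_nonpos
      (fun i _ => Finset.sum_nonpos fun j _ => hterm i j)).1 hsum0 i (Finset.mem_univ _)
    exact (Finset.sum_eq_zero_iff_of_nonpos fun j _ => hterm i j).1 h1 j (Finset.mem_univ _)
  have hadj : ∀ i j, Adj A i j → v i = 0 → v j = 0 := by
    intro i j hij hi
    have h1 := hall i j
    have : (A i j : ℝ) ≠ 0 := by exact_mod_cast hij.2
    have h2 := (hd' i).ne'
    have h3 := (hd' j).ne'
    simp only [mul_eq_zero, this, h2, h3, false_or, hi] at h1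
    simpa [h3] using h1
  apply hv
  funext p
  have := hA.indecomposable o p
  induction this with
  | refl => exact ho
  | tail _ h ih => exact hadj _ _ h ih

/-- Otherwise `a - b` is a nonzero vector vanishing at `o`, of norm `4 - 2 (a, b) ≤ 0`. -/
theorem IsRoot.eq_of_two_le_form (hA : IsSimplyLacedAffine A o) {a b : P → ℤ}
    (ha : IsRoot A {p | p ≠ o} a) (hb : IsRoot A {p | p ≠ o} b) (h : 2 ≤ form A a b) : a = b := by
  by_contra hne
  have h1 := hA.form_pos (v := a - b)
    (by simp [ha.apply_eq_zero (p := o) (by simp), hb.apply_eq_zero (p := o) (by simp)])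
    (sub_ne_zero.2 hne)
  rw [form_sub_left, form_sub_right, form_sub_right, ha.form_self hA.symm hA.gcm.diag,
    hb.form_self hA.symm hA.gcm.diag, form_comm hA.symm b a] at h1
  linarith

/-- A negative pairing is either -1, and then the sum is a root, or at most -2, and then `b = -a`.
-/
theorem IsRoot.form_nonneg (hA : IsSimplyLacedAffine A o) {a b : P → ℤ}
    (ha : IsRoot A {p | p ≠ o} a) (hb : IsRoot A {p | p ≠ o} b)
    (h : ¬ IsRoot A {p | p ≠ o} (a + b)) (h0 : a + b ≠ 0) : 0 ≤ form A a b := by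
  by_contra hlt
  have h1 : form A a b ≠ -1 := fun h1 => h (ha.add hA.symm hA.gcm.diag hb h1)
  have h2 := (ha.neg hA.gcm.diag).eq_of_two_le_form hA hb (by rw [form_neg_left]; omega)
  exact h0 (by simp [← h2])

/-- A non-simple positive root is the sum of a simple root and a positive root. -/
theorem IsRoot.exists_simple_add (hA : IsSimplyLacedAffine A o) {a : P → ℤ}
    (ha : IsRoot A {p | p ≠ o} a) (h0 : 0 ≤ a)
    (hs : ∀ p, a ≠ simpleRoot p) :
    ∃ p, p ≠ o ∧ IsRoot A {p | p ≠ o} (a - simpleRoot p) ∧ 0 ≤ a - simpleRoot p := by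
  have h2 := ha.form_self hA.symm hA.gcm.diag
  -- The norm 2 is the sum of these products, so one of them is positive.
  obtain ⟨p, hp⟩ : ∃ p, 0 < a p * A.mulVec a p := by
    by_contra! hle
    have : form A a a ≤ 0 := Finset.sum_nonpos fun p _ => hle p
    omega
  have hap : 0 ≤ a p := h0 p
  have hap' : a p ≠ 0 := fun h => by simp [h] at hp
  have hpo : p ≠ o := fun h => hap' (by rw [h]; exact ha.apply_eq_zero (by simp))
  have hform : 0 < A.mulVec a p := pos_of_mul_pos_right hp hap
  have hsp : IsRoot A {p | p ≠ o} (simpleRoot p) := .simple p hpo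
  have hlt : ¬ 2 ≤ form A (simpleRoot p) a := fun h =>
    hs p (hsp.eq_of_two_le_form hA ha h).symm
  rw [form_simpleRoot_left] at hlt
  have h1 : A.mulVec a p = 1 := by omega
  refine ⟨p, hpo, ?_, fun q => ?_⟩
  · have := ha.refl p hpo
    rwa [reflect, h1, one_smul] at this
  · by_cases hq : q = p
    · subst hq
      rw [Pi.zero_apply, Pi.sub_apply, simpleRoot_self, sub_nonneg]
      exact (lt_of_le_of_ne hap (Ne.symm hap'))
    · rw [Pi.sub_apply, simpleRoot_of_ne hq, sub_zero]
      exact h0 q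

/-- Induction on the height, peeling off the simple root found by `exists_simple_add`. -/
theorem IsRoot.positive_induction (hA : IsSimplyLacedAffine A o) {C : (P → ℤ) → Prop}
    (simple : ∀ p, p ≠ o → C (simpleRoot p))
    (add : ∀ p b, p ≠ o → IsRoot A {p | p ≠ o} b → IsRoot A {p | p ≠ o} (simpleRoot p + b) →
      C (simpleRoot p) → C b → C (simpleRoot p + b))
    {a : P → ℤ} (ha : IsRoot A {p | p ≠ o} a) (h0 : 0 ≤ a) : C a := by
  induction hn : (∑ p, a p).toNat using Nat.strong_induction_on generalizing a with
  | _ n ih =>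
    subst hn
    by_cases hs : ∀ p, a ≠ simpleRoot p
    · obtain ⟨p, hpo, hb, hb0⟩ := ha.exists_simple_add hA h0 hs
      have hsum : ∑ q, (a - simpleRoot p) q = ∑ q, a q - 1 := by
        classical
        simp [simpleRoot_apply]
      have hnn : 0 ≤ ∑ q, (a - simpleRoot p) q := Finset.sum_nonneg fun q _ => hb0 q
      have hCb := ih _ (by omega) hb hb0 rfl
      have e : simpleRoot p + (a - simpleRoot p) = a := by abel
      have := add p _ hpo hb (by rwa [e]) (simple p hpo) hCb
      rwa [e] at this
    · push Not at hs
      obtain ⟨p, rfl⟩ := hs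
      refine simple p fun h => ?_
      have := ha.apply_eq_zero (p := o) (by simp)
      rw [h, simpleRoot_self] at this
      exact one_ne_zero this

end Affine

/-! ### The asymmetry function on the root lattice. -/

section Signs

variable {P : Type*} [Fintype P] (arrow : P → P → Prop)

theorem sgnLattice_add_left (a a' b : P → ℤ) :
    sgnLattice arrow (a + a') b = sgnLattice arrow a b * sgnLattice arrow a' b := by
  simp only [sgnLattice, Pi.add_apply, add_mul, zpow_add, Finset.prod_mul_distrib]

theorem sgnLattice_add_right (a b b' : P → ℤ) :
    sgnLattice arrow a (b + b') = sgnLattice arrow a b * sgnLattice arrow a b' := by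
  simp only [sgnLattice, Pi.add_apply, mul_add, zpow_add, Finset.prod_mul_distrib]

theorem sgnLattice_neg_left (a b : P → ℤ) :
    sgnLattice arrow (-a) b = sgnLattice arrow a b := by
  simp [sgnLattice]

theorem sgnLattice_neg_right (a b : P → ℤ) :
    sgnLattice arrow a (-b) = sgnLattice arrow a b := by
  simp [sgnLattice]

theorem sgnLattice_sub_left (a a' b : P → ℤ) :
    sgnLattice arrow (a - a') b = sgnLattice arrow a b * sgnLattice arrow a' b := by
  rw [sub_eq_add_neg, sgnLattice_add_left, sgnLattice_neg_left]

theorem sgnLattice_sub_right (a b b' : P → ℤ) :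
    sgnLattice arrow a (b - b') = sgnLattice arrow a b * sgnLattice arrow a b' := by
  rw [sub_eq_add_neg, sgnLattice_add_right, sgnLattice_neg_right]

theorem sgnLattice_zero_left (b : P → ℤ) : sgnLattice arrow 0 b = 1 := by
  simp [sgnLattice]

theorem sgnLattice_zero_right (a : P → ℤ) : sgnLattice arrow a 0 = 1 := by
  simp [sgnLattice]

theorem sgnLattice_simpleRoot (p q : P) :
    sgnLattice arrow (simpleRoot p) (simpleRoot q) = sgn arrow p q := by
  rw [sgnLattice, Finset.prod_eq_single p, Finset.prod_eq_single q]
  · simp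
  · intro r _ hr; simp [simpleRoot_of_ne hr]
  · simp
  · intro r _ hr; simp [simpleRoot_of_ne hr]
  · simp

theorem zpow_finsetSum {G ι : Type*} [CommGroup G] (g : G) (s : Finset ι) (f : ι → ℤ) :
    g ^ (∑ i ∈ s, f i) = ∏ i ∈ s, g ^ f i := by
  classical
  induction s using Finset.induction_on with
  | empty => simp
  | insert i s hi ih => rw [Finset.sum_insert hi, Finset.prod_insert hi, zpow_add, ih]

variable {arrow} {A : Matrix P P ℤ} {o : P}

theorem sgn_mul_sgn (hA : IsSimplyLacedAffine A o) (harrow : IsOrientation A arrow) (p q : P) :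
    sgn arrow p q * sgn arrow q p = (-1) ^ A p q := by
  by_cases hpq : p = q
  · subst hpq; simp [sgn, hA.gcm.diag]
  · by_cases hadj : Adj A p q
    · rw [hA.apply_of_adj hadj]
      rcases harrow.xor p q hadj with ⟨h1, h2⟩ | ⟨h1, h2⟩ <;>
        simp [sgn, hpq, Ne.symm hpq, h1, h2]
    · have h1 : ¬ arrow p q := fun h => hadj (harrow.adj _ _ h)
      have h2 : ¬ arrow q p := fun h => hadj (hA.adj_comm.1 (harrow.adj _ _ h))
      have h3 : A p q = 0 := by
        by_contra h; exact hadj ⟨hpq, h⟩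
      simp [sgn, hpq, Ne.symm hpq, h1, h2, h3]

/-- By bimultiplicativity this reduces to `sgn_mul_sgn`. It decides whether two compositions of root
operators agree or differ in sign. -/
theorem sgnLattice_mul_swap (hA : IsSimplyLacedAffine A o) (harrow : IsOrientation A arrow)
    (a b : P → ℤ) :
    sgnLattice arrow a b * sgnLattice arrow b a = (-1) ^ form A a b := by
  have h : sgnLattice arrow b a = ∏ p, ∏ q, sgn arrow q p ^ (a p * b q) := by
    rw [sgnLattice, Finset.prod_comm]
    simp only [mul_comm]
  rw [h, sgnLattice, form, dotProduct, zpow_finsetSum, ← Finset.prod_mul_distrib]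
  refine Finset.prod_congr rfl fun p _ => ?_
  rw [Matrix.mulVec, dotProduct, Finset.mul_sum, zpow_finsetSum, ← Finset.prod_mul_distrib]
  refine Finset.prod_congr rfl fun q _ => ?_
  rw [← mul_zpow, sgn_mul_sgn hA harrow, ← zpow_mul]
  congr 1
  ring

/-- Reflecting `v` with `n = (α_i, v)` introduces the two cross terms, which together give `(-1) ^
(n * n)` by `sgnLattice_mul_swap`, and the term `sgn(α_i, α_i) ^ (n * n)`, which is the same sign.
They cancel. -/
theorem IsRoot.sgnLattice_self (hA : IsSimplyLacedAffine A o) (harrow : IsOrientation A arrow)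
    {S : Set P} {a : P → ℤ} (ha : IsRoot A S a) : sgnLattice arrow a a = -1 := by
  induction ha with
  | simple i hi => rw [sgnLattice_simpleRoot]; simp [sgn]
  | refl i hi v hv ih =>
    have hsmul_l : ∀ (n : ℤ) (b c : P → ℤ),
        sgnLattice arrow (n • b) c = sgnLattice arrow b c ^ n := by
      intro n b c
      simp only [sgnLattice, ← Finset.prod_zpow, ← zpow_mul, Pi.smul_apply, smul_eq_mul]
      exact Finset.prod_congr rfl fun p _ => Finset.prod_congr rfl fun q _ => by congr 1; ring
    have hsmul_r : ∀ (n : ℤ) (b c : P → ℤ),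
        sgnLattice arrow b (n • c) = sgnLattice arrow b c ^ n := by
      intro n b c
      simp only [sgnLattice, ← Finset.prod_zpow, ← zpow_mul, Pi.smul_apply, smul_eq_mul]
      exact Finset.prod_congr rfl fun p _ => Finset.prod_congr rfl fun q _ => by congr 1; ring
    have hsw := sgnLattice_mul_swap hA harrow (simpleRoot i) v
    have hii : sgnLattice arrow (simpleRoot i) (simpleRoot i) = -1 := by
      rw [sgnLattice_simpleRoot]; simp [sgn]
    rw [reflect_eq]
    generalize form A (simpleRoot i) v = n at *
    rw [sgnLattice_sub_left, sgnLattice_sub_right, sgnLattice_sub_right, hsmul_l, hsmul_l,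
      hsmul_r, hsmul_r, hii, ih]
    calc -1 * sgnLattice arrow v (simpleRoot i) ^ n *
          (sgnLattice arrow (simpleRoot i) v ^ n * ((-1) ^ n) ^ n)
        = -1 * (sgnLattice arrow (simpleRoot i) v * sgnLattice arrow v (simpleRoot i)) ^ n *
          ((-1) ^ n) ^ n := by rw [mul_zpow]; ac_rfl
      _ = -1 := by
        rw [hsw, mul_assoc, ← mul_zpow, ← mul_zpow]; simp

end Signs

/-! ### The action of `μ` and the folding map. -/

section Act

variable {P : Type*} {μ : Equiv.Perm P}

theorem act_add (a b : P → ℤ) : act μ (a + b) = act μ a + act μ b := rfl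
theorem act_sub (a b : P → ℤ) : act μ (a - b) = act μ a - act μ b := rfl
theorem act_neg (a : P → ℤ) : act μ (-a) = -act μ a := rfl
theorem act_smul (n : ℤ) (a : P → ℤ) : act μ (n • a) = n • act μ a := rfl

theorem act_simpleRoot (p : P) : act μ (simpleRoot p) = simpleRoot (μ p) := by
  classical
  funext q
  simp [act, simpleRoot_apply, Equiv.symm_apply_eq]

theorem Folds.apply_apply {A : Matrix P P ℤ} (hμ : Folds A μ) (p : P) : μ (μ p) = p := by
  have := congrArg (fun f => f p) hμ.sq_eq_one
  simpa using this

theorem Folds.symm_apply {A : Matrix P P ℤ} (hμ : Folds A μ) (p : P) : μ.symm p = μ p := by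
  rw [Equiv.symm_apply_eq, hμ.apply_apply]

theorem Folds.act_apply {A : Matrix P P ℤ} (hμ : Folds A μ) (a : P → ℤ) (p : P) :
    act μ a p = a (μ p) := by
  rw [act, hμ.symm_apply]

theorem Folds.act_act {A : Matrix P P ℤ} (hμ : Folds A μ) (a : P → ℤ) :
    act μ (act μ a) = a := by
  funext p; rw [hμ.act_apply, hμ.act_apply, hμ.apply_apply]

theorem Folds.apply_comm {A : Matrix P P ℤ} (hμ : Folds A μ) (p q : P) :
    A (μ p) q = A p (μ q) := by
  rw [← hμ.auto, hμ.apply_apply]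

theorem Folds.apply_self {A : Matrix P P ℤ} (hμ : Folds A μ) {p : P} (hp : μ p ≠ p) :
    A p (μ p) = 0 := by
  by_contra h
  exact hμ.not_adj p ⟨hp.symm, h⟩

theorem Folds.bar_eq_bar {A : Matrix P P ℤ} (hμ : Folds A μ) {p q : P} :
    bar μ p = bar μ q ↔ q = p ∨ q = μ p := by
  have : bar μ p = bar μ q ↔ μ.SameCycle p q := Quotient.eq
  rw [this]
  constructor
  · rintro ⟨i, hi⟩
    have h2 : μ ^ (2 : ℤ) = 1 := by rw [zpow_two, hμ.sq_eq_one]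
    rcases Int.even_or_odd' i with ⟨n, rfl | rfl⟩
    · left; rw [zpow_mul, h2, one_zpow] at hi; simpa using hi.symm
    · right; rw [zpow_add, zpow_mul, h2, one_zpow, zpow_one, one_mul] at hi; exact hi.symm
  · rintro (rfl | rfl)
    · exact ⟨0, by simp⟩
    · exact ⟨1, by simp⟩

theorem Folds.bar_apply {A : Matrix P P ℤ} (hμ : Folds A μ) (p : P) :
    bar μ (μ p) = bar μ p := (hμ.bar_eq_bar.2 (Or.inr rfl)).symm

theorem bar_surjective (x : Orb μ) : ∃ p, bar μ p = x := Quotient.exists_rep x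

variable [Fintype P]

theorem fold_add (a b : P → ℤ) : fold μ (a + b) = fold μ a + fold μ b := by
  funext x; simp [fold, Finset.sum_add_distrib]

theorem fold_sub (a b : P → ℤ) : fold μ (a - b) = fold μ a - fold μ b := by
  funext x; simp [fold, Finset.sum_sub_distrib]

theorem fold_neg (a : P → ℤ) : fold μ (-a) = -fold μ a := by
  funext x; simp [fold]

theorem fold_smul (n : ℤ) (a : P → ℤ) : fold μ (n • a) = n • fold μ a := by
  funext x; simp [fold, Finset.mul_sum]

theorem fold_zero : fold μ (0 : P → ℤ) = 0 := by
  funext x; simp [fold]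

theorem fold_simpleRoot (p : P) : fold μ (simpleRoot p) = simpleRoot (bar μ p) := by
  classical
  funext x
  rw [fold, simpleRoot_apply]
  simp only [simpleRoot_apply, Finset.sum_ite_eq', Finset.mem_filter, Finset.mem_univ, true_and]
  simp only [eq_comm]

open Classical in
theorem Folds.fold_bar {A : Matrix P P ℤ} (hμ : Folds A μ) (a : P → ℤ) (p : P) :
    fold μ a (bar μ p) = if μ p = p then a p else a p + a (μ p) := by
  have : (Finset.univ.filter fun q => bar μ q = bar μ p) = {p, μ p} := by
    ext q
    rw [Finset.mem_filter, eq_comm, hμ.bar_eq_bar]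
    simp
  rw [fold, this]
  split_ifs with h
  · simp [h]
  · rw [Finset.sum_pair (Ne.symm h)]

theorem Folds.fold_act {A : Matrix P P ℤ} (hμ : Folds A μ) (a : P → ℤ) :
    fold μ (act μ a) = fold μ a := by
  funext x
  obtain ⟨p, rfl⟩ := bar_surjective x
  rw [hμ.fold_bar, hμ.fold_bar, hμ.act_apply, hμ.act_apply, hμ.apply_apply]
  split_ifs with h
  · rw [h]
  · ring

/-- The symmetrisation `a + μ(a)` depends only on `f(a)`; it replaces the folded root in all length
computations, which thus take place in the unfolded lattice. -/
theorem Folds.add_act_eq {A : Matrix P P ℤ} (hμ : Folds A μ) {a b : P → ℤ}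
    (h : fold μ a = fold μ b) : a + act μ a = b + act μ b := by
  funext p
  have := congrFun h (bar μ p)
  rw [hμ.fold_bar, hμ.fold_bar] at this
  rw [Pi.add_apply, Pi.add_apply, hμ.act_apply, hμ.act_apply]
  split_ifs at this with hp
  · rw [hp, this]
  · exact this

theorem Folds.form_act {A : Matrix P P ℤ} (hμ : Folds A μ) (a b : P → ℤ) :
    form A (act μ a) (act μ b) = form A a b := by
  simp only [form, dotProduct, Matrix.mulVec, hμ.act_apply]
  rw [← Equiv.sum_comp μ]
  refine Finset.sum_congr rfl fun p _ => ?_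
  rw [← Equiv.sum_comp μ]
  simp only [hμ.apply_apply, hμ.auto]

theorem Folds.act_reflect {A : Matrix P P ℤ} (hμ : Folds A μ) (p : P) (a : P → ℤ) :
    act μ (reflect A p a) = reflect A (μ p) (act μ a) := by
  rw [reflect_eq, reflect_eq, ← act_simpleRoot, hμ.form_act, act_sub, act_smul]

theorem Folds.isRoot_act {A : Matrix P P ℤ} (hμ : Folds A μ) {S : Set P}
    (hS : ∀ p ∈ S, μ p ∈ S) {a : P → ℤ} (ha : IsRoot A S a) : IsRoot A S (act μ a) := by
  induction ha with
  | simple i hi => rw [act_simpleRoot]; exact .simple _ (hS i hi)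
  | refl i hi v hv ih => rw [hμ.act_reflect]; exact ih.refl _ (hS i hi)

theorem Folds.sgnLattice_act {A : Matrix P P ℤ} (hμ : Folds A μ) {arrow : P → P → Prop}
    (hcomp : Compatible μ arrow) (a b : P → ℤ) :
    sgnLattice arrow (act μ a) (act μ b) = sgnLattice arrow a b := by
  simp only [sgnLattice, hμ.act_apply]
  rw [← Equiv.prod_comp μ]
  refine Finset.prod_congr rfl fun p _ => ?_
  rw [← Equiv.prod_comp μ]
  simp only [hμ.apply_apply, ← hcomp _ _]

omit [Fintype P] in
theorem foldedMatrix_diag (A : Matrix P P ℤ) (x : Orb μ) : foldedMatrix A μ x x = 2 := by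
  simp [foldedMatrix]

end Act

/-! ### The folded matrix, lifted reflections and root lengths. -/

section FoldedMatrix

variable {P : Type*} [Fintype P] {A : Matrix P P ℤ} {o : P} {μ : Equiv.Perm P}

/-- A folded entry is the sum of the column of `q` over the orbit of `p`: the entry -2 occurs when
both members of a two-element orbit are adjacent to `q`, and the diagonal entry is 2 because `p` and
`μ p` are not adjacent. -/
theorem Folds.foldedMatrix_bar (hA : IsSimplyLacedAffine A o) (hμ : Folds A μ) (p q : P) :
    foldedMatrix A μ (bar μ p) (bar μ q) = fold μ (fun r => A r q) (bar μ p) := by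
  classical
  rw [hμ.fold_bar]
  have hval : ∀ r s, r ≠ s → A r s = 0 ∨ A r s = -1 := fun r s hrs => by
    have h1 := hA.simplyLaced r s
    have h3 := hA.gcm.nonpos r s hrs
    omega
  have hzero : ∀ r s, ¬ Adj A r s → r ≠ s → A r s = 0 := fun r s h hrs => by
    by_contra h0; exact h ⟨hrs, h0⟩
  have hadjμ : ∀ r s, Adj A (μ r) (μ s) ↔ Adj A r s := fun r s => by
    simp [Adj, hμ.auto]
  rw [foldedMatrix]
  by_cases hpq : bar μ p = bar μ q
  · rw [if_pos hpq]
    rcases hμ.bar_eq_bar.1 hpq with rfl | rfl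
    · split_ifs with h
      · exact (hA.gcm.diag q).symm
      · rw [hμ.apply_comm, hμ.apply_self h, hA.gcm.diag, add_zero]
    · split_ifs with h
      · rw [h, hA.gcm.diag]
      · rw [hμ.apply_self h, hA.gcm.diag, zero_add]
  rw [if_neg hpq]
  have hne : p ≠ q := fun h => hpq (h ▸ rfl)
  have hne' : μ p ≠ q := fun h => hpq (by rw [← h, hμ.bar_apply])
  have hne2 : p ≠ μ q := fun h => hne' (by rw [h, hμ.apply_apply])
  by_cases h1 : ∃ r s, bar μ r = bar μ p ∧ bar μ s = bar μ q ∧ r ≠ μ r ∧ Adj A r s ∧ Adj A (μ r) s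
  · rw [if_pos h1]
    obtain ⟨r, s, hr, hs, hrμ, had, had'⟩ := h1
    have hfix : μ p ≠ p := by
      rcases hμ.bar_eq_bar.1 hr.symm with rfl | rfl
      · exact hrμ.symm
      · rwa [hμ.apply_apply] at hrμ
    rw [if_neg hfix]
    have k1 : A r s = -1 := hA.apply_of_adj had
    have k2 : A (μ r) s = -1 := hA.apply_of_adj had'
    have k3 := hμ.auto r s
    have k4 := hμ.auto (μ r) s
    rw [hμ.apply_apply] at k4
    rcases hμ.bar_eq_bar.1 hr.symm with rfl | rfl <;>
      rcases hμ.bar_eq_bar.1 hs.symm with rfl | rfl <;>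
      simp only [hμ.apply_apply] at * <;> omega
  rw [if_neg h1]
  by_cases h2 : ∃ r s, bar μ r = bar μ p ∧ bar μ s = bar μ q ∧ Adj A r s
  · rw [if_pos h2]
    obtain ⟨r, s, hr, hs, had⟩ := h2
    have k1 : A r s = -1 := hA.apply_of_adj had
    have k3 := hμ.auto r s
    have k4 := hμ.auto (μ r) s
    rw [hμ.apply_apply] at k4
    have hsum : A p q = -1 ∨ A (μ p) q = -1 := by
      rcases hμ.bar_eq_bar.1 hr.symm with rfl | rfl <;>
        rcases hμ.bar_eq_bar.1 hs.symm with rfl | rfl <;>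
        simp only [hμ.apply_apply] at * <;> omega
    by_cases hfix : μ p = p
    · rw [if_pos hfix]
      rw [hfix] at hsum
      omega
    · rw [if_neg hfix]
      have hnot : ¬ (Adj A p q ∧ Adj A (μ p) q) := fun hh =>
        h1 ⟨p, q, rfl, rfl, Ne.symm hfix, hh.1, hh.2⟩
      rcases not_and_or.1 hnot with hn | hn
      · have := hzero _ _ hn hne; omega
      · have := hzero _ _ hn hne'; omega
  · rw [if_neg h2]
    have e1 := hzero _ _ (fun h => h2 ⟨p, q, rfl, rfl, h⟩) hne
    have e2 := hzero _ _ (fun h => h2 ⟨μ p, q, hμ.bar_apply p, rfl, h⟩) hne'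
    split_ifs <;> omega

theorem Folds.foldedMatrix_mulVec (hA : IsSimplyLacedAffine A o) (hμ : Folds A μ) (a : P → ℤ) :
    (foldedMatrix A μ).mulVec (fold μ a) = fold μ (A.mulVec a) := by
  classical
  funext x
  obtain ⟨p, rfl⟩ := bar_surjective x
  have h1 : (foldedMatrix A μ).mulVec (fold μ a) (bar μ p) =
      ∑ q, foldedMatrix A μ (bar μ p) (bar μ q) * a q := by
    rw [Matrix.mulVec, dotProduct,
      ← Finset.sum_fiberwise Finset.univ (bar μ) fun q => foldedMatrix A μ (bar μ p) (bar μ q) * a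
        q]
    refine Finset.sum_congr rfl fun y _ => ?_
    rw [fold, Finset.mul_sum]
    refine Finset.sum_congr (by congr) fun q hq => ?_
    rw [(Finset.mem_filter.1 hq).2]
  rw [h1]
  simp only [hμ.foldedMatrix_bar hA, fold, Finset.sum_mul]
  rw [Finset.sum_comm]
  rfl

/-- If the folded diagram without the image of `o` is of finite type, then the folding fixes
`o`: otherwise the image of the imaginary root would be in the kernel of the folded matrix. -/
theorem Folds.apply_o (hA : IsSimplyLacedAffine A o) (hμ : Folds A μ)
    (hfin : IsFiniteType (foldedFinite A μ o)) : μ o = o := by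
  classical
  by_contra ho
  -- If `o` is moved, its orbit contains `μ o ≠ o`, so deleting `o` loses no orbit.
  have hall : ∀ x : Orb μ, x ∈ finiteOrbs μ o := by
    intro x
    obtain ⟨p, rfl⟩ := bar_surjective x
    by_cases hp : p = o
    · subst hp; exact ⟨μ p, ho, hμ.bar_apply p⟩
    · exact ⟨p, hp, rfl⟩
  obtain ⟨d, hd, hd0, -⟩ := hA.mark_one
  refine hfin.1 ?_
  have := (Matrix.exists_mulVec_eq_zero_iff (M := foldedFinite A μ o)).1
    ⟨fun x => fold μ d x, fun h => ?_, ?_⟩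
  · convert this
  · have h1 := congrFun h ⟨bar μ o, hall _⟩
    simp only [hμ.fold_bar, Pi.zero_apply] at h1
    have := hd o; have := hd (μ o)
    split_ifs at h1; omega
  · funext x
    have h2 := congrFun (hμ.foldedMatrix_mulVec hA d) x
    rw [hd0, fold_zero] at h2
    refine Eq.trans ?_ h2
    simp only [Matrix.mulVec, dotProduct, foldedFinite, Matrix.submatrix_apply]
    exact (Equiv.subtypeUnivEquiv hall).sum_comp
      (fun y => foldedMatrix A μ (x : Orb μ) y * fold μ d y)

variable (A μ) in
open Classical in
/-- The reflection in the folded root lattice, lifted to the root lattice. -/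
noncomputable def foldReflect (p : P) (a : P → ℤ) : P → ℤ :=
  if μ p = p then reflect A p a else reflect A p (reflect A (μ p) a)

theorem Folds.foldReflect_eq (hμ : Folds A μ) (p : P) (hp : μ p ≠ p) (a : P → ℤ) :
    foldReflect A μ p a = a - form A (simpleRoot p) a • simpleRoot p -
      form A (simpleRoot (μ p)) a • simpleRoot (μ p) := by
  have h : form A (simpleRoot p) (simpleRoot (μ p)) = 0 := by
    rw [form_simpleRoot_left, mulVec_simpleRoot, hμ.apply_self hp]
  rw [foldReflect, if_neg hp, reflect_eq, reflect_eq]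
  simp only [form_sub_right, form_smul_right, h]
  module

theorem Folds.fold_foldReflect (hA : IsSimplyLacedAffine A o) (hμ : Folds A μ) (p : P)
    (a : P → ℤ) :
    fold μ (foldReflect A μ p a) = reflect (foldedMatrix A μ) (bar μ p) (fold μ a) := by
  rw [reflect, hμ.foldedMatrix_mulVec hA, hμ.fold_bar]
  split_ifs with hp
  · rw [foldReflect, if_pos hp, reflect, fold_sub, fold_smul, fold_simpleRoot]
  · rw [hμ.foldReflect_eq p hp]
    simp only [fold_sub, fold_smul, fold_simpleRoot, hμ.bar_apply, form_simpleRoot_left]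
    module

theorem Folds.act_foldReflect (hμ : Folds A μ) (p : P) (a : P → ℤ) :
    act μ (foldReflect A μ p a) = foldReflect A μ p (act μ a) := by
  by_cases hp : μ p = p
  · rw [foldReflect, foldReflect, if_pos hp, if_pos hp, hμ.act_reflect, hp]
  · rw [hμ.foldReflect_eq p hp, hμ.foldReflect_eq p hp]
    simp only [act_sub, act_smul, act_simpleRoot, hμ.apply_apply]
    have h1 := hμ.form_act (simpleRoot p) a
    have h2 := hμ.form_act (simpleRoot (μ p)) a
    rw [act_simpleRoot] at h1 h2
    rw [hμ.apply_apply] at h2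
    rw [h1, h2]
    module

theorem foldReflect_add (p : P) (a b : P → ℤ) :
    foldReflect A μ p (a + b) = foldReflect A μ p a + foldReflect A μ p b := by
  simp only [foldReflect]
  split_ifs <;> simp only [reflect_add]

theorem form_foldReflect (hA : IsSimplyLacedAffine A o) (p : P) (a b : P → ℤ) :
    form A (foldReflect A μ p a) (foldReflect A μ p b) = form A a b := by
  simp only [foldReflect]
  split_ifs <;> simp only [form_reflect_reflect hA.symm (hA.gcm.diag _)]

theorem Folds.fold_foldReflect_of_eq (hA : IsSimplyLacedAffine A o) (hμ : Folds A μ) {p : P}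
    {a : P → ℤ} {γ : Orb μ → ℤ} (h : fold μ a = reflect (foldedMatrix A μ) (bar μ p) γ) :
    fold μ (foldReflect A μ p a) = γ := by
  rw [hμ.fold_foldReflect hA, h, reflect_reflect (foldedMatrix_diag A _)]

/-- For a simple root the symmetrisation is `2 α_p`, of norm 8, or `α_p + α_{μ p}` with orthogonal
summands, of norm 4. Lifted reflections commute with `μ` and preserve the form, so no other norm
arises. -/
theorem Folds.form_add_act (hA : IsSimplyLacedAffine A o) (hμ : Folds A μ)
    {T : Set (Orb μ)} {γ : Orb μ → ℤ} (hγ : IsRoot (foldedMatrix A μ) T γ) {a : P → ℤ}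
    (ha : fold μ a = γ) :
    form A (a + act μ a) (a + act μ a) = 4 ∨ form A (a + act μ a) (a + act μ a) = 8 := by
  induction hγ generalizing a with
  | simple x hx =>
    obtain ⟨p, rfl⟩ := bar_surjective x
    rw [← fold_simpleRoot] at ha
    rw [hμ.add_act_eq ha, act_simpleRoot]
    simp only [form_add_left, form_add_right, form_simpleRoot_left, mulVec_simpleRoot,
      hA.gcm.diag]
    by_cases hp : μ p = p
    · rw [hp, hA.gcm.diag]; norm_num
    · rw [hμ.apply_comm, hμ.apply_self hp]; norm_num
  | refl x hx v hv ih =>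
    obtain ⟨p, rfl⟩ := bar_surjective x
    have := ih (hμ.fold_foldReflect_of_eq hA ha)
    rwa [hμ.act_foldReflect, ← foldReflect_add, form_foldReflect hA] at this

end FoldedMatrix

/-- A folding of a simply laced affine diagram that fixes the additional vertex and takes roots to
roots. -/
structure RootFolding {P : Type*} [Fintype P] (A : Matrix P P ℤ) (o : P) (μ : Equiv.Perm P) :
    Prop where
  affine : IsSimplyLacedAffine A o
  folds : Folds A μ
  apply_o : μ o = o
  isRoot_fold : ∀ a, IsRoot A {p | p ≠ o} a →
    IsRoot (foldedMatrix A μ) (finiteOrbs μ o) (fold μ a)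

/-! ### Fibres of the folding map on roots. -/

namespace RootFolding

variable {P : Type*} [Fintype P] {A : Matrix P P ℤ} {o : P} {μ : Equiv.Perm P}
  (F : RootFolding A o μ)

include F

theorem symm : A.IsSymm := F.affine.symm

theorem diag (p : P) : A p p = 2 := F.affine.gcm.diag p

theorem apply_ne {p : P} (hp : p ≠ o) : μ p ≠ o := fun h => hp <| by
  rw [← F.apply_o] at h; exact μ.injective h

theorem isRoot_act {a : P → ℤ} (ha : IsRoot A {p | p ≠ o} a) : IsRoot A {p | p ≠ o} (act μ a) :=
  F.folds.isRoot_act (S := {p | p ≠ o}) (fun _ hp => F.apply_ne hp) ha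

theorem form_self {a : P → ℤ} (ha : IsRoot A {p | p ≠ o} a) : form A a a = 2 :=
  ha.form_self F.symm F.diag

theorem form_act_right (a b : P → ℤ) : form A a (act μ b) = form A (act μ a) b := by
  rw [← F.folds.form_act, F.folds.act_act]

/-- The norm `4 + 2 (a, μ(a))` of the symmetrisation is 4 or 8, and a pairing of 2 would force `μ(a)
= a`. -/
theorem form_act_self {a : P → ℤ} (ha : IsRoot A {p | p ≠ o} a) (h : act μ a ≠ a) :
    form A a (act μ a) = 0 := by
  have h1 := F.folds.form_add_act F.affine (F.isRoot_fold a ha) rfl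
  rw [form_add_left, form_add_right, form_add_right, F.form_self ha,
    F.form_self (F.isRoot_act ha), ← F.form_act_right a a] at h1
  have h2 : ¬ 2 ≤ form A a (act μ a) := fun h2 =>
    h (ha.eq_of_two_le_form F.affine (F.isRoot_act ha) h2).symm
  omega

/-- Pairing `a + μ(a) = b + μ(b)` with `b` gives `(a, b) + (μ(a), b) ≥ 2`. If neither term reaches
2, both are 1. Then `a - b` is a root whose symmetrisation is zero, which has neither norm 4 nor
norm 8. -/
theorem eq_or_eq_act {a b : P → ℤ} (ha : IsRoot A {p | p ≠ o} a) (hb : IsRoot A {p | p ≠ o} b)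
    (h : fold μ a = fold μ b) : b = a ∨ b = act μ a := by
  have hsum := F.folds.add_act_eq h
  have h1 : form A a b + form A (act μ a) b = 2 + form A b (act μ b) := by
    rw [← form_add_left, hsum, form_add_left, F.form_self hb, form_comm F.symm]
  by_contra! hne
  have ha' := F.isRoot_act ha
  have h2 : form A a b < 2 := by
    by_contra hh; exact hne.1 (ha.eq_of_two_le_form F.affine hb (by omega)).symm
  have h3 : form A (act μ a) b < 2 := by
    by_contra hh; exact hne.2 (ha'.eq_of_two_le_form F.affine hb (by omega)).symm
  have h4 : 0 ≤ form A b (act μ b) := by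
    by_cases hbb : act μ b = b
    · rw [hbb, F.form_self hb]; norm_num
    · rw [F.form_act_self hb hbb]
  have h5 : form A a (-b) = -1 := by rw [form_neg_right]; omega
  have h6 := ha.add F.symm F.diag (hb.neg F.diag) h5
  have h7 := F.folds.form_add_act F.affine (F.isRoot_fold _ h6) rfl
  have h8 : a + -b + act μ (a + -b) = 0 := by
    rw [act_add, act_neg]
    calc a + -b + (act μ a + -act μ b) = (a + act μ a) - (b + act μ b) := by abel
      _ = 0 := by rw [hsum, sub_self]
  rw [h8] at h7
  simp [form] at h7

end RootFolding

/-! ### Operators that permute basis vectors up to sign and zero. -/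

section ShiftOp

variable (k : Type*) [Field k] {X : Type*}

open Classical in
/-- The operator taking `v_I` to `± v_J` if `R I J`, and to `0` if there is no such `J`. -/
noncomputable def shiftOp (R : X → X → Prop) (w : X → X → ℤˣ) : Module.End k (X →₀ k) :=
  Finsupp.linearCombination k fun I =>
    if h : ∃ J, R I J then ((w h.choose I : ℤ) : k) • Finsupp.single h.choose 1 else 0

/-- The diagonal operator with integral eigenvalues. -/
noncomputable def diagOp (w : X → ℤ) : Module.End k (X →₀ k) :=
  Finsupp.linearCombination k fun I => (w I : k) • Finsupp.single I 1

variable {k}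

theorem end_ext {f g : Module.End k (X →₀ k)}
    (h : ∀ I, f (Finsupp.single I 1) = g (Finsupp.single I 1)) : f = g :=
  Finsupp.lhom_ext' fun I => LinearMap.ext_ring (h I)

variable {R : X → X → Prop} {w : X → X → ℤˣ}

theorem shiftOp_of_rel (hR : ∀ I J J', R I J → R I J' → J = J') {I J : X} (h : R I J) :
    shiftOp k R w (Finsupp.single I 1) = ((w J I : ℤ) : k) • Finsupp.single J 1 := by
  have hex : ∃ J, R I J := ⟨J, h⟩
  rw [shiftOp, Finsupp.linearCombination_single, dif_pos hex, one_smul,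
    hR _ _ _ hex.choose_spec h]

theorem shiftOp_of_not {I : X} (h : ¬ ∃ J, R I J) :
    shiftOp k R w (Finsupp.single I 1) = 0 := by
  rw [shiftOp, Finsupp.linearCombination_single, dif_neg h, smul_zero]

theorem diagOp_single (w : X → ℤ) (I : X) :
    diagOp k w (Finsupp.single I 1) = (w I : k) • Finsupp.single I 1 := by
  rw [diagOp, Finsupp.linearCombination_single, one_smul]

theorem diagOp_add (w w' : X → ℤ) :
    diagOp k (fun I => w I + w' I) = diagOp k w + diagOp k w' :=
  end_ext fun I => by
    rw [LinearMap.add_apply, diagOp_single, diagOp_single, diagOp_single, ← add_smul,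
      Int.cast_add]

/-- The commutator of two operators. -/
noncomputable def commutatorEnd (f g : Module.End k (X →₀ k)) : Module.End k (X →₀ k) := f * g - g
    * f

theorem commutatorEnd_add_left (f f' g : Module.End k (X →₀ k)) :
    commutatorEnd (f + f') g = commutatorEnd f g + commutatorEnd f' g := by
  simp only [commutatorEnd, add_mul, mul_add]; abel

theorem commutatorEnd_add_right (f g g' : Module.End k (X →₀ k)) :
    commutatorEnd f (g + g') = commutatorEnd f g + commutatorEnd f g' := by
  simp only [commutatorEnd, add_mul, mul_add]; abel

theorem commutatorEnd_apply (f g : Module.End k (X →₀ k)) (v : X →₀ k) :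
    commutatorEnd f g v = f (g v) - g (f v) := rfl

theorem diagOp_lie_diagOp (w w' : X → ℤ) : commutatorEnd (diagOp k w) (diagOp k w') = 0 :=
  end_ext fun I => by
    rw [commutatorEnd_apply, diagOp_single, diagOp_single, map_smul, map_smul, diagOp_single,
      diagOp_single, smul_comm, sub_self, LinearMap.zero_apply]

theorem diagOp_lie_shiftOp (hR : ∀ I J J', R I J → R I J' → J = J') (w' : X → ℤ) (n : ℤ)
    (h : ∀ I J, R I J → w' J = w' I + n) :
    commutatorEnd (diagOp k w') (shiftOp k R w) = (n : k) • shiftOp k R w :=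
  end_ext fun I => by
    rw [commutatorEnd_apply, diagOp_single, LinearMap.smul_apply, map_smul]
    by_cases hJ : ∃ J, R I J
    · obtain ⟨J, hJ⟩ := hJ
      rw [shiftOp_of_rel hR hJ, map_smul, diagOp_single, h I J hJ]
      push_cast
      module
    · rw [shiftOp_of_not hJ]
      simp

end ShiftOp

/-! ### Minuscule models and the simply laced relations. -/

variable {P : Type*} [Fintype P]

/-- A combinatorial model of a minuscule module over a simply laced Lie algebra: a set of basis
vectors `I` with positions `pos I` in the root lattice, weights `wt I` with all labels in
`{-1, 0, 1}`, and a choice of signs with the cocycle property. -/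
structure LatticeModel (A : Matrix P P ℤ) (arrow : P → P → Prop) (X : Type*) where
  pos : X → P → ℤ
  wt : X → P → ℤ
  sign : X → X → ℤˣ
  pos_injective : Function.Injective pos
  wt_eq : ∀ I J, wt J = wt I + A.mulVec (pos J - pos I)
  wt_mem : ∀ I p, wt I p = -1 ∨ wt I p = 0 ∨ wt I p = 1
  exists_add : ∀ I p, wt I p = -1 → ∃ J, pos J = pos I + simpleRoot p
  exists_sub : ∀ I p, wt I p = 1 → ∃ J, pos J = pos I - simpleRoot p
  sign_mul : ∀ I J K, sign K J * sign J I =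
    sgnLattice arrow (pos K - pos J) (pos J - pos I) * sign K I

namespace LatticeModel

variable {A : Matrix P P ℤ} {arrow : P → P → Prop} {X : Type*} (M : LatticeModel A arrow X)
  {o : P}

/-- The pairing of an element of the root lattice with the weight of `I`. -/
def pair (a : P → ℤ) (I : X) : ℤ := a ⬝ᵥ M.wt I

theorem pair_add (a b : P → ℤ) (I : X) : M.pair (a + b) I = M.pair a I + M.pair b I := by
  simp [pair, add_dotProduct]

theorem pair_neg (a : P → ℤ) (I : X) : M.pair (-a) I = -M.pair a I := by
  simp [pair, neg_dotProduct]

theorem pair_simpleRoot (p : P) (I : X) : M.pair (simpleRoot p) I = M.wt I p := by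
  classical
  simp [pair, dotProduct, simpleRoot_apply]

theorem pair_smul (n : ℤ) (a : P → ℤ) (I : X) : M.pair (n • a) I = n * M.pair a I := by
  rw [pair, smul_dotProduct, smul_eq_mul, pair]

theorem pair_eq (a : P → ℤ) (I J : X) : M.pair a J = M.pair a I + form A a (M.pos J - M.pos I) := by
  rw [pair, M.wt_eq I J, dotProduct_add, pair, form]

theorem exists_reflect (p : P) (I : X) :
    ∃ J, M.pos J = M.pos I - M.wt I p • simpleRoot p := by
  rcases M.wt_mem I p with h | h | h
  · obtain ⟨J, hJ⟩ := M.exists_add I p h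
    exact ⟨J, by rw [hJ, h]; module⟩
  · exact ⟨I, by rw [h]; module⟩
  · obtain ⟨J, hJ⟩ := M.exists_sub I p h
    exact ⟨J, by rw [hJ, h]; module⟩

/-- The action of a simple reflection on the set of basis vectors. -/
noncomputable def reflectIdx (p : P) (I : X) : X := (M.exists_reflect p I).choose

theorem pos_reflectIdx (p : P) (I : X) :
    M.pos (M.reflectIdx p I) = M.pos I - M.wt I p • simpleRoot p :=
  (M.exists_reflect p I).choose_spec

theorem pair_reflectIdx (hs : A.IsSymm) (p : P) (a : P → ℤ) (I : X) :
    M.pair a (M.reflectIdx p I) = M.pair (reflect A p a) I := by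
  rw [M.pair_eq a I, pos_reflectIdx, reflect_eq, sub_eq_add_neg a, pair_add, pair_neg, pair_smul,
    pair_simpleRoot, sub_sub_cancel_left, form_neg_right, form_smul_right, form_comm hs, mul_comm]

theorem pos_reflectIdx_sub (p : P) (I J : X) :
    M.pos (M.reflectIdx p J) - M.pos (M.reflectIdx p I) =
      reflect A p (M.pos J - M.pos I) := by
  have h : M.wt J p = M.wt I p + A.mulVec (M.pos J - M.pos I) p := by
    rw [M.wt_eq I J, Pi.add_apply]
  rw [pos_reflectIdx, pos_reflectIdx, reflect, h]
  module

theorem reflectIdx_reflectIdx (h2 : ∀ p, A p p = 2) (p : P) (I : X) :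
    M.reflectIdx p (M.reflectIdx p I) = I := by
  apply M.pos_injective
  have h : M.wt (M.reflectIdx p I) p = - M.wt I p := by
    rw [M.wt_eq I, pos_reflectIdx, sub_sub_cancel_left, Pi.add_apply, Matrix.mulVec_neg,
      Matrix.mulVec_smul, Pi.neg_apply, Pi.smul_apply, mulVec_simpleRoot, h2, smul_eq_mul]
    ring
  rw [pos_reflectIdx, pos_reflectIdx, h]
  module

/-- This is minusculity for all real roots. Simple reflections act on the index set, compatibly with
pairings and with differences of positions, so both claims are transported from simple roots. -/
theorem pair_root (hs : A.IsSymm) (h2 : ∀ p, A p p = 2) {S : Set P} {a : P → ℤ}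
    (ha : IsRoot A S a) (I : X) :
    (M.pair a I = -1 ∨ M.pair a I = 0 ∨ M.pair a I = 1) ∧
      (M.pair a I = -1 ↔ ∃ J, M.pos J = M.pos I + a) := by
  induction ha generalizing I with
  | simple p hp =>
    rw [pair_simpleRoot]
    refine ⟨M.wt_mem I p, M.exists_add I p, fun ⟨J, hJ⟩ => ?_⟩
    -- Adding `α_p` raises the label at `p` by 2, which is possible only from -1 to 1.
    have h := congrFun (M.wt_eq I J) p
    rw [hJ, add_sub_cancel_left, Pi.add_apply, mulVec_simpleRoot, h2] at h
    have h1 := M.wt_mem I p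
    have h3 := M.wt_mem J p
    omega
  | refl p hp v hv ih =>
    rw [← M.pair_reflectIdx hs]
    refine ⟨(ih _).1, (ih _).2.trans ?_⟩
    constructor
    · rintro ⟨J, hJ⟩
      refine ⟨M.reflectIdx p J, ?_⟩
      have := M.pos_reflectIdx_sub p (M.reflectIdx p I) J
      rw [hJ, M.reflectIdx_reflectIdx h2, add_sub_cancel_left] at this
      rw [← this]; abel
    · rintro ⟨J, hJ⟩
      refine ⟨M.reflectIdx p J, ?_⟩
      have := M.pos_reflectIdx_sub p I J
      rw [hJ, add_sub_cancel_left, reflect_reflect (h2 p)] at this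
      rw [← this]; abel

theorem sign_self (I : X) : M.sign I I = 1 := by
  have := M.sign_mul I I I
  rw [sub_self, sgnLattice_zero_left, one_mul] at this
  exact mul_eq_right.1 this

variable (k : Type*) [Field k]

/-- The operator of a root vector. -/
noncomputable def rootOp (a : P → ℤ) : Module.End k (X →₀ k) :=
  shiftOp k (fun I J => M.pos J = M.pos I + a) M.sign

variable {k}

theorem rootOp_of_pos {a : P → ℤ} {I J : X} (h : M.pos J = M.pos I + a) :
    M.rootOp k a (Finsupp.single I 1) = ((M.sign J I : ℤ) : k) • Finsupp.single J 1 :=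
  shiftOp_of_rel (R := fun I J => M.pos J = M.pos I + a)
    (fun _ _ _ h h' => M.pos_injective (h.trans h'.symm)) h

theorem rootOp_of_not {a : P → ℤ} {I : X} (h : ¬ ∃ J, M.pos J = M.pos I + a) :
    M.rootOp k a (Finsupp.single I 1) = 0 :=
  shiftOp_of_not h

theorem rootOp_rootOp_of_pos {a b : P → ℤ} {I J K : X} (hJ : M.pos J = M.pos I + b)
    (hK : M.pos K = M.pos I + (a + b)) :
    M.rootOp k a (M.rootOp k b (Finsupp.single I 1)) =
      ((sgnLattice arrow a b * M.sign K I : ℤˣ) : ℤ) • Finsupp.single K (1 : k) := by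
  have h := M.sign_mul I J K
  have h1 : M.pos K = M.pos J + a := by rw [hK, hJ]; abel
  have e1 : M.pos K - M.pos J = a := by rw [h1]; abel
  have e2 : M.pos J - M.pos I = b := by rw [hJ]; abel
  rw [e1, e2] at h
  rw [M.rootOp_of_pos hJ, map_smul, M.rootOp_of_pos h1, smul_smul, ← h, ← Int.cast_smul_eq_zsmul k,
    mul_comm (M.sign K J), Units.val_mul, Int.cast_mul]

theorem rootOp_rootOp_of_not {a b : P → ℤ} {I : X} (h : ¬ ∃ J, M.pos J = M.pos I + b) :
    M.rootOp k a (M.rootOp k b (Finsupp.single I 1)) = 0 := by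
  rw [M.rootOp_of_not h, map_zero]

theorem rootOp_rootOp_of_not_add {a b : P → ℤ} {I : X}
    (h : ¬ ∃ K, M.pos K = M.pos I + (a + b)) :
    M.rootOp k a (M.rootOp k b (Finsupp.single I 1)) = 0 := by
  by_cases hJ : ∃ J, M.pos J = M.pos I + b
  · obtain ⟨J, hJ⟩ := hJ
    rw [M.rootOp_of_pos hJ, map_smul, M.rootOp_of_not, smul_zero]
    rintro ⟨K, hK⟩
    exact h ⟨K, by rw [hK, hJ]; abel⟩
  · exact M.rootOp_rootOp_of_not hJ

section Brackets

variable (hA : IsSimplyLacedAffine A o) (harrow : IsOrientation A arrow) {S : Set P}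
  {a b : P → ℤ}

include hA harrow

/-- Where the step by `a + b` exists, the pairings of `a` and `b` sum to -1, so one is -1 and the
other 0. Exactly one order of composition survives. The order `b` after `a` gets the right sign
because `(a, b) = -1` makes `sgn(b, a) = -sgn(a, b)`. -/
theorem rootOp_lie_of_add (ha : IsRoot A S a) (hb : IsRoot A S b) (hab : IsRoot A S (a + b)) :
    commutatorEnd (M.rootOp k a) (M.rootOp k b) = ((sgnLattice arrow a b : ℤˣ) : ℤ) • M.rootOp k
      (a + b) := by
  refine end_ext fun I => ?_
  rw [commutatorEnd_apply, LinearMap.smul_apply]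
  by_cases hK : ∃ K, M.pos K = M.pos I + (a + b)
  · have pa := M.pair_root hA.symm hA.gcm.diag ha I
    have pb := M.pair_root hA.symm hA.gcm.diag hb I
    have pab := (M.pair_root hA.symm hA.gcm.diag hab I).2.2 hK
    rw [pair_add] at pab
    obtain ⟨K, hK⟩ := hK
    have hK' : M.pos K = M.pos I + (b + a) := by rw [hK, add_comm a b]
    rw [M.rootOp_of_pos hK, Int.cast_smul_eq_zsmul]
    rcases pa.1 with h | h | h
    · obtain ⟨J, hJ⟩ := pa.2.1 h
      have hn : ¬ ∃ J, M.pos J = M.pos I + b := fun hh => by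
        have := pb.2.2 hh; omega
      have hsw := sgnLattice_mul_swap hA harrow a b
      rw [ha.form_of_add hA.symm hA.gcm.diag hb hab] at hsw
      have hsw' : sgnLattice arrow b a = - sgnLattice arrow a b := by
        rcases Int.units_eq_one_or (sgnLattice arrow a b) with h1 | h1 <;>
          rcases Int.units_eq_one_or (sgnLattice arrow b a) with h2 | h2 <;>
          rw [h1, h2] at hsw ⊢ <;> simp at hsw ⊢
      rw [M.rootOp_rootOp_of_not hn, M.rootOp_rootOp_of_pos hJ hK', hsw', smul_smul]
      push_cast
      module
    · have h' : M.pair b I = -1 := by omega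
      obtain ⟨J, hJ⟩ := pb.2.1 h'
      have hn : ¬ ∃ J, M.pos J = M.pos I + a := fun hh => by
        have := pa.2.2 hh; omega
      rw [M.rootOp_rootOp_of_not hn, M.rootOp_rootOp_of_pos hJ hK, sub_zero, smul_smul,
        Units.val_mul]
    · have := pb.1; omega
  · rw [M.rootOp_rootOp_of_not_add hK, M.rootOp_rootOp_of_not_add (by rwa [add_comm b a]),
      M.rootOp_of_not hK, sub_zero, smul_zero]

/-- For orthogonal roots the two intermediate steps exist together and the signs agree. For a
positive pairing neither composition can be nonzero. -/
theorem rootOp_lie_of_form_nonneg (ha : IsRoot A S a) (hb : IsRoot A S b)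
    (hab : 0 ≤ form A a b) : commutatorEnd (M.rootOp k a) (M.rootOp k b) = 0 := by
  refine end_ext fun I => ?_
  rw [commutatorEnd_apply, LinearMap.zero_apply]
  by_cases hK : ∃ K, M.pos K = M.pos I + (a + b)
  · obtain ⟨K, hK⟩ := hK
    have hK' : M.pos K = M.pos I + (b + a) := by rw [hK, add_comm a b]
    have pa := M.pair_root hA.symm hA.gcm.diag ha I
    have pb := M.pair_root hA.symm hA.gcm.diag hb I
    -- The intermediate element is reached backwards, by subtracting `a` from the endpoint `K`.
    have hJ : (∃ J, M.pos J = M.pos I + b) ↔ M.pair a I = -1 - form A a b := by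
      have h := (M.pair_root hA.symm hA.gcm.diag (ha.neg hA.gcm.diag) K).2
      rw [pair_neg, M.pair_eq a I, hK, add_sub_cancel_left, form_add_right,
        ha.form_self hA.symm hA.gcm.diag] at h
      have e : ∀ J, M.pos J = M.pos I + (a + b) + -a ↔ M.pos J = M.pos I + b := fun J => by
        rw [show M.pos I + (a + b) + -a = M.pos I + b by abel]
      simp only [e] at h
      rw [← h]
      omega
    have hJ' : (∃ J, M.pos J = M.pos I + a) ↔ M.pair b I = -1 - form A a b := by
      have h := (M.pair_root hA.symm hA.gcm.diag (hb.neg hA.gcm.diag) K).2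
      rw [pair_neg, M.pair_eq b I, hK, add_sub_cancel_left, form_add_right,
        hb.form_self hA.symm hA.gcm.diag, form_comm hA.symm b a] at h
      have e : ∀ J, M.pos J = M.pos I + (a + b) + -b ↔ M.pos J = M.pos I + a := fun J => by
        rw [show M.pos I + (a + b) + -b = M.pos I + a by abel]
      simp only [e] at h
      rw [← h]
      omega
    by_cases h0 : form A a b = 0
    · have hiff : (∃ J, M.pos J = M.pos I + b) ↔ ∃ J, M.pos J = M.pos I + a := by
        rw [hJ, ← pa.2, h0, sub_zero]
      have hsw := sgnLattice_mul_swap hA harrow a b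
      rw [h0, zpow_zero] at hsw
      have hsw' : sgnLattice arrow b a = sgnLattice arrow a b := by
        rcases Int.units_eq_one_or (sgnLattice arrow a b) with h1 | h1 <;>
          rcases Int.units_eq_one_or (sgnLattice arrow b a) with h2 | h2 <;>
          rw [h1, h2] at hsw ⊢ <;> simp at hsw
      by_cases hex : ∃ J, M.pos J = M.pos I + b
      · obtain ⟨J', hJ'⟩ := hiff.1 hex
        obtain ⟨J, hJ⟩ := hex
        rw [M.rootOp_rootOp_of_pos hJ hK, M.rootOp_rootOp_of_pos hJ' hK', hsw', sub_self]
      · rw [M.rootOp_rootOp_of_not hex, M.rootOp_rootOp_of_not (mt hiff.2 hex), sub_self]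
    -- Here `(a, b) > 0`, so an intermediate step would need a pairing below -1.
    · have h1 := pa.1
      have h2 := pb.1
      rw [M.rootOp_rootOp_of_not (by rw [hJ]; omega), M.rootOp_rootOp_of_not (by rw [hJ']; omega),
        sub_self]
  · rw [M.rootOp_rootOp_of_not_add hK, M.rootOp_rootOp_of_not_add (by rwa [add_comm b a]),
      sub_self]

/-- Both compositions return to `I`. At most one is nonzero, according to the pairing, and its sign
is `sgn(a, a) = -1`. -/
theorem rootOp_lie_neg (ha : IsRoot A S a) :
    commutatorEnd (M.rootOp k a) (M.rootOp k (-a)) = -diagOp k (M.pair a) := by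
  refine end_ext fun I => ?_
  rw [commutatorEnd_apply, LinearMap.neg_apply, diagOp_single]
  have pa := M.pair_root hA.symm hA.gcm.diag ha I
  have pn := M.pair_root hA.symm hA.gcm.diag (ha.neg hA.gcm.diag) I
  rw [pair_neg] at pn
  have hI : M.pos I = M.pos I + (a + -a) := by abel
  have hI' : M.pos I = M.pos I + (-a + a) := by abel
  have s1 : sgnLattice arrow a (-a) = -1 := by
    rw [sgnLattice_neg_right, ha.sgnLattice_self hA harrow]
  have s2 : sgnLattice arrow (-a) a = -1 := by
    rw [sgnLattice_neg_left, ha.sgnLattice_self hA harrow]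
  rcases pa.1 with h | h | h
  · obtain ⟨J, hJ⟩ := pa.2.1 h
    have hn : ¬ ∃ J, M.pos J = M.pos I + -a := fun hh => by
      have := pn.2.2 hh; omega
    rw [M.rootOp_rootOp_of_not hn, M.rootOp_rootOp_of_pos hJ hI', s2, M.sign_self, h]
    simp
  · have hn : ¬ ∃ J, M.pos J = M.pos I + -a := fun hh => by
      have := pn.2.2 hh; omega
    have hn' : ¬ ∃ J, M.pos J = M.pos I + a := fun hh => by
      have := pa.2.2 hh; omega
    rw [M.rootOp_rootOp_of_not hn, M.rootOp_rootOp_of_not hn', h]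
    simp
  · obtain ⟨J, hJ⟩ := pn.2.1 (by omega)
    have hn' : ¬ ∃ J, M.pos J = M.pos I + a := fun hh => by
      have := pa.2.2 hh; omega
    rw [M.rootOp_rootOp_of_not hn', M.rootOp_rootOp_of_pos hJ hI, s1, M.sign_self, h]
    simp

end Brackets

end LatticeModel

/-! ### Folded models and Kac's relations for the folded roots. -/

variable {P : Type*} [Fintype P]

/-- A lattice model that is compatible with a folding: an element is determined by its folded
position, and steps of the folded position by a simple root come from steps by a simple root. -/
structure FoldedModel (A : Matrix P P ℤ) (arrow : P → P → Prop) (μ : Equiv.Perm P) (X : Type*)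
    extends LatticeModel A arrow X where
  fold_injective : Function.Injective fun I => fold μ (pos I)
  exists_of_simple : ∀ I J p, fold μ (pos J - pos I) = simpleRoot (bar μ p) →
    ∃ q, pos J - pos I = simpleRoot q

/-- The squared length of `f(a) - n f(b)`, up to a factor, when this is the image of a root. -/
theorem RootFolding.form_fold_sub {A : Matrix P P ℤ} {o : P} {μ : Equiv.Perm P}
    (F : RootFolding A o μ) {a b : P → ℤ} (ha : IsRoot A {p | p ≠ o} a)
      (hb : IsRoot A {p | p ≠ o} b) (n : ℕ)
    (h : fold μ a - (n : ℤ) • fold μ b ∈ foldedRoots A μ o) :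
    (4 + 2 * form A a (act μ a) + n * n * (4 + 2 * form A b (act μ b)) -
      4 * n * (form A a b + form A a (act μ b)) = 4) ∨
    4 + 2 * form A a (act μ a) + n * n * (4 + 2 * form A b (act μ b)) -
      4 * n * (form A a b + form A a (act μ b)) = 8 := by
  obtain ⟨c, hc, hcf⟩ := h
  have h1 := F.folds.form_add_act F.affine (F.isRoot_fold c hc) rfl
  have h2 : c + act μ c = (a + act μ a) - (n : ℤ) • (b + act μ b) := by
    rw [← fold_smul, ← fold_sub] at hcf
    rw [F.folds.add_act_eq hcf, act_sub, act_smul]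
    module
  rw [h2] at h1
  simp only [form_sub_left, form_sub_right, form_smul_left, form_smul_right, form_add_left,
    form_add_right, F.folds.form_act, F.form_self ha, F.form_self hb, ← F.form_act_right] at h1
  have e1 := form_comm F.symm b a
  have e2 : form A b (act μ a) = form A a (act μ b) := by
    rw [form_comm F.symm, F.form_act_right]
  rw [e1, e2] at h1
  refine h1.imp (fun h => ?_) fun h => ?_ <;> linear_combination h

theorem isRoot_of_foldReflect {A : Matrix P P ℤ} {μ : Equiv.Perm P} {S : Set P}
    (h2 : ∀ p, A p p = 2) {p : P} (hp : p ∈ S)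
    (hp' : μ p ∈ S) {a : P → ℤ} (ha : IsRoot A S (foldReflect A μ p a)) : IsRoot A S a := by
  rw [foldReflect] at ha
  split_ifs at ha with h
  · have := ha.refl p hp
    rwa [reflect_reflect (h2 p)] at this
  · have := (ha.refl p hp).refl _ hp'
    rwa [reflect_reflect (h2 p), reflect_reflect (h2 _)] at this

namespace FoldedModel

variable {A : Matrix P P ℤ} {arrow : P → P → Prop} {μ : Equiv.Perm P} {X : Type*}
  (M : FoldedModel A arrow μ X) {o : P}

theorem eq_of_fold {I J J' : X} {γ : Orb μ → ℤ} (h : fold μ (M.pos J - M.pos I) = γ)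
    (h' : fold μ (M.pos J' - M.pos I) = γ) : J = J' := by
  apply M.fold_injective
  rw [← h', fold_sub, fold_sub] at h
  exact sub_left_injective h

variable (k : Type*) [Field k]

/-- The operator of a root vector for a folded root. -/
noncomputable def op (γ : Orb μ → ℤ) : Module.End k (X →₀ k) :=
  shiftOp k (fun I J => fold μ (M.pos J - M.pos I) = γ) M.sign

/-- The weight labels of the folded model. -/
noncomputable def foldWt (I : X) (x : Orb μ) : ℤ := fold μ (M.wt I) x

variable {k}

theorem op_of_rel {γ : Orb μ → ℤ} {I J : X} (h : fold μ (M.pos J - M.pos I) = γ) :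
    M.op k γ (Finsupp.single I 1) = ((M.sign J I : ℤ) : k) • Finsupp.single J 1 :=
  shiftOp_of_rel (R := fun I J => fold μ (M.pos J - M.pos I) = γ)
    (fun _ _ _ => M.eq_of_fold) h

theorem op_of_not {γ : Orb μ → ℤ} {I : X} (h : ¬ ∃ J, fold μ (M.pos J - M.pos I) = γ) :
    M.op k γ (Finsupp.single I 1) = 0 :=
  shiftOp_of_not h

theorem exists_foldReflect (p : P) : ∃ σ : X → X, ∀ I J,
    M.pos (σ J) - M.pos (σ I) = foldReflect A μ p (M.pos J - M.pos I) := by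
  by_cases hp : μ p = p
  · exact ⟨M.reflectIdx p, fun I J => by rw [M.pos_reflectIdx_sub, foldReflect, if_pos hp]⟩
  · exact ⟨fun I => M.reflectIdx p (M.reflectIdx (μ p) I), fun I J => by
      rw [M.pos_reflectIdx_sub, M.pos_reflectIdx_sub, foldReflect, if_neg hp]⟩

/-- Reflecting both endpoints turns a step by `v` into a step by the reflected root. This supplies
the nonvanishing of root operators. -/
theorem exists_pos_add_root (hex : ∀ p, ∃ I J, M.pos J = M.pos I + simpleRoot p) {S : Set P}
    {a : P → ℤ}
    (ha : IsRoot A S a) : ∃ I J, M.pos J = M.pos I + a := by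
  induction ha with
  | simple p hp => exact hex p
  | refl p hp v hv ih =>
    obtain ⟨I, J, h⟩ := ih
    refine ⟨M.reflectIdx p I, M.reflectIdx p J, ?_⟩
    have := M.pos_reflectIdx_sub p I J
    rw [h, add_sub_cancel_left] at this
    rw [← this]
    abel

variable (F : RootFolding A o μ)

include F

/-- A lattice vector that folds to a root need not be a root, but a difference of positions is: each
folded reflection lifts to a permutation of the model, which reduces the claim to simple roots,
where `exists_of_simple` applies. -/
theorem isRoot_of_isRoot_fold {γ : Orb μ → ℤ}
    (hγ : IsRoot (foldedMatrix A μ) (finiteOrbs μ o) γ) {I J : X}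
    (h : fold μ (M.pos J - M.pos I) = γ) : IsRoot A {p | p ≠ o} (M.pos J - M.pos I) := by
  induction hγ generalizing I J with
  | simple x hx =>
    obtain ⟨p, hp, rfl⟩ := hx
    obtain ⟨q, hq⟩ := M.exists_of_simple I J p h
    rw [hq, fold_simpleRoot] at h
    have hpq : bar μ p = bar μ q := by
      have := congrFun h (bar μ q)
      by_contra hne
      rw [simpleRoot_self, simpleRoot_of_ne (Ne.symm hne)] at this
      exact one_ne_zero this
    rw [hq]
    refine .simple q ?_
    rcases F.folds.bar_eq_bar.1 hpq with rfl | rfl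
    · exact hp
    · exact F.apply_ne hp
  | refl x hx v hv ih =>
    obtain ⟨p, hp, rfl⟩ := hx
    obtain ⟨σ, hσ⟩ := M.exists_foldReflect p
    have h1 := F.folds.fold_foldReflect_of_eq F.affine h
    rw [← hσ] at h1
    have h3 := ih h1
    rw [hσ] at h3
    exact isRoot_of_foldReflect F.diag hp (F.apply_ne hp) h3

theorem eq_or_eq_act {a : P → ℤ} (ha : IsRoot A {p | p ≠ o} a) {I J : X}
    (h : fold μ (M.pos J - M.pos I) = fold μ a) :
    M.pos J - M.pos I = a ∨ M.pos J - M.pos I = act μ a :=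
  F.eq_or_eq_act ha (M.isRoot_of_isRoot_fold F (F.isRoot_fold a ha) h) h.symm

theorem op_fold_of_act_eq {a : P → ℤ} (ha : IsRoot A {p | p ≠ o} a) (h : act μ a = a) :
    M.op k (fold μ a) = M.rootOp k a := by
  refine end_ext fun I => ?_
  by_cases hJ : ∃ J, M.pos J = M.pos I + a
  · obtain ⟨J, hJ⟩ := hJ
    rw [M.rootOp_of_pos hJ, M.op_of_rel (by rw [hJ, add_sub_cancel_left])]
  · rw [M.rootOp_of_not hJ, M.op_of_not]
    rintro ⟨J, hJ'⟩
    refine hJ ⟨J, ?_⟩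
    rcases M.eq_or_eq_act F ha hJ' with h1 | h1
    · rw [← h1]; abel
    · rw [← h, ← h1]; abel

/-- Steps that fold to `f(a)` are steps by `a` or by `μ(a)`. The two never start at the same
element, since folded positions separate elements, so the operators add without overlap. -/
theorem op_fold_of_act_ne {a : P → ℤ} (ha : IsRoot A {p | p ≠ o} a) (h : act μ a ≠ a) :
    M.op k (fold μ a) = M.rootOp k a + M.rootOp k (act μ a) := by
  refine end_ext fun I => ?_
  rw [LinearMap.add_apply]
  have huniq : ∀ J J', M.pos J = M.pos I + a → M.pos J' = M.pos I + act μ a → False := by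
    intro J J' hJ hJ'
    have : J = J' := M.eq_of_fold (I := I) (γ := fold μ a) (by rw [hJ, add_sub_cancel_left])
      (by rw [hJ', add_sub_cancel_left, F.folds.fold_act])
    rw [← this, hJ] at hJ'
    exact h (add_left_cancel hJ').symm
  by_cases hJ : ∃ J, M.pos J = M.pos I + a
  · obtain ⟨J, hJ⟩ := hJ
    rw [M.rootOp_of_pos hJ, M.op_of_rel (by rw [hJ, add_sub_cancel_left]),
      M.rootOp_of_not fun ⟨J', hJ'⟩ => huniq J J' hJ hJ', add_zero]
  · rw [M.rootOp_of_not hJ, zero_add]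
    by_cases hJ' : ∃ J, M.pos J = M.pos I + act μ a
    · obtain ⟨J, hJ'⟩ := hJ'
      rw [M.rootOp_of_pos hJ', M.op_of_rel (by rw [hJ', add_sub_cancel_left, F.folds.fold_act])]
    · rw [M.rootOp_of_not hJ', M.op_of_not]
      rintro ⟨J, hJ1⟩
      rcases M.eq_or_eq_act F ha hJ1 with h1 | h1
      · exact hJ ⟨J, by rw [← h1]; abel⟩
      · exact hJ' ⟨J, by rw [← h1]; abel⟩

section Brackets

variable (harrow : IsOrientation A arrow) (hcomp : Compatible μ arrow) {a b : P → ℤ}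

include harrow

/-- Expanding both operators, every pair of lifts has a sum that is neither a root nor zero, hence a
nonnegative pairing. -/
theorem op_lie_of_not_mem (ha : IsRoot A {p | p ≠ o} a) (hb : IsRoot A {p | p ≠ o} b)
    (h : fold μ a + fold μ b ∉ foldedRoots A μ o) (h0 : fold μ a + fold μ b ≠ 0) :
    commutatorEnd (M.op k (fold μ a)) (M.op k (fold μ b)) = 0 := by
  have key : ∀ a' b', IsRoot A {p | p ≠ o} a' → IsRoot A {p | p ≠ o} b' →
      fold μ a' = fold μ a → fold μ b' = fold μ b →
      commutatorEnd (M.rootOp k a') (M.rootOp k b') = 0 := by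
    intro a' b' ha' hb' e1 e2
    refine M.rootOp_lie_of_form_nonneg F.affine harrow ha' hb'
      (ha'.form_nonneg F.affine hb' (fun hr => h ?_) fun hr => h0 ?_)
    · rw [← e1, ← e2, ← fold_add]; exact ⟨_, hr, rfl⟩
    · rw [← e1, ← e2, ← fold_add, hr, fold_zero]
  have k1 := key a b ha hb rfl rfl
  have k2 := key a (act μ b) ha (F.isRoot_act hb) rfl (F.folds.fold_act b)
  have k3 := key (act μ a) b (F.isRoot_act ha) hb (F.folds.fold_act a) rfl
  have k4 := key (act μ a) (act μ b) (F.isRoot_act ha) (F.isRoot_act hb) (F.folds.fold_act a)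
    (F.folds.fold_act b)
  by_cases haa : act μ a = a <;> by_cases hbb : act μ b = b
  · rw [M.op_fold_of_act_eq F ha haa, M.op_fold_of_act_eq F hb hbb, k1]
  · rw [M.op_fold_of_act_eq F ha haa, M.op_fold_of_act_ne F hb hbb, commutatorEnd_add_right, k1,
      k2, add_zero]
  · rw [M.op_fold_of_act_ne F ha haa, M.op_fold_of_act_eq F hb hbb, commutatorEnd_add_left, k1, k3,
      add_zero]
  · rw [M.op_fold_of_act_ne F ha haa, M.op_fold_of_act_ne F hb hbb, commutatorEnd_add_left,
      commutatorEnd_add_right, commutatorEnd_add_right,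
      k1, k2, k3, k4, add_zero, add_zero]

theorem op_lie_neg_of_act_eq (ha : IsRoot A {p | p ≠ o} a) (h : act μ a = a) :
    commutatorEnd (M.op k (fold μ a)) (M.op k (-fold μ a)) = -diagOp k (M.pair a) := by
  rw [← fold_neg, M.op_fold_of_act_eq F ha h,
    M.op_fold_of_act_eq F (ha.neg F.diag) (by rw [act_neg, h]),
    M.rootOp_lie_neg F.affine harrow ha]

/-- The cross terms vanish because `a` and `μ(a)` are orthogonal. -/
theorem op_lie_neg_of_act_ne (ha : IsRoot A {p | p ≠ o} a) (h : act μ a ≠ a) :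
    commutatorEnd (M.op k (fold μ a)) (M.op k (-fold μ a)) =
      -diagOp k (fun I => M.pair a I + M.pair (act μ a) I) := by
  have ha' := F.isRoot_act ha
  have h0 := F.form_act_self ha h
  rw [← fold_neg, M.op_fold_of_act_ne F ha h,
    M.op_fold_of_act_ne F (ha.neg F.diag) (by rw [act_neg]; exact fun e => h (neg_injective e)),
    commutatorEnd_add_left, commutatorEnd_add_right, commutatorEnd_add_right, act_neg,
      M.rootOp_lie_neg F.affine harrow ha,
    M.rootOp_lie_neg F.affine harrow ha',
    M.rootOp_lie_of_form_nonneg F.affine harrow ha (ha'.neg F.diag)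
      (by rw [form_neg_right, h0, neg_zero]),
    M.rootOp_lie_of_form_nonneg F.affine harrow ha' (ha.neg F.diag)
      (by rw [form_neg_right, form_comm F.symm, h0, neg_zero]), diagOp_add]
  abel

/-- The bracket of two root vectors for folded roots. -/
theorem op_lie_of_add (hcomp : Compatible μ arrow) (ha : IsRoot A {p | p ≠ o} a)
    (hb : IsRoot A {p | p ≠ o} b) (hab : IsRoot A {p | p ≠ o} (a + b)) :
    ∃ m : ℕ, (m = 0 ∨ m = 1) ∧
      IsGreatest {n : ℕ | fold μ a - (n : ℤ) • fold μ b ∈ foldedRoots A μ o} m ∧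
      commutatorEnd (M.op k (fold μ a)) (M.op k (fold μ b)) =
        (((m : ℤ) + 1) * (sgnLattice arrow a b : ℤ)) • M.op k (fold μ (a + b)) := by
  have hA := F.affine
  have ha' := F.isRoot_act ha
  have hb' := F.isRoot_act hb
  have hab' := F.isRoot_act hab
  have hf := ha.form_of_add F.symm F.diag hb hab
  have hnorm := F.folds.form_add_act hA (F.isRoot_fold _ hab) rfl
  have hstr := F.form_fold_sub ha hb
  have h0mem : fold μ a - ((0 : ℕ) : ℤ) • fold μ b ∈ foldedRoots A μ o :=
    ⟨a, ha, by simp⟩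
  have hs : sgnLattice arrow (act μ a) (act μ b) = sgnLattice arrow a b :=
    F.folds.sgnLattice_act hcomp a b
  have hgreat0 : (∀ n : ℕ, fold μ a - (n : ℤ) • fold μ b ∈ foldedRoots A μ o → n = 0) →
      IsGreatest {n : ℕ | fold μ a - (n : ℤ) • fold μ b ∈ foldedRoots A μ o} 0 := fun h =>
    ⟨h0mem, fun n hn => (h n hn).le⟩
  have R1 := M.rootOp_lie_of_add (k := k) hA harrow ha hb hab
  have R4 := M.rootOp_lie_of_add (k := k) hA harrow ha' hb' hab'
  rw [← act_add, hs] at R4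
  by_cases haa : act μ a = a
  -- With `a` fixed, `a + μ(b)` is a root as well, so both summands of the operator of `f(b)`
  -- contribute.
  · have hg : form A a (act μ b) = -1 := by rw [F.form_act_right, haa, hf]
    rw [haa, hg, hf, F.form_self ha] at hstr
    by_cases hbb : act μ b = b
    · rw [hbb, F.form_self hb] at hstr
      refine ⟨0, Or.inl rfl, hgreat0 fun n hn => by_contra fun hpos => ?_, ?_⟩
      -- For `n ≥ 1` the norm of the symmetrisation exceeds 8, so `f(a) - n f(b)` is not a folded
      -- root.
      · have : (1 : ℤ) ≤ n := by exact_mod_cast Nat.one_le_iff_ne_zero.2 hpos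
        rcases hstr n hn with h | h <;> nlinarith
      · rw [M.op_fold_of_act_eq F ha haa, M.op_fold_of_act_eq F hb hbb,
          M.op_fold_of_act_eq F hab (by rw [act_add, haa, hbb]), R1]
        simp
    · rw [F.form_act_self hb hbb] at hstr
      refine ⟨0, Or.inl rfl, hgreat0 fun n hn => by_contra fun hpos => ?_, ?_⟩
      · have : (1 : ℤ) ≤ n := by exact_mod_cast Nat.one_le_iff_ne_zero.2 hpos
        rcases hstr n hn with h | h <;> nlinarith
      · rw [haa] at R4
        rw [M.op_fold_of_act_eq F ha haa, M.op_fold_of_act_ne F hb hbb,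
          M.op_fold_of_act_ne F hab (by rw [act_add, haa]; exact fun e => hbb (add_left_cancel e)),
          commutatorEnd_add_right, R1, R4]
        simp
  · by_cases hbb : act μ b = b
    · have hg : form A a (act μ b) = -1 := by rw [hbb, hf]
      rw [F.form_act_self ha haa, hg, hf, hbb, F.form_self hb] at hstr
      refine ⟨0, Or.inl rfl, hgreat0 fun n hn => by_contra fun hpos => ?_, ?_⟩
      · have : (1 : ℤ) ≤ n := by exact_mod_cast Nat.one_le_iff_ne_zero.2 hpos
        rcases hstr n hn with h | h <;> nlinarith
      · rw [hbb] at R4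
        rw [M.op_fold_of_act_ne F ha haa, M.op_fold_of_act_eq F hb hbb,
          M.op_fold_of_act_ne F hab (by rw [act_add, hbb]; exact fun e => haa (add_right_cancel e)),
          commutatorEnd_add_left, R1, R4]
        simp
    -- Both roots are moved. This norm is 4 or 8, so `(a, μ(b))` is 0 or 1; the value 1 means that
    -- `a + b` is fixed, that is, two short roots add to a long one.
    · have hn : form A (a + b + act μ (a + b)) (a + b + act μ (a + b)) =
          4 + 4 * form A a (act μ b) := by
        have e1 := form_comm F.symm b a
        have e2 : form A b (act μ a) = form A a (act μ b) := by
          rw [form_comm F.symm, F.form_act_right]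
        simp only [act_add, form_add_left, form_add_right, F.folds.form_act, F.form_self ha,
          F.form_self hb, ← F.form_act_right, F.form_act_self ha haa, F.form_act_self hb hbb,
          e1, e2, hf]
        ring
      rw [F.form_act_self ha haa, F.form_act_self hb hbb, hf] at hstr
      have hfix : act μ (a + b) = a + b ↔ form A a (act μ b) = 1 := by
        have h3 : form A (a + b + act μ (a + b)) (a + b + act μ (a + b)) =
            4 + 2 * form A (a + b) (act μ (a + b)) := by
          simp only [form_add_left _ (a + b), form_add_right _ _ (a + b), F.folds.form_act,
            F.form_self hab, ← F.form_act_right]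
          ring
        constructor
        · intro h
          rw [h, F.form_self hab] at h3
          rw [h] at hn
          omega
        · intro h
          by_contra hne
          rw [F.form_act_self hab hne] at h3
          omega
      have hcross : 0 ≤ form A a (act μ b) := by omega
      have R2 := M.rootOp_lie_of_form_nonneg (k := k) hA harrow ha hb' hcross
      have R3 := M.rootOp_lie_of_form_nonneg (k := k) hA harrow ha' hb
        (by rwa [← F.form_act_right])
      by_cases hgg : form A a (act μ b) = 1
      · rw [hgg] at hstr
        refine ⟨1, Or.inr rfl, ⟨?_, fun n hn => ?_⟩, ?_⟩
        -- Since `(a, μ(b)) = 1`, the vector `a - μ(b)` is a root, and it folds to `f(a) - f(b)`;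
        -- hence `m ≥ 1`.
        · refine ⟨a + -act μ b, ha.add F.symm F.diag (hb'.neg F.diag)
            (by rw [form_neg_right, hgg]), ?_⟩
          rw [fold_add, fold_neg, F.folds.fold_act]
          push_cast
          module
        · by_contra hlt
          have : (2 : ℤ) ≤ n := by exact_mod_cast not_le.1 hlt
          rcases hstr n hn with h | h <;> nlinarith
        -- The brackets of `a` with `b` and of `μ(a)` with `μ(b)` both give the operator of the
        -- fixed root `a + b`, whence the factor 2.
        · rw [hfix.2 hgg] at R4
          rw [M.op_fold_of_act_ne F ha haa, M.op_fold_of_act_ne F hb hbb,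
            M.op_fold_of_act_eq F hab (hfix.2 hgg), commutatorEnd_add_left,
            commutatorEnd_add_right, commutatorEnd_add_right, R1, R2, R3, R4]
          push_cast
          module
      · have hgg' : form A a (act μ b) = 0 := by omega
        rw [hgg'] at hstr
        refine ⟨0, Or.inl rfl, hgreat0 fun n hn => by_contra fun hpos => ?_, ?_⟩
        · have : (1 : ℤ) ≤ n := by exact_mod_cast Nat.one_le_iff_ne_zero.2 hpos
          rcases hstr n hn with h | h <;> nlinarith
        · rw [M.op_fold_of_act_ne F ha haa, M.op_fold_of_act_ne F hb hbb,
            M.op_fold_of_act_ne F hab (mt hfix.1 hgg), commutatorEnd_add_left,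
            commutatorEnd_add_right, commutatorEnd_add_right, R1, R2, R3, R4]
          push_cast
          module

end Brackets

/-- The operators of the root vectors for positive (negative) folded roots lie in every Lie
subalgebra that contains those for the simple roots (their negatives). -/
theorem op_mem_of_simple (harrow : IsOrientation A arrow) (hcomp : Compatible μ arrow)
    (hk : (2 : k) ≠ 0) (W : Submodule k (Module.End k (X →₀ k)))
    (hW : ∀ f ∈ W, ∀ g ∈ W, commutatorEnd f g ∈ W) {u : ℤ} (hu : u = 1 ∨ u = -1)
    (hsimple : ∀ p, p ≠ o → M.op k (fold μ (u • simpleRoot p)) ∈ W)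
    {a : P → ℤ} (ha : IsRoot A {p | p ≠ o} a) (h0 : 0 ≤ a) : M.op k (fold μ (u • a)) ∈ W := by
  have hroot : ∀ c, IsRoot A {p | p ≠ o} c → IsRoot A {p | p ≠ o} (u • c) := by
    intro c hc
    rcases hu with rfl | rfl
    · rwa [one_smul]
    · rw [neg_one_smul]; exact hc.neg F.diag
  refine ha.positive_induction (C := fun c => M.op k (fold μ (u • c)) ∈ W) F.affine hsimple
    (fun p b hp hb hpb h1 h2 => ?_) h0
  obtain ⟨m, hm, -, hbr⟩ := M.op_lie_of_add (k := k) F harrow hcomp (hroot _ (.simple p hp))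
    (hroot _ hb) (by rw [← smul_add]; exact hroot _ hpb)
  have hmem := hW _ h1 _ h2
  have hcast : ∀ (z : ℤ) (f : Module.End k (X →₀ k)), z • f = (z : k) • f :=
    fun z f => (Int.cast_smul_eq_zsmul k z f).symm
  rw [hbr, ← smul_add, hcast] at hmem
  -- The structure constant is ±1 or ±2, hence invertible.
  refine (W.smul_mem_iff ?_).1 hmem
  generalize sgnLattice arrow _ _ = t
  rcases hm with rfl | rfl <;> rcases Int.units_eq_one_or t with rfl | rfl <;> norm_num [hk]

end FoldedModel

/-! ### Characters of finite sets of heap elements. -/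

section Character

variable {P E : Type*} (ε : E → P)

open Classical in
theorem character_apply (L : Finset E) (p : P) :
    character ε L p = ∑ a ∈ L, if ε a = p then 1 else 0 := by
  rw [character, Finset.card_filter]
  push_cast
  rfl

theorem character_empty : character ε ∅ = 0 := by
  funext p; simp [character]

theorem character_singleton (a : E) : character ε {a} = simpleRoot (ε a) := by
  classical
  funext p
  rw [character_apply, simpleRoot_apply, Finset.sum_singleton]
  simp only [eq_comm]

open Classical in
theorem character_insert {a : E} {L : Finset E} (h : a ∉ L) :
    character ε (insert a L) = simpleRoot (ε a) + character ε L := by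
  funext p
  rw [Pi.add_apply, character_apply, character_apply, simpleRoot_apply, Finset.sum_insert h]
  simp only [eq_comm]

theorem character_nonneg (L : Finset E) : 0 ≤ character ε L := fun _ => Int.natCast_nonneg _

theorem character_pos {L : Finset E} {p : P} : 0 < character ε L p ↔ ∃ a ∈ L, ε a = p := by
  classical
  rw [character, Int.natCast_pos, Finset.card_pos]
  simp [Finset.Nonempty, Finset.mem_filter]

theorem exists_eq_singleton {L : Finset E} {p : P} (h : character ε L = simpleRoot p) :
    ∃ a, ε a = p ∧ L = {a} := by
  classical
  have hall : ∀ a ∈ L, ε a = p := fun a ha => by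
    by_contra hne
    have := (character_pos ε).2 ⟨a, ha, rfl⟩
    rw [h, simpleRoot_of_ne hne] at this
    exact lt_irrefl _ this
  have h1 := congrFun h p
  rw [character, Finset.filter_true_of_mem hall, simpleRoot_self] at h1
  obtain ⟨a, rfl⟩ := Finset.card_eq_one.1 (by exact_mod_cast h1)
  exact ⟨a, hall a (by simp), rfl⟩

theorem fold_character [Fintype P] (μ : Equiv.Perm P) (L : Finset E) :
    fold μ (character ε L) = character (barLabel μ ε) L := by
  classical
  funext x
  rw [fold, character_apply]
  simp only [character_apply]
  rw [Finset.sum_comm]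
  refine Finset.sum_congr rfl fun a _ => ?_
  simp only [Finset.sum_ite_eq, Finset.mem_filter, Finset.mem_univ, true_and, barLabel]
  congr

open Classical in
theorem sgnLattice_character [Fintype P] (arrow : P → P → Prop) (L L' : Finset E) :
    sgnLattice arrow (character ε L) (character ε L') =
      ∏ a ∈ L, ∏ b ∈ L', sgn arrow (ε a) (ε b) := by
  have h1 : ∀ a, sgnLattice arrow (simpleRoot (ε a)) (character ε L') =
      ∏ b ∈ L', sgn arrow (ε a) (ε b) := by
    intro a
    induction L' using Finset.induction_on with
    | empty => rw [character_empty, sgnLattice_zero_right, Finset.prod_empty]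
    | insert b L' hb ih =>
      rw [character_insert ε hb, sgnLattice_add_right, sgnLattice_simpleRoot, ih,
        Finset.prod_insert hb]
  induction L using Finset.induction_on with
  | empty => rw [character_empty, sgnLattice_zero_left, Finset.prod_empty]
  | insert a L ha ih =>
    rw [character_insert ε ha, sgnLattice_add_left, h1, ih, Finset.prod_insert ha]

open Classical in
/-- The differences of the numbers of elements of sets with given labels are additive. -/
theorem character_sdiff_add {S T U : Set E} {dST dTS dTU dUT dSU dUS : Finset E}
    (hST : (dST : Set E) = S \ T) (hTS : (dTS : Set E) = T \ S)
    (hTU : (dTU : Set E) = T \ U) (hUT : (dUT : Set E) = U \ T)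
    (hSU : (dSU : Set E) = S \ U) (hUS : (dUS : Set E) = U \ S) :
    (character ε dST - character ε dTS) + (character ε dTU - character ε dUT) =
      character ε dSU - character ε dUS := by
  set W := dST ∪ dTS ∪ dTU ∪ dUT ∪ dSU ∪ dUS with hW
  have key : ∀ (d : Finset E), d ⊆ W → ∀ p, character ε d p =
      ∑ a ∈ W, if a ∈ d ∧ ε a = p then (1 : ℤ) else 0 := by
    intro d hd p
    rw [character_apply, ← Finset.sum_subset hd
      (f := fun a => if a ∈ d ∧ ε a = p then (1 : ℤ) else 0)]
    · exact Finset.sum_congr rfl fun a ha => by simp [ha]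
    · intro a _ ha; simp [ha]
  funext p
  simp only [Pi.add_apply, Pi.sub_apply]
  rw [key dST (by intro; simp +contextual [hW]), key dTS (by intro; simp +contextual [hW]),
    key dTU (by intro; simp +contextual [hW]), key dUT (by intro; simp +contextual [hW]),
    key dSU (by intro; simp +contextual [hW]), key dUS (by intro; simp +contextual [hW]),
    ← Finset.sum_sub_distrib, ← Finset.sum_sub_distrib, ← Finset.sum_sub_distrib,
    ← Finset.sum_add_distrib]
  refine Finset.sum_congr rfl fun a _ => ?_
  have m : ∀ {d : Finset E} {Z : Set E}, (d : Set E) = Z → (a ∈ d ↔ a ∈ Z) :=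
    fun h => by rw [← Finset.mem_coe, h]
  simp only [m hST, m hTS, m hTU, m hUT, m hSU, m hUS]
  -- Pointwise this is the identity (S - T) + (T - U) = S - U for indicator functions.
  by_cases ha : ε a = p <;> by_cases h1 : a ∈ S <;> by_cases h2 : a ∈ T <;>
    by_cases h3 : a ∈ U <;> simp [ha, h1, h2, h3]

end Character

/-! ### Fibres, ideals and weight labels in a full heap. -/

section Heap

variable {P E : Type*} [PartialOrder E] {A : Matrix P P ℤ} {ε : E → P}

/-- The order is generated by concurrent pairs, so `x` is the first nontrivial step of a chain from
`a` to `b`. -/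
theorem IsHeap.exists_conc_right (hE : IsHeap A ε) {a b : E} (h : a < b) :
    ∃ x, a < x ∧ x ≤ b ∧ Conc A (ε a) (ε x) := by
  have ht := (hE.le_iff a b).1 h.le
  induction ht using Relation.TransGen.head_induction_on with
  | single h' => exact ⟨b, h, le_rfl, h'.2⟩
  | @head a c h1 h2 ih =>
    rcases h1.1.eq_or_lt with rfl | hlt
    · exact ih h
    · exact ⟨c, hlt, (hE.le_iff c b).2 h2, h1.2⟩

theorem IsHeap.exists_conc_left (hE : IsHeap A ε) {a b : E} (h : a < b) :
    ∃ x, a ≤ x ∧ x < b ∧ Conc A (ε x) (ε b) := by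
  have ht := (hE.le_iff a b).1 h.le
  induction ht with
  | single h' => exact ⟨a, le_rfl, h, h'.2⟩
  | @tail c b h1 h2 ih =>
    rcases h2.1.eq_or_lt with rfl | hlt
    · exact ih h
    · exact ⟨c, (hE.le_iff a c).2 h1, hlt, h2.2⟩

theorem IsHeap.comparable_of_eq (hE : IsHeap A ε) {a b : E} (h : ε a = ε b) : a ≤ b ∨ b ≤ a :=
  hE.comparable a b (Or.inl h)

/-- Otherwise the part of the fibre above `b₀` lies in finitely many finite intervals, and its
maximal element contradicts unboundedness. -/
theorem IsFibred.exists_not_le (hE : IsFibred A ε) (F : Finset E) (p : P) :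
    ∃ b, ε b = p ∧ ∀ l ∈ F, ¬ b ≤ l := by
  by_contra! hcon
  obtain ⟨b₀, hb₀⟩ := hE.nonempty p
  have hfin : {b | ε b = p ∧ b₀ ≤ b}.Finite := by
    refine (F.finite_toSet.biUnion fun l _ => hE.locallyFinite b₀ l).subset ?_
    rintro b ⟨hb, hle⟩
    obtain ⟨l, hl, hbl⟩ := hcon b hb
    exact Set.mem_biUnion hl ⟨hle, hbl⟩
  obtain ⟨m, hm⟩ := hfin.exists_maximal ⟨b₀, hb₀, le_rfl⟩
  obtain ⟨⟨c, hc, hlt⟩, -⟩ := hE.unbounded m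
  exact hlt.not_ge (hm.2 ⟨hc.trans hm.1.1, hm.1.2.trans hlt.le⟩ hlt.le)

theorem IsFibred.exists_not_ge (hE : IsFibred A ε) (F : Finset E) (p : P) :
    ∃ b, ε b = p ∧ ∀ l ∈ F, ¬ l ≤ b := by
  by_contra! hcon
  obtain ⟨b₀, hb₀⟩ := hE.nonempty p
  have hfin : {b | ε b = p ∧ b ≤ b₀}.Finite := by
    refine (F.finite_toSet.biUnion fun l _ => hE.locallyFinite l b₀).subset ?_
    rintro b ⟨hb, hle⟩
    obtain ⟨l, hl, hbl⟩ := hcon b hb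
    exact Set.mem_biUnion hl ⟨hbl, hle⟩
  obtain ⟨m, hm⟩ := hfin.exists_minimal ⟨b₀, hb₀, le_rfl⟩
  obtain ⟨-, ⟨c, hc, hlt⟩⟩ := hE.unbounded m
  exact hlt.not_ge (hm.2 ⟨hc.trans hm.1.1, hlt.le.trans hm.1.2⟩ hlt.le)

/-- The property spreads along a path in the connected diagram: an element of an adjacent label that
is not below `b` is comparable with it, hence above it. -/
theorem IsFibred.exists_ge (hE : IsFibred A ε) (hA : Indecomposable A) (a : E) (p : P) :
    ∃ b, ε b = p ∧ a ≤ b := by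
  have h := hA (ε a) p
  induction h with
  | refl => exact ⟨a, rfl, le_rfl⟩
  | @tail q r _ hqr ih =>
    obtain ⟨b, hb, hab⟩ := ih
    obtain ⟨c, hc, hcb⟩ := hE.exists_not_le {b} r
    rcases hE.comparable b c (Or.inr (by rwa [hb, hc])) with h | h
    · exact ⟨c, hc, hab.trans h⟩
    · exact absurd h (hcb b (by simp))

theorem IsFibred.exists_le (hE : IsFibred A ε) (hA : Indecomposable A) (a : E) (p : P) :
    ∃ b, ε b = p ∧ b ≤ a := by
  have h := hA (ε a) p
  induction h with
  | refl => exact ⟨a, rfl, le_rfl⟩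
  | @tail q r _ hqr ih =>
    obtain ⟨b, hb, hab⟩ := ih
    obtain ⟨c, hc, hcb⟩ := hE.exists_not_ge {b} r
    rcases hE.comparable b c (Or.inr (by rwa [hb, hc])) with h | h
    · exact absurd h (hcb b (by simp))
    · exact ⟨c, hc, h.trans hab⟩

/-- The last element labelled `p` in an ideal, and the first one outside. -/
theorem IsHeap.exists_last_next (hE : IsHeap A ε) {I : Set E} (hI : IsLowerSet I) {p : P}
    (h1 : ∃ a ∈ I, ε a = p) (h2 : ∃ a ∉ I, ε a = p) :
    ∃ b b', ε b = p ∧ ε b' = p ∧ b ∈ I ∧ b' ∉ I ∧ b < b' ∧ ∀ c, ε c = p → c ≤ b ∨ b' ≤ c := by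
  obtain ⟨a, haI, ha⟩ := h1
  obtain ⟨d, hdI, hd⟩ := h2
  have hlt : ∀ x y, ε x = p → ε y = p → x ∈ I → y ∉ I → x ≤ y := by
    intro x y hx hy hxI hyI
    rcases hE.comparable_of_eq (hx.trans hy.symm) with h | h
    · exact h
    · exact absurd (hI h hxI) hyI
  have hfin1 : {c | ε c = p ∧ c ∈ I ∧ a ≤ c}.Finite :=
    (hE.locallyFinite a d).subset fun c hc => ⟨hc.2.2, hlt c d hc.1 hd hc.2.1 hdI⟩
  have hfin2 : {c | ε c = p ∧ c ∉ I ∧ c ≤ d}.Finite :=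
    (hE.locallyFinite a d).subset fun c hc => ⟨hlt a c ha hc.1 haI hc.2.1, hc.2.2⟩
  obtain ⟨b, hb⟩ := hfin1.exists_maximal ⟨a, ha, haI, le_rfl⟩
  obtain ⟨b', hb'⟩ := hfin2.exists_minimal ⟨d, hd, hdI, le_rfl⟩
  refine ⟨b, b', hb.1.1, hb'.1.1, hb.1.2.1, hb'.1.2.1,
    lt_of_le_of_ne (hlt _ _ hb.1.1 hb'.1.1 hb.1.2.1 hb'.1.2.1) ?_, fun c hc => ?_⟩
  · intro h; exact hb'.1.2.1 (h ▸ hb.1.2.1)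
  · by_cases hcI : c ∈ I
    · left
      rcases hE.comparable_of_eq (hc.trans hb.1.1.symm) with h | h
      · exact h
      · exact hb.2 ⟨hc, hcI, hb.1.2.2.trans h⟩ h
    · right
      rcases hE.comparable_of_eq (hc.trans hb'.1.1.symm) with h | h
      · exact hb'.2 ⟨hc, hcI, h.trans hb'.1.2.2⟩ h
      · exact h

/-- The elements of an ideal with label adjacent to `p` that lie above all elements of the ideal
labelled `p`. -/
def topNeighbours (A : Matrix P P ℤ) (ε : E → P) (I : Set E) (p : P) : Set E :=
  {e | e ∈ I ∧ Adj A p (ε e) ∧ ∀ c ∈ I, ε c = p → c < e}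

/-- The weight label of an ideal at the vertex `p`. -/
noncomputable def idealWt (A : Matrix P P ℤ) (ε : E → P) (I : Set E) (p : P) : ℤ :=
  1 - (topNeighbours A ε I p).ncard

/-- The situation around a fibre of the labelling: `b` is the last element labelled `p` in the
ideal `I`, and `b'` is the first one that is not in `I`. -/
theorem IsFull.topNeighbours_eq (hE : IsFull A ε) {I : Set E} (hI : IsLowerSet I) {p : P}
    {b b' : E} (hb : ε b = p) (hb' : ε b' = p) (hbI : b ∈ I) (hbI' : b' ∉ I)
    (hgap : ∀ c, ε c = p → c ≤ b ∨ b' ≤ c) :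
    topNeighbours A ε I p = {e | e ∈ Set.Ioo b b' ∧ Adj A p (ε e)} ∩ I := by
  ext e
  constructor
  · rintro ⟨heI, hadj, hc⟩
    refine ⟨⟨⟨hc b hbI hb, ?_⟩, hadj⟩, heI⟩
    rcases hE.comparable b' e (Or.inr (hb'.symm ▸ hadj)) with h | h
    · exact absurd (hI h heI) hbI'
    · exact lt_of_le_of_ne h fun h => hbI' (h ▸ heI)
  · rintro ⟨⟨⟨h1, h2⟩, hadj⟩, heI⟩
    refine ⟨heI, hadj, fun c hcI hc => ?_⟩
    rcases hgap c hc with h | h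
    · exact h.trans_lt h1
    · exact absurd (hI h hcI) hbI'

variable [Fintype P] {o : P}

/-- Between consecutive elements of a fibre all nonzero matrix entries are -1, so the sum -2 in the
fullness axiom counts two neighbours. -/
theorem IsFull.ncard_neighbours (hE : IsFull A ε) (hA : IsSimplyLacedAffine A o) {b b' : E}
    (hlt : b < b') (heq : ε b = ε b') (hgap : ∀ c, ε c = ε b → c ≤ b ∨ b' ≤ c) :
    {e | e ∈ Set.Ioo b b' ∧ Adj A (ε b) (ε e)}.ncard = 2 := by
  classical
  have hno : ∀ c ∈ Set.Ioo b b', ε c ≠ ε b := by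
    intro c hc h
    rcases hgap c h with h' | h'
    · exact hc.1.not_ge h'
    · exact hc.2.not_ge h'
  have hsum := hE.full b b' hlt heq hno
  have hfin : (Set.Ioo b b').Finite := (hE.locallyFinite b b').subset Set.Ioo_subset_Icc_self
  have hset : {e | e ∈ Set.Ioo b b' ∧ Adj A (ε b) (ε e)} =
      ↑(hfin.toFinset.filter fun e => Adj A (ε b) (ε e)) := by
    ext e; simp
  rw [finsum_mem_eq_finite_toFinset_sum _ hfin] at hsum
  have hval : ∀ c ∈ hfin.toFinset, A (ε b) (ε c) = -(if Adj A (ε b) (ε c) then 1 else 0) := by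
    intro c hc
    split_ifs with h
    · exact hA.apply_of_adj h
    · by_contra h0
      exact h ⟨(hno c (hfin.mem_toFinset.1 hc)).symm, by simpa using h0⟩
  rw [Finset.sum_congr rfl hval, Finset.sum_neg_distrib, ← Finset.sum_filter,
    Finset.sum_const] at hsum
  rw [hset, Set.ncard_coe_finset]
  simp only [nsmul_eq_mul, mul_one, neg_inj] at hsum
  exact_mod_cast hsum

end Heap

/-- A full heap over a simply laced affine diagram, that folds along a folding of the diagram. -/
structure FullFolding {P E : Type*} [Fintype P] [PartialOrder E] (A : Matrix P P ℤ) (o : P)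
    (μ : Equiv.Perm P) (ε : E → P) : Prop where
  root : RootFolding A o μ
  full : IsFull A ε
  heapFolds : HeapFolds A μ ε

/-- The vertex `o` only witnesses that there is some fibre, so that the ideal is neither empty nor
everything. -/
theorem isProperIdeal_of_forall {P E : Type*} [PartialOrder E] {μ : Equiv.Perm P} {ε : E → P}
    (o : P) {I : Set E} (hI : IsLowerSet I) (h1 : ∀ p, ∃ a ∈ I, ε a = p)
    (h2 : ∀ p, ∃ a ∉ I, ε a = p) : IsProperIdeal (barLabel μ ε) I := by
  refine ⟨hI, ?_, ?_, fun x => ?_⟩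
  · obtain ⟨a, ha, -⟩ := h1 o
    exact ⟨a, ha⟩
  · rintro rfl
    obtain ⟨a, ha, -⟩ := h2 o
    exact ha trivial
  · obtain ⟨p, rfl⟩ := bar_surjective x
    obtain ⟨a, ha, hap⟩ := h1 p
    obtain ⟨b, hb, hbp⟩ := h2 p
    exact ⟨⟨a, ha, by rw [barLabel, hap]⟩, b, hb, by rw [barLabel, hbp]⟩

/-! ### Positions and weights of proper ideals of the folded heap. -/

namespace FullFolding

variable {P E : Type*} [Fintype P] [PartialOrder E] {A : Matrix P P ℤ} {o : P}
  {μ : Equiv.Perm P} {ε : E → P} (H : FullFolding A o μ ε)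

include H

theorem comparable {a b : E} (h : barLabel μ ε a = barLabel μ ε b) : a ≤ b ∨ b ≤ a := by
  rcases H.root.folds.bar_eq_bar.1 h with h | h
  · exact H.full.comparable_of_eq h.symm
  · exact H.heapFolds _ _ (Or.inl h.symm) a b rfl rfl

theorem exists_ge (a : E) (p : P) : ∃ b, ε b = p ∧ a ≤ b :=
  H.full.exists_ge H.root.affine.indecomposable a p

theorem exists_le (a : E) (p : P) : ∃ b, ε b = p ∧ b ≤ a :=
  H.full.exists_le H.root.affine.indecomposable a p

/-- Every element has elements of each unfolded label below it, so properness for the folded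
labelling passes to the unfolded one. -/
theorem exists_mem (I : ProperIdeal (barLabel μ ε)) (p : P) : ∃ a ∈ I.1, ε a = p := by
  obtain ⟨a, ha, -⟩ := (I.2.2.2.2 (bar μ p)).1
  obtain ⟨b, hb, hle⟩ := H.exists_le a p
  exact ⟨b, I.2.1 hle ha, hb⟩

theorem exists_notMem (I : ProperIdeal (barLabel μ ε)) (p : P) : ∃ a ∉ I.1, ε a = p := by
  obtain ⟨a, ha, -⟩ := (I.2.2.2.2 (bar μ p)).2
  obtain ⟨b, hb, hle⟩ := H.exists_ge a p
  exact ⟨b, fun h => ha (I.2.1 hle h), hb⟩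

theorem isProperIdeal_insert (I : ProperIdeal (barLabel μ ε)) {a : E} (ha : a ∉ I.1)
    (hlow : ∀ c < a, c ∈ I.1) : IsProperIdeal (barLabel μ ε) (insert a I.1) := by
  refine isProperIdeal_of_forall o ?_ (fun p => ?_) fun p => ?_
  · rintro x y hyx (rfl | hx)
    · rcases hyx.eq_or_lt with rfl | hlt
      · exact Or.inl rfl
      · exact Or.inr (hlow y hlt)
    · exact Or.inr (I.2.1 hyx hx)
  · obtain ⟨b, hb, hbp⟩ := H.exists_mem I p
    exact ⟨b, Or.inr hb, hbp⟩
  · obtain ⟨b, hb, hbp⟩ := H.exists_notMem I p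
    obtain ⟨⟨c, hc, hlt⟩, -⟩ := H.full.unbounded b
    by_cases hba : b = a
    · subst hba
      refine ⟨c, ?_, hc.trans hbp⟩
      rintro (h | h)
      · exact hlt.ne' h
      · exact hb (I.2.1 hlt.le h)
    · exact ⟨b, fun h => h.elim hba hb, hbp⟩

theorem isProperIdeal_erase (I : ProperIdeal (barLabel μ ε)) {a : E} (ha : a ∈ I.1)
    (hup : ∀ c, a < c → c ∉ I.1) : IsProperIdeal (barLabel μ ε) (I.1 \ {a}) := by
  refine isProperIdeal_of_forall o ?_ (fun p => ?_) fun p => ?_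
  · rintro x y hyx ⟨hx, hxa⟩
    refine ⟨I.2.1 hyx hx, ?_⟩
    rintro rfl
    exact hup x (lt_of_le_of_ne hyx (Ne.symm hxa)) hx
  · obtain ⟨b, hb, hbp⟩ := H.exists_mem I p
    obtain ⟨-, c, hc, hlt⟩ := H.full.unbounded b
    by_cases hba : b = a
    · subst hba
      exact ⟨c, ⟨I.2.1 hlt.le hb, hlt.ne⟩, hc.trans hbp⟩
    · exact ⟨b, ⟨hb, hba⟩, hbp⟩
  · obtain ⟨b, hb, hbp⟩ := H.exists_notMem I p
    exact ⟨b, fun h => hb h.1, hbp⟩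

theorem isProperIdeal_inter (I J : ProperIdeal (barLabel μ ε)) :
    IsProperIdeal (barLabel μ ε) (I.1 ∩ J.1) := by
  refine isProperIdeal_of_forall o (I.2.1.inter J.2.1) (fun p => ?_) fun p => ?_
  · obtain ⟨a, ha, hap⟩ := H.exists_mem I p
    obtain ⟨b, hb, hbp⟩ := H.exists_mem J p
    rcases H.full.comparable_of_eq (hap.trans hbp.symm) with h | h
    · exact ⟨a, ⟨ha, J.2.1 h hb⟩, hap⟩
    · exact ⟨b, ⟨I.2.1 h ha, hb⟩, hbp⟩
  · obtain ⟨b, hb, hbp⟩ := H.exists_notMem I p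
    exact ⟨b, fun h => hb h.1, hbp⟩

/-- Elements of the difference with a given label lie between an element of `I` and an element
outside `J` of that label, and there are finitely many labels. -/
theorem finite_sdiff (I J : ProperIdeal (barLabel μ ε)) : (J.1 \ I.1).Finite := by
  choose a ha hap using H.exists_mem I
  choose b hb hbp using H.exists_notMem J
  refine (Set.finite_iUnion fun p => H.full.locallyFinite (a p) (b p)).subset ?_
  rintro c ⟨hcJ, hcI⟩
  refine Set.mem_iUnion.2 ⟨ε c, ?_, ?_⟩
  · rcases H.full.comparable_of_eq (hap (ε c)) with h | h
    · exact h
    · exact absurd (I.2.1 h (ha _)) hcI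
  · rcases H.full.comparable_of_eq (hbp (ε c)) with h | h
    · exact absurd (J.2.1 h hcJ) (hb _)
    · exact h

/-- The difference of two proper ideals, as a finite set. -/
noncomputable def diff (J I : ProperIdeal (barLabel μ ε)) : Finset E :=
  (H.finite_sdiff I J).toFinset

theorem coe_diff (J I : ProperIdeal (barLabel μ ε)) : (H.diff J I : Set E) = J.1 \ I.1 :=
  (H.finite_sdiff I J).coe_toFinset

theorem mem_diff {J I : ProperIdeal (barLabel μ ε)} {a : E} :
    a ∈ H.diff J I ↔ a ∈ J.1 ∧ a ∉ I.1 := by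
  rw [← Finset.mem_coe, H.coe_diff, Set.mem_sdiff]

theorem diff_eq_empty {J I : ProperIdeal (barLabel μ ε)} (h : J.1 ⊆ I.1) : H.diff J I = ∅ := by
  ext a
  simp only [H.mem_diff, Finset.notMem_empty, iff_false]
  exact fun ha => ha.2 (h ha.1)

theorem ordConnected_diff (J I : ProperIdeal (barLabel μ ε)) :
    (H.diff J I : Set E).OrdConnected := by
  rw [H.coe_diff]
  exact ⟨fun x hx y hy z hz => ⟨J.2.1 hz.2 hy.1, fun h => hx.2 (I.2.1 hz.1 h)⟩⟩

/-- The relative position of two proper ideals. -/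
noncomputable def rel (J I : ProperIdeal (barLabel μ ε)) : P → ℤ :=
  character ε (H.diff J I) - character ε (H.diff I J)

theorem rel_add (I J K : ProperIdeal (barLabel μ ε)) : H.rel K J + H.rel J I = H.rel K I :=
  character_sdiff_add ε (H.coe_diff K J) (H.coe_diff J K) (H.coe_diff J I) (H.coe_diff I J)
    (H.coe_diff K I) (H.coe_diff I K)

theorem rel_of_subset {I J : ProperIdeal (barLabel μ ε)} (h : I.1 ⊆ J.1) :
    H.rel J I = character ε (H.diff J I) := by
  rw [rel, H.diff_eq_empty h, character_empty, sub_zero]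

theorem rel_swap (I J : ProperIdeal (barLabel μ ε)) : H.rel I J = -H.rel J I := by
  rw [rel, rel, neg_sub]

theorem diff_insert {I J : ProperIdeal (barLabel μ ε)} {a : E} (ha : a ∉ I.1)
    (h : J.1 = insert a I.1) : H.diff J I = {a} := by
  ext c
  rw [H.mem_diff, h, Finset.mem_singleton]
  constructor
  · rintro ⟨rfl | h1, h2⟩
    · rfl
    · exact absurd h1 h2
  · rintro rfl
    exact ⟨Or.inl rfl, ha⟩

theorem rel_insert {I J : ProperIdeal (barLabel μ ε)} {a : E} (ha : a ∉ I.1)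
    (h : J.1 = insert a I.1) : H.rel J I = simpleRoot (ε a) := by
  rw [H.rel_of_subset (by rw [h]; exact Set.subset_insert _ _), H.diff_insert ha h,
    character_singleton]

theorem fold_rel (I J : ProperIdeal (barLabel μ ε)) :
    fold μ (H.rel J I) =
      character (barLabel μ ε) (H.diff J I) - character (barLabel μ ε) (H.diff I J) := by
  rw [rel, fold_sub, fold_character, fold_character]

/-- Elements with the same folded label are comparable, so they cannot lie on opposite sides of the
difference of two lower sets. No cancellation therefore occurs in the folded relative position. -/
theorem character_diff_eq_zero (I J : ProperIdeal (barLabel μ ε)) (x : Orb μ) :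
    character (barLabel μ ε) (H.diff J I) x = 0 ∨
      character (barLabel μ ε) (H.diff I J) x = 0 := by
  by_contra! hne
  have h1 := (character_nonneg (barLabel μ ε) (H.diff J I) x).lt_of_ne hne.1.symm
  have h2 := (character_nonneg (barLabel μ ε) (H.diff I J) x).lt_of_ne hne.2.symm
  obtain ⟨a, ha, hax⟩ := (character_pos _).1 h1
  obtain ⟨b, hb, hbx⟩ := (character_pos _).1 h2
  rw [H.mem_diff] at ha hb
  rcases H.comparable (hax.trans hbx.symm) with h | h
  · exact ha.2 (I.2.1 h hb.1)
  · exact hb.2 (J.2.1 h ha.1)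

/-- An ideal at a nonnegative relative position contains the other one. -/
theorem subset_of_fold_nonneg {I J : ProperIdeal (barLabel μ ε)} (h : 0 ≤ fold μ (H.rel J I)) :
    I.1 ⊆ J.1 := by
  intro a haI
  by_contra haJ
  have h1 : 0 ≤ character (barLabel μ ε) (H.diff J I) (barLabel μ ε a) -
      character (barLabel μ ε) (H.diff I J) (barLabel μ ε a) := by
    have := h (barLabel μ ε a)
    rwa [H.fold_rel] at this
  have h2 := (character_pos (barLabel μ ε)).2 ⟨a, H.mem_diff.2 ⟨haI, haJ⟩, rfl⟩
  have h3 := H.character_diff_eq_zero I J (barLabel μ ε a)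
  omega

theorem eq_of_fold_rel_eq_zero {I J : ProperIdeal (barLabel μ ε)} (h : fold μ (H.rel J I) = 0) :
    J = I := by
  refine Subtype.ext (Set.Subset.antisymm ?_ (H.subset_of_fold_nonneg h.ge))
  refine H.subset_of_fold_nonneg ?_
  rw [H.rel_swap, fold_neg, h, neg_zero]

theorem rel_eq_simpleRoot {I J : ProperIdeal (barLabel μ ε)} {x : Orb μ}
    (h : fold μ (H.rel J I) = simpleRoot x) : ∃ p, H.rel J I = simpleRoot p := by
  have hsub : I.1 ⊆ J.1 := by
    refine H.subset_of_fold_nonneg ?_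
    rw [h]
    intro y
    classical
    rw [simpleRoot_apply]
    split_ifs <;> simp
  rw [H.rel_of_subset hsub, fold_character] at h
  obtain ⟨a, -, ha⟩ := exists_eq_singleton _ h
  exact ⟨ε a, by rw [H.rel_of_subset hsub, ha, character_singleton]⟩

theorem finite_topNeighbours (I : ProperIdeal (barLabel μ ε)) (p : P) :
    (topNeighbours A ε I.1 p).Finite := by
  obtain ⟨b, b', hb, hb', hbI, hbI', hlt, hgap⟩ :=
    H.full.exists_last_next I.2.1 (H.exists_mem I p) (H.exists_notMem I p)
  rw [H.full.topNeighbours_eq I.2.1 hb hb' hbI hbI' hgap]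
  exact (H.full.locallyFinite b b').subset fun e he => Set.Ioo_subset_Icc_self he.1.1

theorem idealWt_mem (I : ProperIdeal (barLabel μ ε)) (p : P) :
    idealWt A ε I.1 p = -1 ∨ idealWt A ε I.1 p = 0 ∨ idealWt A ε I.1 p = 1 := by
  obtain ⟨b, b', hb, hb', hbI, hbI', hlt, hgap⟩ :=
    H.full.exists_last_next I.2.1 (H.exists_mem I p) (H.exists_notMem I p)
  have h2 := H.full.ncard_neighbours H.root.affine hlt (hb.trans hb'.symm) (by rwa [hb])
  rw [hb] at h2
  have hle := Set.ncard_le_ncard (Set.inter_subset_left (t := I.1))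
    (Set.finite_of_ncard_pos (by rw [h2]; norm_num))
  rw [idealWt, H.full.topNeighbours_eq I.2.1 hb hb' hbI hbI' hgap]
  omega

/-- Label 1 means that no neighbour in `I` lies above the last element `b` of the fibre. An element
of `I` above `b` would yield, next to `b` in a chain, such a neighbour or a later element of the
fibre. -/
theorem exists_removable (I : ProperIdeal (barLabel μ ε)) {p : P} (h : idealWt A ε I.1 p = 1) :
    ∃ a ∈ I.1, ε a = p ∧ ∀ c, a < c → c ∉ I.1 := by
  obtain ⟨b, b', hb, hb', hbI, hbI', hlt, hgap⟩ :=
    H.full.exists_last_next I.2.1 (H.exists_mem I p) (H.exists_notMem I p)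
  have h0 : topNeighbours A ε I.1 p = ∅ := by
    rw [← Set.ncard_eq_zero (H.finite_topNeighbours I p)]
    rw [idealWt] at h
    omega
  refine ⟨b, hbI, hb, fun c hbc hcI => ?_⟩
  obtain ⟨x, hbx, hxc, hconc⟩ := H.full.exists_conc_right hbc
  have hxI := I.2.1 hxc hcI
  rw [hb] at hconc
  rcases hconc with hx | hx
  · rcases hgap x hx.symm with h1 | h1
    · exact hbx.not_ge h1
    · exact hbI' (I.2.1 h1 hxI)
  · have : x ∈ topNeighbours A ε I.1 p := by
      refine ⟨hxI, hx, fun c hc hcp => ?_⟩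
      rcases hgap c hcp with h1 | h1
      · exact h1.trans_lt hbx
      · exact absurd (I.2.1 h1 hc) hbI'
    rw [h0] at this
    exact this

/-- Label -1 means that both neighbours between `b` and the next element `b'` already lie in `I`, so
nothing below `b'` is missing. -/
theorem exists_addable (I : ProperIdeal (barLabel μ ε)) {p : P} (h : idealWt A ε I.1 p = -1) :
    ∃ a ∉ I.1, ε a = p ∧ ∀ c < a, c ∈ I.1 := by
  obtain ⟨b, b', hb, hb', hbI, hbI', hlt, hgap⟩ :=
    H.full.exists_last_next I.2.1 (H.exists_mem I p) (H.exists_notMem I p)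
  have h2 := H.full.ncard_neighbours H.root.affine hlt (hb.trans hb'.symm) (by rwa [hb])
  rw [hb] at h2
  have hall := Set.eq_of_subset_of_ncard_le (Set.inter_subset_left (t := I.1))
    (by
      rw [idealWt, H.full.topNeighbours_eq I.2.1 hb hb' hbI hbI' hgap] at h
      rw [h2]
      omega)
    (Set.finite_of_ncard_pos (by rw [h2]; norm_num))
  rw [Set.inter_eq_left] at hall
  refine ⟨b', hbI', hb', fun c hcb => ?_⟩
  by_contra hcI
  obtain ⟨x, hcx, hxb, hconc⟩ := H.full.exists_conc_left hcb
  have hxI : x ∉ I.1 := fun hx => hcI (I.2.1 hcx hx)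
  rw [hb'] at hconc
  rcases hconc with hx | hx
  · rcases hgap x hx with h1 | h1
    · exact hxI (I.2.1 h1 hbI)
    · exact hxb.not_ge h1
  · rcases H.full.comparable x b (Or.inr (by rwa [hb])) with h1 | h1
    · exact hxI (I.2.1 h1 hbI)
    · refine hxI (hall ⟨⟨lt_of_le_of_ne h1 ?_, hxb⟩, H.root.affine.adj_comm.1 hx⟩)
      rintro rfl
      exact hxI hbI

/-- At the label of `a` the neighbour count drops from 2 to 0, at an adjacent label `a` itself is a
new top neighbour, and elsewhere nothing changes: this is the column of `A`. -/
theorem idealWt_insert {I J : ProperIdeal (barLabel μ ε)} {a : E} (ha : a ∉ I.1)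
    (h : J.1 = insert a I.1) (q : P) :
    idealWt A ε J.1 q = idealWt A ε I.1 q + A q (ε a) := by
  have haJ : a ∈ J.1 := by rw [h]; exact Or.inl rfl
  have hJI : ∀ c ∈ J.1, c ≠ a → c ∈ I.1 := fun c hc hca => by
    rw [h] at hc; exact hc.resolve_left hca
  have hIJ : I.1 ⊆ J.1 := by rw [h]; exact Set.subset_insert _ _
  by_cases hq : q = ε a
  · subst hq
    obtain ⟨b, b', hb, hb', hbI, hbI', hlt, hgap⟩ :=
      H.full.exists_last_next I.2.1 (H.exists_mem I (ε a)) (H.exists_notMem I (ε a))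
    have hab : b' = a := by
      rcases hgap a rfl with h1 | h1
      · exact absurd (I.2.1 h1 hbI) ha
      · by_contra hne
        exact hbI' (hJI b' (J.2.1 h1 haJ) hne)
    subst hab
    have h2 := H.full.ncard_neighbours H.root.affine hlt hb (by rwa [hb])
    rw [hb] at h2
    have hI : topNeighbours A ε I.1 (ε b') = {e | e ∈ Set.Ioo b b' ∧ Adj A (ε b') (ε e)} := by
      rw [H.full.topNeighbours_eq I.2.1 hb rfl hbI hbI' hgap, Set.inter_eq_left]
      intro e he
      exact hJI e (J.2.1 he.1.2.le haJ) he.1.2.ne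
    have hJ : topNeighbours A ε J.1 (ε b') = ∅ := by
      ext e
      simp only [Set.mem_empty_iff_false, iff_false]
      rintro ⟨he, -, hc⟩
      have hlt' := hc b' haJ rfl
      exact ha (I.2.1 hlt'.le (hJI e he hlt'.ne'))
    rw [idealWt, idealWt, hI, hJ, h2, Set.ncard_empty, H.root.diag]
    norm_num
  by_cases hadj : Adj A q (ε a)
  · have htop : topNeighbours A ε J.1 q = insert a (topNeighbours A ε I.1 q) := by
      ext e
      constructor
      · rintro ⟨he, hadj', hc⟩
        by_cases hea : e = a
        · exact Or.inl hea
        · exact Or.inr ⟨hJI e he hea, hadj', fun c hcI => hc c (hIJ hcI)⟩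
      · rintro (rfl | ⟨he, hadj', hc⟩)
        · refine ⟨haJ, hadj, fun c hcJ hcq => ?_⟩
          have hce : c ≠ e := fun hce => hq (by rw [← hcq, hce])
          rcases H.full.comparable c e (Or.inr (by rwa [hcq])) with h1 | h1
          · exact lt_of_le_of_ne h1 hce
          · exact absurd (I.2.1 h1 (hJI c hcJ hce)) ha
        · refine ⟨hIJ he, hadj', fun c hcJ hcq => hc c (hJI c hcJ fun hca => hq ?_) hcq⟩
          rw [← hcq, hca]
    rw [idealWt, idealWt, htop, Set.ncard_insert_of_notMem (fun h => ha h.1)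
      (H.finite_topNeighbours I q), H.root.affine.apply_of_adj hadj]
    push_cast
    ring
  · have htop : topNeighbours A ε J.1 q = topNeighbours A ε I.1 q := by
      ext e
      constructor
      · rintro ⟨he, hadj', hc⟩
        exact ⟨hJI e he fun hea => hadj (hea ▸ hadj'), hadj', fun c hcI => hc c (hIJ hcI)⟩
      · rintro ⟨he, hadj', hc⟩
        refine ⟨hIJ he, hadj', fun c hcJ hcq => hc c (hJI c hcJ fun hca => hq ?_) hcq⟩
        rw [← hcq, hca]
    have h0 : A q (ε a) = 0 := by
      by_contra h0
      exact hadj ⟨hq, h0⟩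
    rw [idealWt, idealWt, htop, h0, add_zero]

theorem idealWt_of_subset {I J : ProperIdeal (barLabel μ ε)} (h : I.1 ⊆ J.1) :
    idealWt A ε J.1 = idealWt A ε I.1 + A.mulVec (H.rel J I) := by
  induction hn : (H.diff J I).card using Nat.strong_induction_on generalizing I with
  | _ n ih =>
    subst hn
    by_cases hne : (H.diff J I).Nonempty
    -- A minimal element of the difference can be added to `I` without losing the ideal property.
    · obtain ⟨a, ha⟩ := (H.diff J I).exists_minimal hne
      have ha1 := H.mem_diff.1 ha.1
      let K : ProperIdeal (barLabel μ ε) := ⟨insert a I.1, H.isProperIdeal_insert I ha1.2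
        fun c hc => by
          by_contra hcI
          exact hc.not_ge (ha.2 (H.mem_diff.2 ⟨J.2.1 hc.le ha1.1, hcI⟩) hc.le)⟩
      have hKJ : K.1 ⊆ J.1 := Set.insert_subset ha1.1 h
      have hcard : (H.diff J K).card < (H.diff J I).card := by
        refine Finset.card_lt_card ⟨fun c hc => ?_, fun hsub => ?_⟩
        · rw [H.mem_diff] at hc ⊢
          exact ⟨hc.1, fun hcI => hc.2 (Or.inr hcI)⟩
        · exact (H.mem_diff.1 (hsub ha.1)).2 (Or.inl rfl)
      have h1 := ih _ hcard hKJ rfl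
      rw [h1, ← H.rel_add I K J, Matrix.mulVec_add, H.rel_insert (J := K) ha1.2 rfl]
      funext q
      simp only [Pi.add_apply, mulVec_simpleRoot, H.idealWt_insert (J := K) ha1.2 rfl q]
      ring
    · have he : J.1 ⊆ I.1 := fun c hc => by
        by_contra hcI
        exact hne ⟨c, H.mem_diff.2 ⟨hc, hcI⟩⟩
      obtain rfl : I = J := Subtype.ext (Set.Subset.antisymm h he)
      rw [rel, sub_self, Matrix.mulVec_zero, add_zero]

theorem idealWt_eq (I J : ProperIdeal (barLabel μ ε)) :
    idealWt A ε J.1 = idealWt A ε I.1 + A.mulVec (H.rel J I) := by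
  let K : ProperIdeal (barLabel μ ε) := ⟨I.1 ∩ J.1, H.isProperIdeal_inter I J⟩
  have h1 := H.idealWt_of_subset (I := K) (J := I) Set.inter_subset_left
  have h2 := H.idealWt_of_subset (I := K) (J := J) Set.inter_subset_right
  rw [h1, h2, ← H.rel_add I K J, H.rel_swap K I, Matrix.mulVec_add, Matrix.mulVec_neg]
  abel

/-- There are proper ideals that differ by one element with a given label. -/
theorem exists_rel_eq_simpleRoot (p : P) :
    ∃ I J : ProperIdeal (barLabel μ ε), H.rel J I = simpleRoot p := by
  obtain ⟨a, rfl⟩ := H.full.nonempty p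
  -- The complement of the principal filter of `a` contains all elements below `a` but not `a`.
  let I : ProperIdeal (barLabel μ ε) := ⟨{x | ¬ a ≤ x}, isProperIdeal_of_forall o
    (fun x y hyx hx h => hx (h.trans hyx))
    (fun q => by
      obtain ⟨b, hb, h⟩ := H.full.exists_not_ge {a} q
      exact ⟨b, h a (by simp), hb⟩)
    (fun q => by
      obtain ⟨b, hb, h⟩ := H.exists_ge a q
      exact ⟨b, fun h' => h' h, hb⟩)⟩
  have ha : a ∉ I.1 := fun h => h le_rfl
  exact ⟨I, ⟨insert a I.1, H.isProperIdeal_insert I ha fun c hc => hc.not_ge⟩,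
    H.rel_insert ha rfl⟩

/-- Every finite nonempty convex set is the difference of two proper ideals. -/
theorem exists_diff_eq {L : Finset E} (hL : (L : Set E).OrdConnected) (hne : L.Nonempty) :
    ∃ I J : ProperIdeal (barLabel μ ε), I.1 ⊆ J.1 ∧ H.diff J I = L := by
  obtain ⟨l₀, hl₀⟩ := hne
  -- The smaller ideal, consisting of the elements below `L` but not in `L`, must meet every fibre:
  -- far enough down, a fibre leaves `L`.
  have hin : ∀ q, ∃ b, b ∉ L ∧ b ≤ l₀ ∧ ε b = q := by
    intro q
    obtain ⟨b, hb, hbl⟩ := H.exists_le l₀ q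
    obtain ⟨c, hc, hcl⟩ := H.full.exists_not_ge L q
    rcases H.full.comparable_of_eq (hb.trans hc.symm) with h | h
    · exact ⟨b, fun hbL => hcl b hbL h, hbl, hb⟩
    · exact ⟨c, fun hcL => hcl c hcL le_rfl, h.trans hbl, hc⟩
  have hout : ∀ q, ∃ b, (∀ l ∈ L, ¬ b ≤ l) ∧ ε b = q := by
    intro q
    obtain ⟨b, hb, h⟩ := H.full.exists_not_le L q
    exact ⟨b, h, hb⟩
  let I : ProperIdeal (barLabel μ ε) := ⟨{x | x ∉ L ∧ ∃ l ∈ L, x ≤ l}, isProperIdeal_of_forall o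
    (by
      rintro x y hyx ⟨hx, l, hl, hxl⟩
      exact ⟨fun hy => hx (hL.out hy hl ⟨hyx, hxl⟩), l, hl, hyx.trans hxl⟩)
    (fun q => by
      obtain ⟨b, hb, hbl, hbq⟩ := hin q
      exact ⟨b, ⟨hb, l₀, hl₀, hbl⟩, hbq⟩)
    (fun q => by
      obtain ⟨b, hb, hbq⟩ := hout q
      exact ⟨b, fun ⟨_, l, hl, hbl⟩ => hb l hl hbl, hbq⟩)⟩
  let J : ProperIdeal (barLabel μ ε) := ⟨{x | ∃ l ∈ L, x ≤ l}, isProperIdeal_of_forall o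
    (by
      rintro x y hyx ⟨l, hl, hxl⟩
      exact ⟨l, hl, hyx.trans hxl⟩)
    (fun q => by
      obtain ⟨b, -, hbl, hbq⟩ := hin q
      exact ⟨b, ⟨l₀, hl₀, hbl⟩, hbq⟩)
    (fun q => by
      obtain ⟨b, hb, hbq⟩ := hout q
      exact ⟨b, fun ⟨l, hl, hbl⟩ => hb l hl hbl, hbq⟩)⟩
  refine ⟨I, J, fun x hx => hx.2, ?_⟩
  ext x
  rw [H.mem_diff]
  constructor
  · rintro ⟨hxJ, hxI⟩
    by_contra hxL
    exact hxI ⟨hxL, hxJ⟩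
  · intro hx
    exact ⟨⟨x, hx, le_rfl⟩, fun h => h.1 hx⟩

end FullFolding

/-! ### Parity as a cocycle on pairs of ideals. -/

section Parity

variable {P E : Type*} [PartialOrder E] {A : Matrix P P ℤ} {ε : E → P}
  {arrow : P → P → Prop}

theorem sgn_of_not_conc (harrow : IsOrientation A arrow) {p q : P} (h : ¬ Conc A p q) :
    sgn arrow p q = 1 := by
  rw [sgn, if_neg]
  rintro (rfl | h')
  · exact h (Or.inl rfl)
  · exact h (Or.inr (harrow.adj _ _ h'))

open Classical in
theorem parity_eq (L : Finset E) : parity arrow ε L =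
    ∏ a ∈ L, ∏ b ∈ L, if b < a then sgn arrow (ε a) (ε b) else 1 := by
  rw [parity, Finset.prod_filter, Finset.prod_product]

theorem parity_empty : parity arrow ε (∅ : Finset E) = 1 := by
  rw [parity_eq, Finset.prod_empty]

theorem parity_singleton (a : E) : parity arrow ε {a} = 1 := by
  rw [parity_eq]; simp

open Classical in
-- A pair from `L` and `L'` that is not in decreasing order is incomparable, hence not concurrent,
-- and has sign 1. The cross terms may thus be taken over all pairs, which gives the lattice sign of
-- the characters.
theorem parity_union [Fintype P] (hE : IsHeap A ε) (harrow : IsOrientation A arrow)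
    {L L' : Finset E}
    (h : ∀ a ∈ L, ∀ b ∈ L', ¬ a ≤ b) :
    parity arrow ε (L ∪ L') = parity arrow ε L * parity arrow ε L' *
      sgnLattice arrow (character ε L) (character ε L') := by
  have hdisj : Disjoint L L' := by
    rw [Finset.disjoint_left]
    exact fun a ha ha' => h a ha a ha' le_rfl
  have h1 : ∏ a ∈ L, ∏ b ∈ L', (if b < a then sgn arrow (ε a) (ε b) else 1) =
      sgnLattice arrow (character ε L) (character ε L') := by
    rw [sgnLattice_character]
    refine Finset.prod_congr rfl fun a ha => Finset.prod_congr rfl fun b hb => ?_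
    split_ifs with hlt
    · rfl
    · refine (sgn_of_not_conc harrow fun hc => ?_).symm
      rcases hE.comparable a b hc with h' | h'
      · exact h a ha b hb h'
      · exact hlt (lt_of_le_of_ne h' fun hab => h a ha b hb hab.ge)
  have h2 : ∏ a ∈ L', ∏ b ∈ L, (if b < a then sgn arrow (ε a) (ε b) else 1) = 1 := by
    refine Finset.prod_eq_one fun a ha => Finset.prod_eq_one fun b hb => ?_
    rw [if_neg fun hlt => h b hb a ha hlt.le]
  rw [parity_eq, Finset.prod_union hdisj]
  simp only [Finset.prod_union hdisj, Finset.prod_mul_distrib]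
  rw [h1, h2, ← parity_eq, ← parity_eq]
  ac_rfl

end Parity

namespace FullFolding

variable {P E : Type*} [Fintype P] [PartialOrder E] {A : Matrix P P ℤ} {o : P}
  {μ : Equiv.Perm P} {ε : E → P} (H : FullFolding A o μ ε) {arrow : P → P → Prop}

theorem parity_diff (harrow : IsOrientation A arrow) {I J K : ProperIdeal (barLabel μ ε)}
    (hKI : K.1 ⊆ I.1) (hIJ : I.1 ⊆ J.1) :
    parity arrow ε (H.diff J K) = parity arrow ε (H.diff J I) * parity arrow ε (H.diff I K) *
      sgnLattice arrow (H.rel J I) (H.rel I K) := by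
  classical
  rw [H.rel_of_subset hIJ, H.rel_of_subset hKI, ← parity_union H.full.toIsHeap harrow]
  · congr 1
    ext a
    rw [Finset.mem_union, H.mem_diff, H.mem_diff, H.mem_diff]
    by_cases h1 : a ∈ I.1
    · simp [h1, hIJ h1]
    · simp only [h1, not_false_eq_true, and_true, false_and, or_false, and_iff_left_iff_imp]
      exact fun _ h => h1 (hKI h)
  · intro a ha b hb hab
    rw [H.mem_diff] at ha hb
    exact ha.2 (I.2.1 hab hb.1)

variable (arrow) in
/-- The sign of a pair of proper ideals, computed from a common lower bound. -/
noncomputable def relSign (K J I : ProperIdeal (barLabel μ ε)) : ℤˣ :=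
  parity arrow ε (H.diff J K) * parity arrow ε (H.diff I K) *
    sgnLattice arrow (H.rel J I) (H.rel I K)

/-- Passing to a smaller common lower bound multiplies the sign by factors that each occur twice, so
the choice of bound does not matter. -/
theorem relSign_of_subset (harrow : IsOrientation A arrow)
    {I J K K' : ProperIdeal (barLabel μ ε)} (hI : K.1 ⊆ I.1) (hJ : K.1 ⊆ J.1)
    (hK : K'.1 ⊆ K.1) : H.relSign arrow K' J I = H.relSign arrow K J I := by
  rw [relSign, relSign, H.parity_diff harrow hK hI, H.parity_diff harrow hK hJ,
    ← H.rel_add K' K I, sgnLattice_add_right, ← H.rel_add K I J, sgnLattice_add_left]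
  generalize parity arrow ε (H.diff J K) = t₁
  generalize parity arrow ε (H.diff I K) = t₂
  generalize parity arrow ε (H.diff K K') = t₃
  generalize sgnLattice arrow (H.rel J I) (H.rel I K) = t₄
  generalize sgnLattice arrow (H.rel J I) (H.rel K K') = t₅
  generalize sgnLattice arrow (H.rel I K) (H.rel K K') = t₆
  calc _ = t₁ * t₂ * t₄ * (t₃ * t₃) * (t₅ * t₅) * (t₆ * t₆) := by ac_rfl
    _ = _ := by simp only [Int.units_mul_self, mul_one]

/-- The intersection of two proper ideals. -/
def inter (I J : ProperIdeal (barLabel μ ε)) : ProperIdeal (barLabel μ ε) :=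
  ⟨I.1 ∩ J.1, H.isProperIdeal_inter I J⟩

theorem relSign_inter (harrow : IsOrientation A arrow) {I J K : ProperIdeal (barLabel μ ε)}
    (hI : K.1 ⊆ I.1) (hJ : K.1 ⊆ J.1) :
    H.relSign arrow (H.inter J I) J I = H.relSign arrow K J I :=
  (H.relSign_of_subset harrow Set.inter_subset_right Set.inter_subset_left
    (Set.subset_inter hJ hI)).symm

theorem relSign_mul (I J K M : ProperIdeal (barLabel μ ε)) :
    H.relSign arrow K M J * H.relSign arrow K J I =
      sgnLattice arrow (H.rel M J) (H.rel J I) * H.relSign arrow K M I := by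
  rw [relSign, relSign, relSign, ← H.rel_add K I J, sgnLattice_add_right, ← H.rel_add I J M,
    sgnLattice_add_left]
  generalize parity arrow ε (H.diff J K) = t₁
  generalize parity arrow ε (H.diff I K) = t₂
  generalize parity arrow ε (H.diff M K) = t₃
  generalize sgnLattice arrow (H.rel M J) (H.rel J I) = t₄
  generalize sgnLattice arrow (H.rel M J) (H.rel I K) = t₅
  generalize sgnLattice arrow (H.rel J I) (H.rel I K) = t₆
  calc _ = t₄ * (t₃ * t₂ * (t₅ * t₆)) * (t₁ * t₁) := by ac_rfl
    _ = _ := by simp only [Int.units_mul_self, mul_one]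

/-- The model of the module spanned by the proper ideals. -/
noncomputable def model (harrow : IsOrientation A arrow) (I₀ : ProperIdeal (barLabel μ ε)) :
    FoldedModel A arrow μ (ProperIdeal (barLabel μ ε)) where
  pos I := H.rel I I₀
  wt I := idealWt A ε I.1
  sign J I := H.relSign arrow (H.inter J I) J I
  pos_injective I J h := by
    refine (H.eq_of_fold_rel_eq_zero (J := I) (I := J) ?_)
    have h1 := H.rel_add I₀ J I
    have h : H.rel I I₀ = H.rel J I₀ := h
    rw [h] at h1
    rw [add_eq_right.1 h1, fold_zero]
  wt_eq I J := by
    rw [H.idealWt_eq I J, ← H.rel_add I₀ I J, add_sub_cancel_right]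
  wt_mem I p := H.idealWt_mem I p
  exists_add I p h := by
    obtain ⟨a, ha, rfl, hlow⟩ := H.exists_addable I h
    let J : ProperIdeal (barLabel μ ε) := ⟨insert a I.1, H.isProperIdeal_insert I ha hlow⟩
    refine ⟨J, ?_⟩
    rw [← H.rel_add I₀ I J, H.rel_insert (J := J) ha rfl, add_comm]
  exists_sub I p h := by
    obtain ⟨a, ha, rfl, hup⟩ := H.exists_removable I h
    let J : ProperIdeal (barLabel μ ε) := ⟨I.1 \ {a}, H.isProperIdeal_erase I ha hup⟩
    refine ⟨J, ?_⟩
    have hJ : I.1 = insert a J.1 := by simp [J, Set.insert_eq_of_mem ha]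
    rw [← H.rel_add I₀ J I, H.rel_insert (I := J) (fun h => h.2 rfl) hJ, add_sub_cancel_left]
  sign_mul I J K := by
    -- All three signs are computed from the common lower bound `I ∩ J ∩ K`.
    have hI : (H.inter I (H.inter J K)).1 ⊆ I.1 := Set.inter_subset_left
    have hJ : (H.inter I (H.inter J K)).1 ⊆ J.1 := fun _ h => h.2.1
    have hK : (H.inter I (H.inter J K)).1 ⊆ K.1 := fun _ h => h.2.2
    rw [H.relSign_inter harrow hJ hK, H.relSign_inter harrow hI hJ, H.relSign_inter harrow hI hK,
      H.relSign_mul, ← H.rel_add I₀ J K, ← H.rel_add I₀ I J, add_sub_cancel_right,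
      add_sub_cancel_right]
  fold_injective I J h := by
    refine (H.eq_of_fold_rel_eq_zero (J := I) (I := J) ?_)
    have h1 := H.rel_add I₀ J I
    have h2 := congrArg (fold μ) h1
    have h : fold μ (H.rel I I₀) = fold μ (H.rel J I₀) := h
    rw [fold_add, h] at h2
    exact add_eq_right.1 h2
  exists_of_simple I J p h := by
    rw [← H.rel_add I₀ I J, add_sub_cancel_right] at h ⊢
    exact H.rel_eq_simpleRoot h

theorem model_pos_sub (harrow : IsOrientation A arrow) (I₀ I J : ProperIdeal (barLabel μ ε)) :
    (H.model harrow I₀).pos J - (H.model harrow I₀).pos I = H.rel J I := by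
  change H.rel J I₀ - H.rel I I₀ = _
  rw [← H.rel_add I₀ I J, add_sub_cancel_right]

theorem model_sign_of_subset (harrow : IsOrientation A arrow)
    {I₀ I J : ProperIdeal (barLabel μ ε)} (h : I.1 ⊆ J.1) :
    (H.model harrow I₀).sign J I = parity arrow ε (H.diff J I) := by
  change H.relSign arrow (H.inter J I) J I = _
  rw [H.relSign_inter harrow (K := I) subset_rfl h, relSign, H.diff_eq_empty (subset_refl I.1),
    parity_empty, rel, rel, sub_self, sgnLattice_zero_right, mul_one, mul_one]

theorem model_sign_of_superset (harrow : IsOrientation A arrow)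
    {I₀ I J : ProperIdeal (barLabel μ ε)} (h : J.1 ⊆ I.1) :
    (H.model harrow I₀).sign J I =
      parity arrow ε (H.diff I J) * sgnLattice arrow (H.rel I J) (H.rel I J) := by
  change H.relSign arrow (H.inter J I) J I = _
  rw [H.relSign_inter harrow (K := J) h subset_rfl, relSign, H.diff_eq_empty (subset_refl J.1),
    parity_empty, one_mul, H.rel_swap J I, sgnLattice_neg_left]

end FullFolding

section LieQuotient

variable {R L L' : Type*} [CommRing R] [LieRing L] [LieAlgebra R L] [LieRing L'] [LieAlgebra R L']

/-- A homomorphism of Lie algebras that vanishes on an ideal factors through the quotient. -/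
def lieQuotientLift (I : LieIdeal R L) (f : L →ₗ⁅R⁆ L') (h : ∀ x ∈ I, f x = 0) :
    L ⧸ I →ₗ⁅R⁆ L' :=
  { Submodule.liftQ I.toSubmodule (f : L →ₗ[R] L') h with
    map_lie' := by
      rintro ⟨x⟩ ⟨y⟩
      exact f.map_lie x y }

end LieQuotient

theorem sumOp_single {Q E : Type*} [PartialOrder E] (k : Type*) [Field k] (η : E → Q)
    (S : Set (Finset E)) (c : Finset E → ℤˣ) (T : Finset E → Module.End k (VE k η))
    (I : ProperIdeal η) :
    sumOp k η S c T (Finsupp.single I 1) =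
      ∑ᶠ L ∈ S, ((c L : ℤ) : k) • T L (Finsupp.single I 1) := by
  rw [sumOp, Finsupp.linearCombination_single, one_smul]

/-! ### Heap operators as operators of the folded model. -/

section Operators

variable {P E : Type*} [PartialOrder E] {μ : Equiv.Perm P} {ε : E → P} {arrow : P → P → Prop}
  {k : Type*} [Field k]

theorem mem_heapsOf_simpleRoot {Q : Type*} {η : E → Q} {x : Q} {L : Finset E} :
    L ∈ heapsOf η (simpleRoot x) ↔ ∃ a, η a = x ∧ L = {a} := by
  constructor
  · rintro ⟨-, h⟩
    exact exists_eq_singleton η h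
  · rintro ⟨a, rfl, rfl⟩
    refine ⟨?_, character_singleton η a⟩
    rw [Finset.coe_singleton]
    exact Set.ordConnected_singleton

theorem Xv_eq_Xop (x : Orb μ) :
    Xv k (barLabel μ ε) x = Xop k (barLabel μ ε) (parity arrow ε) (simpleRoot x) := by
  refine end_ext fun I => ?_
  rw [Xv, Xop, sumOp_single, sumOp_single]
  refine finsum_mem_congr rfl fun L hL => ?_
  obtain ⟨a, -, rfl⟩ := mem_heapsOf_simpleRoot.1 hL
  rw [parity_singleton]

theorem Yv_eq_Yop (x : Orb μ) :
    Yv k (barLabel μ ε) x = Yop k (barLabel μ ε) (parity arrow ε) (simpleRoot x) := by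
  refine end_ext fun I => ?_
  rw [Yv, Yop, sumOp_single, sumOp_single]
  refine finsum_mem_congr rfl fun L hL => ?_
  obtain ⟨a, -, rfl⟩ := mem_heapsOf_simpleRoot.1 hL
  rw [parity_singleton]

theorem HL_single (L : Finset E) (I : ProperIdeal (barLabel μ ε)) [Decidable (Below L I.1)]
    [Decidable (Above L I.1)] :
    HL k (barLabel μ ε) L (Finsupp.single I 1) =
      if Below L I.1 ∧ ¬ Above L I.1 then Finsupp.single I 1
      else if Above L I.1 ∧ ¬ Below L I.1 then - Finsupp.single I 1 else 0 := by
  rw [HL, Finsupp.linearCombination_single, one_smul]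
  congr

end Operators

namespace FullFolding

variable {P E : Type*} [Fintype P] [PartialOrder E] {A : Matrix P P ℤ} {o : P}
  {μ : Equiv.Perm P} {ε : E → P} (H : FullFolding A o μ ε) {arrow : P → P → Prop}
  (harrow : IsOrientation A arrow) (I₀ : ProperIdeal (barLabel μ ε)) {k : Type*} [Field k]

theorem diff_of_above {I J : ProperIdeal (barLabel μ ε)} {L : Finset E} (hL : Above L I.1)
    (h : J.1 = I.1 ∪ (L : Set E)) : H.diff J I = L := by
  ext a
  rw [H.mem_diff, h, Set.mem_union, Finset.mem_coe]
  have : a ∈ L → a ∉ I.1 := fun haL haI => by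
    have h' : a ∈ I.1 ∩ (L : Set E) := ⟨haI, haL⟩
    rw [hL.2] at h'
    exact h'
  tauto

theorem above_diff {I J : ProperIdeal (barLabel μ ε)} (h : I.1 ⊆ J.1) :
    Above (H.diff J I) I.1 ∧ I.1 ∪ (H.diff J I : Set E) = J.1 := by
  have hu : I.1 ∪ (H.diff J I : Set E) = J.1 := by
    rw [H.coe_diff, Set.union_sdiff_cancel h]
  refine ⟨⟨by rw [hu]; exact J.2.1, ?_⟩, hu⟩
  rw [H.coe_diff]
  exact Set.inter_sdiff_self _ _

theorem diff_of_below {I J : ProperIdeal (barLabel μ ε)} {L : Finset E} (hL : Below L I.1)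
    (h : J.1 = I.1 \ (L : Set E)) : H.diff I J = L := by
  ext a
  rw [H.mem_diff, h, Set.mem_sdiff, Finset.mem_coe]
  have : a ∈ L → a ∈ I.1 := fun haL => hL.1 haL
  tauto

theorem below_diff {I J : ProperIdeal (barLabel μ ε)} (h : J.1 ⊆ I.1) :
    Below (H.diff I J) I.1 ∧ I.1 \ (H.diff I J : Set E) = J.1 := by
  have hu : I.1 \ (H.diff I J : Set E) = J.1 := by
    rw [H.coe_diff, Set.sdiff_sdiff_cancel_left h]
  refine ⟨⟨?_, by rw [hu]; exact J.2.1⟩, hu⟩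
  rw [H.coe_diff]
  exact Set.sdiff_subset

theorem fold_rel_of_subset {I J : ProperIdeal (barLabel μ ε)} (h : I.1 ⊆ J.1) :
    fold μ (H.rel J I) = character (barLabel μ ε) (H.diff J I) := by
  rw [H.rel_of_subset h, fold_character]

/-- On `v_I` at most one `L` acts: the difference `J \ I` for the unique ideal `J` at folded
relative position `γ`. Nonnegativity of `γ` gives `I ⊆ J`. -/
theorem Xop_eq {γ : Orb μ → ℤ} (hγ : 0 ≤ γ) :
    Xop k (barLabel μ ε) (parity arrow ε) γ = (H.model harrow I₀).op k γ := by
  classical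
  refine end_ext fun I => ?_
  rw [Xop, sumOp_single]
  have key : ∀ (L : Finset E) (J : ProperIdeal (barLabel μ ε)), Above L I.1 →
      J.1 = I.1 ∪ (L : Set E) → L ∈ heapsOf (barLabel μ ε) γ →
      fold μ ((H.model harrow I₀).pos J - (H.model harrow I₀).pos I) = γ ∧ H.diff J I = L := by
    intro L J hL hJ hmem
    have hd := H.diff_of_above hL hJ
    refine ⟨?_, hd⟩
    rw [H.model_pos_sub, H.fold_rel_of_subset (by rw [hJ]; exact Set.subset_union_left), hd]
    exact hmem.2
  by_cases hJ : ∃ J, fold μ ((H.model harrow I₀).pos J - (H.model harrow I₀).pos I) = γ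
  · obtain ⟨J, hJ⟩ := hJ
    have hJ' := hJ
    rw [H.model_pos_sub] at hJ'
    have hsub : I.1 ⊆ J.1 := H.subset_of_fold_nonneg (by rw [hJ']; exact hγ)
    have hmem : H.diff J I ∈ heapsOf (barLabel μ ε) γ :=
      ⟨H.ordConnected_diff J I, by rw [← H.fold_rel_of_subset hsub, hJ']⟩
    rw [(H.model harrow I₀).op_of_rel hJ, H.model_sign_of_subset harrow hsub,
      finsum_eq_single _ (H.diff J I)]
    · obtain ⟨hab, hu⟩ := H.above_diff hsub
      rw [finsum_eq_if, if_pos hmem, XL, Finsupp.linearCombination_single, one_smul,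
        dif_pos ⟨hab, by rw [hu]; exact J.2⟩]
      congr 2
      exact Subtype.ext hu
    · intro L hL
      rw [finsum_eq_if]
      split_ifs with hLmem
      · rw [XL, Finsupp.linearCombination_single, one_smul, dif_neg, smul_zero]
        intro hcon
        obtain ⟨h1, h2⟩ := key L ⟨_, hcon.2⟩ hcon.1 rfl hLmem
        exact hL (by rw [← h2, (H.model harrow I₀).eq_of_fold h1 hJ])
      · rfl
  · rw [(H.model harrow I₀).op_of_not hJ]
    refine finsum_mem_eq_zero_of_forall_eq_zero fun L hLmem => ?_
    rw [XL, Finsupp.linearCombination_single, one_smul, dif_neg, smul_zero]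
    intro hcon
    exact hJ ⟨_, (key L ⟨_, hcon.2⟩ hcon.1 rfl hLmem).1⟩

/-- The minus sign is `sgn(b, b) = -1` for the root `b` that is removed; this is why `a` is assumed
to be a root. -/
theorem Yop_eq {a : P → ℤ} (ha : IsRoot A {p | p ≠ o} a) (h0 : 0 ≤ fold μ a) :
    Yop k (barLabel μ ε) (parity arrow ε) (fold μ a) =
      -(H.model harrow I₀).op k (-fold μ a) := by
  classical
  refine end_ext fun I => ?_
  rw [Yop, sumOp_single, LinearMap.neg_apply]
  have key : ∀ (L : Finset E) (J : ProperIdeal (barLabel μ ε)), Below L I.1 →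
      J.1 = I.1 \ (L : Set E) → L ∈ heapsOf (barLabel μ ε) (fold μ a) →
      fold μ ((H.model harrow I₀).pos J - (H.model harrow I₀).pos I) = -fold μ a ∧
        H.diff I J = L := by
    intro L J hL hJ hmem
    have hd := H.diff_of_below hL hJ
    refine ⟨?_, hd⟩
    rw [H.model_pos_sub, H.rel_swap, fold_neg,
      H.fold_rel_of_subset (by rw [hJ]; exact Set.sdiff_subset), hd, hmem.2]
  by_cases hJ : ∃ J, fold μ ((H.model harrow I₀).pos J - (H.model harrow I₀).pos I) = -fold μ a
  · obtain ⟨J, hJ⟩ := hJ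
    have hJ' := hJ
    rw [H.model_pos_sub, H.rel_swap, fold_neg, neg_inj] at hJ'
    have hsub : J.1 ⊆ I.1 := H.subset_of_fold_nonneg (by rw [hJ']; exact h0)
    have hmem : H.diff I J ∈ heapsOf (barLabel μ ε) (fold μ a) :=
      ⟨H.ordConnected_diff I J, by rw [← H.fold_rel_of_subset hsub, hJ']⟩
    have hroot : IsRoot A {p | p ≠ o} (H.rel I J) := by
      rw [← H.model_pos_sub harrow I₀]
      exact (H.model harrow I₀).isRoot_of_isRoot_fold H.root (H.root.isRoot_fold a ha)
        (by rw [H.model_pos_sub, hJ'])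
    rw [(H.model harrow I₀).op_of_rel hJ, H.model_sign_of_superset harrow hsub,
      hroot.sgnLattice_self H.root.affine harrow, finsum_eq_single _ (H.diff I J)]
    · obtain ⟨hab, hu⟩ := H.below_diff hsub
      rw [finsum_eq_if, if_pos hmem, YL, Finsupp.linearCombination_single, one_smul,
        dif_pos ⟨hab, by rw [hu]; exact J.2⟩, mul_neg_one, Units.val_neg, Int.cast_neg, neg_smul,
        neg_neg]
      congr 2
      exact Subtype.ext hu
    · intro L hL
      rw [finsum_eq_if]
      split_ifs with hLmem
      · rw [YL, Finsupp.linearCombination_single, one_smul, dif_neg, smul_zero]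
        intro hcon
        obtain ⟨h1, h2⟩ := key L ⟨_, hcon.2⟩ hcon.1 rfl hLmem
        exact hL (by rw [← h2, (H.model harrow I₀).eq_of_fold h1 hJ])
      · rfl
  · rw [(H.model harrow I₀).op_of_not hJ, neg_zero]
    refine finsum_mem_eq_zero_of_forall_eq_zero fun L hLmem => ?_
    rw [YL, Finsupp.linearCombination_single, one_smul, dif_neg, smul_zero]
    intro hcon
    exact hJ ⟨_, (key L ⟨_, hcon.2⟩ hcon.1 rfl hLmem).1⟩

include H in
-- Adding `a` raises this label by 2 within the range from -1 to 1.
theorem idealWt_of_above {I : ProperIdeal (barLabel μ ε)} {a : E} (h : Above {a} I.1) :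
    idealWt A ε I.1 (ε a) = -1 := by
  rw [Above, Finset.coe_singleton] at h
  have ha : a ∉ I.1 := fun ha => by
    have : a ∈ I.1 ∩ {a} := ⟨ha, rfl⟩
    rw [h.2] at this
    exact this
  have hlow : ∀ c < a, c ∈ I.1 := fun c hc => by
    rcases h.1 hc.le (Or.inr rfl) with h' | h'
    · exact h'
    · exact absurd h' hc.ne
  let J : ProperIdeal (barLabel μ ε) := ⟨insert a I.1, H.isProperIdeal_insert I ha hlow⟩
  have h1 := H.idealWt_insert (J := J) ha rfl (ε a)
  rw [H.root.diag] at h1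
  have h2 := H.idealWt_mem I (ε a)
  have h3 := H.idealWt_mem J (ε a)
  omega

include H in
theorem idealWt_of_below {I : ProperIdeal (barLabel μ ε)} {a : E} (h : Below {a} I.1) :
    idealWt A ε I.1 (ε a) = 1 := by
  rw [Below, Finset.coe_singleton] at h
  have ha : a ∈ I.1 := h.1 rfl
  have hup : ∀ c, a < c → c ∉ I.1 := fun c hc hcI =>
    (h.2 hc.le ⟨hcI, hc.ne'⟩).2 rfl
  let J : ProperIdeal (barLabel μ ε) := ⟨I.1 \ {a}, H.isProperIdeal_erase I ha hup⟩
  have hI : I.1 = insert a J.1 := by simp [J, Set.insert_eq_of_mem ha]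
  have h1 := H.idealWt_insert (I := J) (fun h => h.2 rfl) hI (ε a)
  rw [H.root.diag] at h1
  have h2 := H.idealWt_mem I (ε a)
  have h3 := H.idealWt_mem J (ε a)
  omega

include H in
theorem exists_above {I : ProperIdeal (barLabel μ ε)} {p : P} (h : idealWt A ε I.1 p = -1) :
    ∃ a, ε a = p ∧ Above {a} I.1 ∧ ∀ b, ε b = p → Above {b} I.1 → b = a := by
  obtain ⟨a, ha, hap, hlow⟩ := H.exists_addable I h
  refine ⟨a, hap, ?_, fun b hb hab => ?_⟩
  · have := H.isProperIdeal_insert I ha hlow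
    rw [Above, Finset.coe_singleton, Set.union_singleton]
    exact ⟨this.1, Set.inter_singleton_eq_empty.2 ha⟩
  · rw [Above, Finset.coe_singleton] at hab
    rcases H.full.comparable_of_eq (hb.trans hap.symm) with h' | h'
    · by_contra hne
      have : b ∈ I.1 ∩ {b} := ⟨hlow b (lt_of_le_of_ne h' hne), rfl⟩
      rw [hab.2] at this
      exact this
    · rcases hab.1 h' (Or.inr rfl) with h1 | h1
      · exact absurd h1 ha
      · exact h1.symm

include H in
theorem exists_below {I : ProperIdeal (barLabel μ ε)} {p : P} (h : idealWt A ε I.1 p = 1) :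
    ∃ a, ε a = p ∧ Below {a} I.1 ∧ ∀ b, ε b = p → Below {b} I.1 → b = a := by
  obtain ⟨a, ha, hap, hup⟩ := H.exists_removable I h
  refine ⟨a, hap, ?_, fun b hb hab => ?_⟩
  · have := H.isProperIdeal_erase I ha hup
    rw [Below, Finset.coe_singleton]
    exact ⟨Set.singleton_subset_iff.2 ha, this.1⟩
  · rw [Below, Finset.coe_singleton] at hab
    by_contra hne
    rcases H.full.comparable_of_eq (hb.trans hap.symm) with h' | h'
    · exact (hab.2 h' ⟨ha, Ne.symm hne⟩).2 rfl
    · exact hup b (lt_of_le_of_ne h' (Ne.symm hne)) (hab.1 rfl)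

/-- The finite sum defining the action of a coroot, over the fibre of the unfolded labelling. -/
theorem finsum_HL (H : FullFolding A o μ ε) (I : ProperIdeal (barLabel μ ε)) (p : P) :
    ({L | ∃ a, ε a = p ∧ L = {a}} ∩
      Function.support fun L => HL k (barLabel μ ε) L (Finsupp.single I 1)).Finite ∧
    ∑ᶠ L ∈ {L | ∃ a, ε a = p ∧ L = {a}}, HL k (barLabel μ ε) L (Finsupp.single I 1) =
      (idealWt A ε I.1 p : k) • Finsupp.single I 1 := by
  classical
  have hex : ∃ L₀ : Finset E, ∃ z : k, z = (idealWt A ε I.1 p : k) ∧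
      (z ≠ 0 → L₀ ∈ {L | ∃ a, ε a = p ∧ L = {a}}) ∧
      ∀ L ∈ {L | ∃ a, ε a = p ∧ L = {a}}, HL k (barLabel μ ε) L (Finsupp.single I 1) =
        if L = L₀ then z • Finsupp.single I 1 else 0 := by
    have hab : ∀ a, ε a = p → Above {a} I.1 → idealWt A ε I.1 p = -1 := by
      rintro a rfl h; exact H.idealWt_of_above h
    have hbe : ∀ a, ε a = p → Below {a} I.1 → idealWt A ε I.1 p = 1 := by
      rintro a rfl h; exact H.idealWt_of_below h
    rcases H.idealWt_mem I p with h | h | h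
    · obtain ⟨a, hap, ha, huniq⟩ := H.exists_above h
      refine ⟨{a}, -1, by rw [h]; simp, fun _ => ⟨a, hap, rfl⟩, ?_⟩
      rintro _ ⟨b, hb, rfl⟩
      have hnb : ¬ Below {b} I.1 := fun h' => by have := hbe b hb h'; omega
      rw [HL_single, if_neg fun h' => hnb h'.1]
      by_cases hba : b = a
      · subst hba
        rw [if_pos ⟨ha, hnb⟩, if_pos rfl, neg_one_smul]
      · rw [if_neg fun h' => hba (huniq b hb h'.1), if_neg (by simpa using hba)]
    · refine ⟨∅, 0, by rw [h]; simp, fun h' => absurd rfl h', ?_⟩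
      rintro _ ⟨b, hb, rfl⟩
      have hnb : ¬ Below {b} I.1 := fun h' => by have := hbe b hb h'; omega
      have hna : ¬ Above {b} I.1 := fun h' => by have := hab b hb h'; omega
      rw [HL_single, if_neg fun h' => hnb h'.1, if_neg fun h' => hna h'.1, zero_smul, ite_self]
    · obtain ⟨a, hap, ha, huniq⟩ := H.exists_below h
      refine ⟨{a}, 1, by rw [h]; simp, fun _ => ⟨a, hap, rfl⟩, ?_⟩
      rintro _ ⟨b, hb, rfl⟩
      have hna : ¬ Above {b} I.1 := fun h' => by have := hab b hb h'; omega
      rw [HL_single]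
      by_cases hba : b = a
      · subst hba
        rw [if_pos ⟨ha, hna⟩, if_pos rfl, one_smul]
      · rw [if_neg fun h' => hba (huniq b hb h'.1), if_neg fun h' => hna h'.1,
          if_neg (by simpa using hba)]
  obtain ⟨L₀, z, hz, hmem, hval⟩ := hex
  constructor
  · refine (Set.finite_singleton L₀).subset ?_
    rintro L ⟨hL, hne⟩
    by_contra hLL
    exact hne (by simp only [hval L hL, if_neg (show ¬ L = L₀ from hLL)])
  · rw [← hz, finsum_mem_congr rfl hval, finsum_eq_single _ L₀]
    · rw [if_pos rfl, finsum_eq_if]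
      split_ifs with h
      · rfl
      · have : z = 0 := by by_contra h'; exact h (hmem h')
        rw [this, zero_smul]
    · intro L hL
      simp [hL]

/-- The folded fibre is the union of the fibres of `p` and `μ p`, disjoint unless `p` is fixed, so
the eigenvalue is the folded weight. -/
theorem Hv_eq (x : Orb μ) :
    Hv k (barLabel μ ε) x = diagOp k fun I => (H.model harrow I₀).foldWt I x := by
  classical
  refine end_ext fun I => ?_
  obtain ⟨p, rfl⟩ := bar_surjective x
  rw [Hv, sumOp_single, diagOp_single]
  simp only [Units.val_one, Int.cast_one, one_smul]
  change _ = ((fold μ (idealWt A ε I.1) (bar μ p) : ℤ) : k) • _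
  rw [H.root.folds.fold_bar]
  obtain ⟨hf1, hs1⟩ := finsum_HL (k := k) H I p
  split_ifs with hp
  · rw [← hs1]
    refine finsum_mem_congr ?_ fun _ _ => rfl
    ext L
    rw [mem_heapsOf_simpleRoot]
    refine exists_congr fun a => and_congr_left fun _ => ?_
    rw [barLabel, eq_comm, H.root.folds.bar_eq_bar, hp, or_self]
  · obtain ⟨hf2, hs2⟩ := finsum_HL (k := k) H I (μ p)
    rw [Int.cast_add, add_smul, ← hs1, ← hs2, ← finsum_mem_union' _ hf1 hf2]
    · refine finsum_mem_congr ?_ fun _ _ => rfl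
      ext L
      rw [mem_heapsOf_simpleRoot, Set.mem_union, Set.mem_ofPred_eq, Set.mem_ofPred_eq, ← exists_or]
      refine exists_congr fun a => ?_
      rw [barLabel, eq_comm, H.root.folds.bar_eq_bar, or_and_right]
    · rw [Set.disjoint_left]
      rintro _ ⟨a, ha, rfl⟩ ⟨b, hb, hab⟩
      rw [Finset.singleton_inj] at hab
      subst hab
      exact hp (hb.symm.trans ha)

end FullFolding

/-! ### Coroots of folded roots. -/

namespace FoldedModel

variable {P : Type*} [Fintype P] {A : Matrix P P ℤ} {arrow : P → P → Prop} {μ : Equiv.Perm P}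
  {X : Type*} (M : FoldedModel A arrow μ X) {o : P} (F : RootFolding A o μ)

include F

theorem foldWt_of_rel {γ : Orb μ → ℤ} {I J : X} (h : fold μ (M.pos J - M.pos I) = γ) (x : Orb μ) :
    M.foldWt J x = M.foldWt I x + (foldedMatrix A μ).mulVec γ x := by
  rw [foldWt, foldWt, M.wt_eq I J, fold_add, ← F.folds.foldedMatrix_mulVec F.affine, h,
    Pi.add_apply]

theorem diagOp_lie_op (k : Type*) [Field k] (x : Orb μ) (γ : Orb μ → ℤ) :
    commutatorEnd (diagOp k fun I => M.foldWt I x) (M.op k γ) =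
      (((foldedMatrix A μ).mulVec γ x : ℤ) : k) • M.op k γ :=
  diagOp_lie_shiftOp (R := fun I J => fold μ (M.pos J - M.pos I) = γ)
    (fun _ _ _ => M.eq_of_fold) (fun I => M.foldWt I x) _ fun _ _ h => M.foldWt_of_rel F h x

/-- The length factor 2 for a fixed vertex compensates for its orbit having only one element. -/
theorem sqLen_mul_foldWt (p : P) (I : X) :
    sqLen μ (simpleRoot p) * (M.foldWt I (bar μ p) : ℂ) = M.wt I p + M.wt I (μ p) := by
  have h : act μ (simpleRoot p) = simpleRoot p ↔ μ p = p := by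
    rw [act_simpleRoot]
    refine ⟨fun h => ?_, fun h => by rw [h]⟩
    by_contra hne
    have := congrFun h p
    rw [simpleRoot_self, simpleRoot_of_ne (Ne.symm hne)] at this
    exact zero_ne_one this
  rw [foldWt, F.folds.fold_bar, sqLen]
  by_cases hp : μ p = p
  · rw [if_pos (h.2 hp), if_pos hp, hp]; ring
  · rw [if_neg (mt h.1 hp), if_neg hp]; push_cast; ring

theorem sum_sqLen_mul_foldWt {a : P → ℤ} (ho : a o = 0) (I : X) [Fintype {p : P // p ≠ o}] :
    ∑ p : {p : P // p ≠ o}, (a p : ℂ) * (sqLen μ (simpleRoot (p : P)) *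
      (M.foldWt I (bar μ p) : ℂ)) = M.pair a I + M.pair (act μ a) I := by
  classical
  simp only [M.sqLen_mul_foldWt F]
  rw [← Finset.sum_subtype (Finset.univ.filter fun p => p ≠ o) (by simp)
    (fun p => (a p : ℂ) * ((M.wt I p : ℂ) + M.wt I (μ p))), Finset.sum_filter_of_ne]
  · have h1 : M.pair (act μ a) I = ∑ p, a p * M.wt I (μ p) := by
      rw [LatticeModel.pair, dotProduct, ← Equiv.sum_comp μ]
      simp only [F.folds.act_apply, F.folds.apply_apply]
    rw [h1, LatticeModel.pair, dotProduct]
    push_cast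
    rw [← Finset.sum_add_distrib]
    exact Finset.sum_congr rfl fun p _ => by ring
  · rintro p - hp rfl
    simp [ho] at hp

/-- The action of the coroot of a folded root. -/
theorem sum_smul_diagOp {a : P → ℤ} (ho : a o = 0) [Fintype {p : P // p ≠ o}] :
    ∑ p : {p : P // p ≠ o}, ((a p : ℂ) * (sqLen μ (simpleRoot (p : P)) / sqLen μ a)) •
      diagOp ℂ (fun I => M.foldWt I (bar μ p)) =
    (sqLen μ a)⁻¹ • diagOp ℂ (fun I => M.pair a I + M.pair (act μ a) I) := by
  refine end_ext fun I => ?_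
  rw [LinearMap.sum_apply, LinearMap.smul_apply, diagOp_single, smul_smul]
  simp only [LinearMap.smul_apply, diagOp_single, smul_smul]
  rw [← Finset.sum_smul]
  congr 1
  have h := M.sum_sqLen_mul_foldWt F ho I
  push_cast
  rw [← h, Finset.mul_sum]
  exact Finset.sum_congr rfl fun p _ => by rw [div_eq_mul_inv]; ring

end FoldedModel

/-! ### The representation of Kac's algebra. -/

section Representation

variable {P : Type*} [Fintype P] {A : Matrix P P ℤ} {arrow : P → P → Prop} {μ : Equiv.Perm P}
  {X : Type*} (M : FoldedModel A arrow μ X) {o : P}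

variable (o) in
/-- The homomorphism from the free Lie algebra on the basis symbols. -/
noncomputable def freeRep : FreeLieAlgebra ℂ (Gen A μ o) →ₗ⁅ℂ⁆ Module.End ℂ (X →₀ ℂ) :=
  FreeLieAlgebra.lift ℂ fun g => match g with
    | .h x => diagOp ℂ fun I => M.foldWt I x
    | .e γ => M.op ℂ γ

theorem freeRep_symH (x : finiteOrbs μ o) :
    freeRep M o (symH A μ o x) = diagOp ℂ fun I => M.foldWt I x := by
  rw [freeRep, symH, FreeLieAlgebra.lift_of_apply]

theorem freeRep_symE {γ : Orb μ → ℤ} (h : γ ∈ foldedRoots A μ o) :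
    freeRep M o (symE A μ o γ) = M.op ℂ γ := by
  rw [freeRep, symE, dif_pos h, FreeLieAlgebra.lift_of_apply]

theorem freeRep_lie (x y : FreeLieAlgebra ℂ (Gen A μ o)) :
    freeRep M o ⁅x, y⁆ = commutatorEnd (freeRep M o x) (freeRep M o y) :=
  (freeRep M o).map_lie x y

theorem freeRep_add (x y : FreeLieAlgebra ℂ (Gen A μ o)) :
    freeRep M o (x + y) = freeRep M o x + freeRep M o y :=
  (freeRep M o : FreeLieAlgebra ℂ (Gen A μ o) →ₗ[ℂ] Module.End ℂ (X →₀ ℂ)).map_add x y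

theorem freeRep_sub (x y : FreeLieAlgebra ℂ (Gen A μ o)) :
    freeRep M o (x - y) = freeRep M o x - freeRep M o y :=
  (freeRep M o : FreeLieAlgebra ℂ (Gen A μ o) →ₗ[ℂ] Module.End ℂ (X →₀ ℂ)).map_sub x y

theorem freeRep_smul (c : ℂ) (x : FreeLieAlgebra ℂ (Gen A μ o)) :
    freeRep M o (c • x) = c • freeRep M o x :=
  (freeRep M o : FreeLieAlgebra ℂ (Gen A μ o) →ₗ[ℂ] Module.End ℂ (X →₀ ℂ)).map_smul c x

theorem freeRep_zsmul (n : ℤ) (x : FreeLieAlgebra ℂ (Gen A μ o)) :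
    freeRep M o (n • x) = n • freeRep M o x :=
  map_zsmul (freeRep M o : FreeLieAlgebra ℂ (Gen A μ o) →ₗ[ℂ] Module.End ℂ (X →₀ ℂ)) n x

theorem freeRep_symCoroot (F : RootFolding A o μ) {a : P → ℤ} (ha : IsRoot A {p | p ≠ o} a) :
    freeRep M o (symCoroot A μ o a) =
      (sqLen μ a)⁻¹ • diagOp ℂ (fun I => M.pair a I + M.pair (act μ a) I) := by
  classical
  rw [symCoroot, map_sum]
  refine (Finset.sum_congr rfl fun p _ => ?_).trans
    (M.sum_smul_diagOp F (ha.apply_eq_zero (by simp)))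
  rw [freeRep_smul, freeRep_symH]

/-- Each relator is one of the commutator formulas of the folded model; for the coroots, the
half-sum (fixed root) or sum (moved root) of the pairings of `a` and `μ(a)` is what
`freeRep_symCoroot` produces. -/
theorem freeRep_relator (F : RootFolding A o μ) (harrow : IsOrientation A arrow)
    (hcomp : Compatible μ arrow) {r : FreeLieAlgebra ℂ (Gen A μ o)}
    (hr : IsRelator A μ o arrow r) : freeRep M o r = 0 := by
  induction hr with
  | hh x y =>
    rw [freeRep_lie, freeRep_symH, freeRep_symH]
    exact diagOp_lie_diagOp _ _
  | he x γ hγ =>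
    rw [freeRep_sub, freeRep_smul, freeRep_lie, freeRep_symH, freeRep_symE M hγ,
      M.diagOp_lie_op F]
    exact sub_self (G := Module.End ℂ (X →₀ ℂ)) _
  | ee_neg a ha =>
    have hneg : -fold μ a ∈ foldedRoots A μ o := ⟨-a, ha.neg F.diag, fold_neg a⟩
    rw [freeRep_add, freeRep_lie, freeRep_symE M ⟨a, ha, rfl⟩, freeRep_symE M hneg,
      freeRep_symCoroot M F ha, sqLen]
    by_cases h : act μ a = a
    · rw [if_pos h, M.op_lie_neg_of_act_eq F harrow ha h, h]
      refine end_ext fun I => ?_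
      rw [LinearMap.add_apply, LinearMap.neg_apply, LinearMap.smul_apply, diagOp_single,
        diagOp_single, LinearMap.zero_apply]
      push_cast
      module
    · rw [if_neg h, M.op_lie_neg_of_act_ne F harrow ha h, inv_one, one_smul]
      exact neg_add_cancel (G := Module.End ℂ (X →₀ ℂ)) _
  | ee_zero γ γ' hγ hγ' h h0 =>
    rw [freeRep_lie, freeRep_symE M hγ, freeRep_symE M hγ']
    obtain ⟨a, ha, rfl⟩ := hγ
    obtain ⟨b, hb, rfl⟩ := hγ'
    exact M.op_lie_of_not_mem F harrow ha hb h h0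
  | ee_add a b ha hb hab m hm =>
    obtain ⟨m', -, hm', hbr⟩ := M.op_lie_of_add (k := ℂ) F harrow hcomp ha hb hab
    -- The greatest `m` is unique, so the one in the relator is the one from the bracket formula.
    obtain rfl := hm.unique hm'
    rw [freeRep_sub, freeRep_zsmul, freeRep_lie, freeRep_symE M ⟨a, ha, rfl⟩,
      freeRep_symE M ⟨b, hb, rfl⟩, freeRep_symE M ⟨_, hab, rfl⟩, hbr]
    exact sub_self (G := Module.End ℂ (X →₀ ℂ)) _

/-- The representation of Kac's Lie algebra on the space spanned by a folded model. -/
noncomputable def kacRep (F : RootFolding A o μ) (harrow : IsOrientation A arrow)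
    (hcomp : Compatible μ arrow) : KacAlgebra A μ o arrow →ₗ⁅ℂ⁆ Module.End ℂ (X →₀ ℂ) :=
  lieQuotientLift _ (freeRep M o) fun x hx => by
    have hle : LieSubmodule.lieSpan ℂ (FreeLieAlgebra ℂ (Gen A μ o)) {r | IsRelator A μ o arrow r} ≤
        (freeRep M o).ker :=
      LieSubmodule.lieSpan_le.2 fun r hr => (freeRep M o).mem_ker.2
        (freeRep_relator M F harrow hcomp hr)
    exact (freeRep M o).mem_ker.1 (hle hx)

variable (F : RootFolding A o μ) (harrow : IsOrientation A arrow) (hcomp : Compatible μ arrow)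

theorem kacRep_kacE {γ : Orb μ → ℤ} (h : γ ∈ foldedRoots A μ o) :
    kacRep M F harrow hcomp (kacE A μ o arrow γ) = M.op ℂ γ :=
  freeRep_symE M h

theorem kacRep_neg_kacE {γ : Orb μ → ℤ} (h : γ ∈ foldedRoots A μ o) :
    kacRep M F harrow hcomp (-kacE A μ o arrow γ) = -M.op ℂ γ := by
  rw [map_neg, kacRep_kacE M F harrow hcomp h]

theorem kacRep_kacH (x : finiteOrbs μ o) :
    kacRep M F harrow hcomp (kacH A μ o arrow x) = diagOp ℂ fun I => M.foldWt I x :=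
  freeRep_symH M x

end Representation

theorem fold_nonneg {P : Type*} [Fintype P] {μ : Equiv.Perm P} {a : P → ℤ} (h : 0 ≤ a) :
    0 ≤ fold μ a := fun _ => Finset.sum_nonneg fun p _ => h p

/-! ### Convex sets, nonvanishing and generation. -/

namespace FullFolding

variable {P E : Type*} [Fintype P] [PartialOrder E] {A : Matrix P P ℤ} {o : P}
  {μ : Equiv.Perm P} {ε : E → P} (H : FullFolding A o μ ε) {arrow : P → P → Prop}
  (harrow : IsOrientation A arrow)

include H harrow

theorem exists_rel_eq_root {a : P → ℤ} (ha : IsRoot A {p | p ≠ o} a) :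
    ∃ I J : ProperIdeal (barLabel μ ε), H.rel J I = a := by
  obtain ⟨I₀, -, -⟩ := H.exists_rel_eq_simpleRoot o
  obtain ⟨I, J, h⟩ := (H.model harrow I₀).exists_pos_add_root (fun p => by
    obtain ⟨I, J, h⟩ := H.exists_rel_eq_simpleRoot p
    exact ⟨I, J, by rw [← h, ← H.model_pos_sub harrow I₀]; abel⟩) ha
  exact ⟨I, J, by rw [← H.model_pos_sub harrow I₀, h]; abel⟩

/-- Convex sets of character `f(a)` are differences of nested ideals, so the dichotomy for
differences of positions applies to their unfolded characters. -/
theorem heapsOf_fold {a : P → ℤ} (ha : IsRoot A {p | p ≠ o} a) (h0 : 0 ≤ a) :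
    (heapsOf (barLabel μ ε) (fold μ a)).Nonempty ∧
      ∀ L ∈ heapsOf (barLabel μ ε) (fold μ a), L ∈ heapsOf ε a ∪ heapsOf ε (act μ a) := by
  constructor
  · obtain ⟨I, J, h⟩ := H.exists_rel_eq_root harrow ha
    have hsub : I.1 ⊆ J.1 := H.subset_of_fold_nonneg (by rw [h]; exact fold_nonneg h0)
    exact ⟨H.diff J I, H.ordConnected_diff J I, by rw [← H.fold_rel_of_subset hsub, h]⟩
  · rintro L ⟨hconv, hL⟩
    -- An empty `L` would give `f(a) = 0`, contradicting the norm 4 or 8 of `a + μ(a)`.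
    have hne : L.Nonempty := by
      by_contra hne
      rw [Finset.not_nonempty_iff_eq_empty] at hne
      subst hne
      rw [character_empty, ← fold_zero] at hL
      have h1 := H.root.folds.form_add_act H.root.affine (H.root.isRoot_fold a ha) rfl
      rw [← H.root.folds.add_act_eq hL] at h1
      have h2 : (0 : P → ℤ) + act μ 0 = 0 := by funext p; simp [act]
      rw [h2] at h1
      simp [form] at h1
    obtain ⟨I, J, hsub, rfl⟩ := H.exists_diff_eq hconv hne
    rw [← H.fold_rel_of_subset hsub, ← H.model_pos_sub harrow I] at hL
    have h := (H.model harrow I).eq_or_eq_act H.root ha hL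
    rw [H.model_pos_sub, H.rel_of_subset hsub] at h
    exact h.imp (fun h => ⟨hconv, h⟩) fun h => ⟨hconv, h⟩

variable (k : Type*) [Field k]

/-- Some pair of ideals differs by the root `a`, and there the coefficient is ±1. -/
theorem op_ne_zero (I₀ : ProperIdeal (barLabel μ ε)) {a : P → ℤ}
    (ha : IsRoot A {p | p ≠ o} a) : (H.model harrow I₀).op k (fold μ a) ≠ 0 := by
  intro h
  obtain ⟨I, J, hJ⟩ := H.exists_rel_eq_root harrow ha
  have h1 := (H.model harrow I₀).op_of_rel (k := k) (γ := fold μ a) (I := I) (J := J)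
    (by rw [H.model_pos_sub, hJ])
  rw [h, LinearMap.zero_apply] at h1
  have h2 := congrArg (fun v => v J) h1
  rcases Int.units_eq_one_or ((H.model harrow I₀).sign J I) with hs | hs <;> simp [hs] at h2

variable (hcomp : Compatible μ arrow) (hk : (2 : k) ≠ 0)

include hcomp hk

theorem Xop_mem {a : P → ℤ} (ha : IsRoot A {p | p ≠ o} a) (h0 : 0 ≤ a) :
    Xop k (barLabel μ ε) (parity arrow ε) (fold μ a) ≠ 0 ∧
      Xop k (barLabel μ ε) (parity arrow ε) (fold μ a) ∈
        LieSubalgebra.lieSpan k (Module.End k (VE k (barLabel μ ε)))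
          (Set.range (Xv k (barLabel μ ε))) := by
  obtain ⟨I₀, -, -⟩ := H.exists_rel_eq_simpleRoot o
  set W := LieSubalgebra.lieSpan k (Module.End k (VE k (barLabel μ ε)))
    (Set.range (Xv k (barLabel μ ε)))
  rw [H.Xop_eq harrow I₀ (fold_nonneg h0)]
  refine ⟨H.op_ne_zero harrow k I₀ ha, ?_⟩
  have := (H.model harrow I₀).op_mem_of_simple (k := k) H.root harrow hcomp hk W.toSubmodule
    (fun f hf g hg => W.lie_mem hf hg) (u := 1) (Or.inl rfl) (fun p hp => ?_) ha h0
  · rwa [one_smul] at this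
  · rw [one_smul, ← H.Xop_eq harrow I₀ (fold_nonneg fun q => ?_), fold_simpleRoot, ← Xv_eq_Xop]
    · exact LieSubalgebra.subset_lieSpan ⟨_, rfl⟩
    · classical
      rw [simpleRoot_apply]; split_ifs <;> simp

theorem Yop_mem {a : P → ℤ} (ha : IsRoot A {p | p ≠ o} a) (h0 : 0 ≤ a) :
    Yop k (barLabel μ ε) (parity arrow ε) (fold μ a) ≠ 0 ∧
      Yop k (barLabel μ ε) (parity arrow ε) (fold μ a) ∈
        LieSubalgebra.lieSpan k (Module.End k (VE k (barLabel μ ε)))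
          (Set.range (Yv k (barLabel μ ε))) := by
  obtain ⟨I₀, -, -⟩ := H.exists_rel_eq_simpleRoot o
  set W := LieSubalgebra.lieSpan k (Module.End k (VE k (barLabel μ ε)))
    (Set.range (Yv k (barLabel μ ε)))
  rw [H.Yop_eq harrow I₀ ha (fold_nonneg h0), ← fold_neg]
  refine ⟨fun h => H.op_ne_zero harrow k I₀ (ha.neg H.root.diag) ?_, W.neg_mem ?_⟩
  · rw [← neg_neg ((H.model harrow I₀).op k _), h]
    exact neg_zero (G := Module.End k (VE k (barLabel μ ε)))
  have := (H.model harrow I₀).op_mem_of_simple (k := k) H.root harrow hcomp hk W.toSubmodule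
    (fun f hf g hg => W.lie_mem hf hg) (u := -1) (Or.inr rfl) (fun p hp => ?_) ha h0
  · rwa [neg_one_smul] at this
  · have h1 := H.Yop_eq (k := k) harrow I₀ (.simple p hp) (fold_nonneg fun q => ?_)
    · rw [fold_simpleRoot, ← Yv_eq_Yop] at h1
      rw [neg_one_smul, fold_neg, fold_simpleRoot, ← neg_neg ((H.model harrow I₀).op k _), ← h1]
      exact W.neg_mem (LieSubalgebra.subset_lieSpan ⟨_, rfl⟩)
    · classical
      rw [simpleRoot_apply]; split_ifs <;> simp

end FullFolding

end FoldedHeap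

theorem proposition6p5 {P E : Type*} [Fintype P] [PartialOrder E]
    (A : Matrix P P ℤ) (o : P) (hA : IsSimplyLacedAffine A o)
    (ε : E → P) (hE : IsFull A ε)
    (μ : Equiv.Perm P) (hμ : Folds A μ) (hfold : HeapFolds A μ ε)
    (hfin : IsFiniteType (foldedFinite A μ o))
    (hroots : ∀ α, IsRoot A {p | p ≠ o} α → IsRoot (foldedMatrix A μ) (finiteOrbs μ o) (fold μ α))
    (arrow : P → P → Prop) (harrow : IsOrientation A arrow) (hcomp : Compatible μ arrow)
    (k : Type*) [Field k] (hk : ringChar k ≠ 2) :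
    (∀ α : P → ℤ, IsRoot A {p | p ≠ o} α → 0 ≤ α →
      ((heapsOf (barLabel μ ε) (fold μ α)).Nonempty ∧
        ∀ L ∈ heapsOf (barLabel μ ε) (fold μ α), L ∈ heapsOf ε α ∪ heapsOf ε (act μ α)) ∧
      (Xop k (barLabel μ ε) (parity arrow ε) (fold μ α) ≠ 0 ∧
        Xop k (barLabel μ ε) (parity arrow ε) (fold μ α) ∈
          LieSubalgebra.lieSpan k (Module.End k (VE k (barLabel μ ε)))
            (Set.range (Xv k (barLabel μ ε)))) ∧
      (Yop k (barLabel μ ε) (parity arrow ε) (fold μ α) ≠ 0 ∧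
        Yop k (barLabel μ ε) (parity arrow ε) (fold μ α) ∈
          LieSubalgebra.lieSpan k (Module.End k (VE k (barLabel μ ε)))
            (Set.range (Yv k (barLabel μ ε))))) ∧
    ∃ ρ : KacAlgebra A μ o arrow →ₗ⁅ℂ⁆ Module.End ℂ (VE ℂ (barLabel μ ε)),
      (∀ x : finiteOrbs μ o,
        ρ (kacE A μ o arrow (simpleRoot (x : Orb μ))) = Xv ℂ (barLabel μ ε) x ∧
        ρ (-kacE A μ o arrow (-simpleRoot (x : Orb μ))) = Yv ℂ (barLabel μ ε) x ∧
        ρ (kacH A μ o arrow x) = Hv ℂ (barLabel μ ε) x) ∧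
      ∀ α : P → ℤ, IsRoot A {p | p ≠ o} α → 0 ≤ α →
        ρ (kacE A μ o arrow (fold μ α)) =
          Xop ℂ (barLabel μ ε) (parity arrow ε) (fold μ α) ∧
        ρ (-kacE A μ o arrow (-fold μ α)) =
          Yop ℂ (barLabel μ ε) (parity arrow ε) (fold μ α) := by
  have hμo := hμ.apply_o hA hfin
  have H : FullFolding A o μ ε := ⟨⟨hA, hμ, hμo, hroots⟩, hE, hfold⟩
  refine ⟨fun α hα h0 => ⟨H.heapsOf_fold harrow hα h0,
    H.Xop_mem harrow k hcomp (Ring.two_ne_zero hk) hα h0,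
    H.Yop_mem harrow k hcomp (Ring.two_ne_zero hk) hα h0⟩, ?_⟩
  obtain ⟨I₀, -, -⟩ := H.exists_rel_eq_simpleRoot o
  have hX : ∀ α, IsRoot A {p | p ≠ o} α → 0 ≤ α →
      kacRep (H.model harrow I₀) H.root harrow hcomp (kacE A μ o arrow (fold μ α)) =
        Xop ℂ (barLabel μ ε) (parity arrow ε) (fold μ α) := fun α hα h0 => by
    rw [H.Xop_eq harrow I₀ (fold_nonneg h0), kacRep_kacE _ _ _ _ ⟨α, hα, rfl⟩]
  have hY : ∀ α, IsRoot A {p | p ≠ o} α → 0 ≤ α →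
      kacRep (H.model harrow I₀) H.root harrow hcomp (-kacE A μ o arrow (-fold μ α)) =
        Yop ℂ (barLabel μ ε) (parity arrow ε) (fold μ α) := fun α hα h0 => by
    rw [H.Yop_eq harrow I₀ hα (fold_nonneg h0),
      kacRep_neg_kacE _ _ _ _ ⟨-α, hα.neg H.root.diag, fold_neg α⟩]
  refine ⟨kacRep (H.model harrow I₀) H.root harrow hcomp, ?_, fun α hα h0 =>
    ⟨hX α hα h0, hY α hα h0⟩⟩
  rintro ⟨x, p, hp, rfl⟩
  have hsp : (0 : P → ℤ) ≤ simpleRoot p := fun q => by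
    classical
    rw [simpleRoot_apply]; split_ifs <;> simp
  have h1 := hX _ (.simple p hp) hsp
  have h2 := hY _ (.simple p hp) hsp
  rw [fold_simpleRoot] at h1 h2
  exact ⟨h1.trans (Xv_eq_Xop _).symm, h2.trans (Yv_eq_Yop _).symm, by
    rw [kacRep_kacH, H.Hv_eq harrow I₀]⟩
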